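/- **Setting.** Let $\Delta(n)$ be the simplex, $x_U=(1/n,\dots,1/n)$, $H(v)=-\sum_i v_i\log v_i$, and $H_c=\{v\in\Delta(n):H(v)\ge c\}$. A preference model is a map $M:\Delta(n)\to[0,1]^n$ (extended by the all-ones vector off $\Delta(n)$); it is $\lambda$-dispersed if $M(v)_i\ge\lambda$ for all $v\in\Delta(n)$ and all $i$. In each of $T$ rounds the Recommender shows a menu $K$ of $k$ of the $n$ items; the Agent picks $i\in K$ with probability $p_{K,v,i}=M(v)_i/\sum_{j\in K}M(v)_j$, where $v$ is the normalized histogram of the items picked so far; the Recommender sees $i$ and receives the reward $\rho_t(e_i)$. The $\rho_1,\dots,\rho_T$ are fixed in advance, linear, $G$-Lipschitz on $\Delta(n)$ in the Euclidean norm, with values in $[0,1]$. Let $\mathrm{IRD}(v,M)$ be the convex hull of the vectors $p_{K,v}$ over all menus $K$, and $\mathrm{EIRD}(M)=\bigcap_{v\in\Delta(n)}\mathrm{IRD}(v,M)$. The regret against $x\in\Delta(n)$ is $\sum_t\rho_t(x)-\mathbb E\sum_t\rho_t(e_{i_t})$. A class $\mathcal M$ of preference models is *$S$-locally learnable around $x_U$*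 if there is an algorithm $\mathcal A$ which for every $\alpha>0$ and $\epsilon'\in(0,1]$ names $S$ points of $\Delta(n)$ within Euclidean distance $\alpha$ of $x_U$ and, for every $M\in\mathcal M$, from estimates of the normalized scores $M(x)/\sum_jM(x)_j$ at these points with $\ell_\infty$-error at most $\beta=\epsilon'/F(\alpha)$ ($F(\alpha)>0$ not depending on $\epsilon'$) produces a hypothesis $\hat M$ whose normalized scores have Euclidean error at most $\epsilon'$ at every point of $\Delta(n)$. **Algorithm**, with parameters $t_{pad},t_{move},t_{query},\alpha,\epsilon',r,\epsilon,\delta,\eta$. *Learning phase*, of length $t_0=t_{pad}+S(2t_{move}+t_{query})$. For $t_{pad}$ rounds show the $k$ items with the smallest counts. Then, for each of the $S$ points $x$ which $\mathcal A$ names for $(\alpha,\epsilon')$: 1. for $t_{move}$ rounds show the $k$ items with the largest missing counts for having histogram $x$ at the end of these rounds; 2. for $t_{query}$ rounds show $\lceil (n-1)/(k-1)\rceil$ menus, each for equally many consecutive rounds, which all contain item $1$ and together cover all items; estimate the normalized scores at $x$ by the frequencies relative to item $1$; 3. for $t_{move}$ rounds move back to $x_U$ as in step 1. Ties are broken uniformly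 at random. Let $\hat M$ be the hypothesis of $\mathcal A$ for these estimates. *Optimization phase.* Identify the hyperplane $\sum_i x_i=1$ with $\mathbb R^{n-1}$ by dropping the last coordinate and translating $x_U$ to $0$. Put $x_{t_0+1}=0$ and $\mathcal K_{t_0}=H_c$. In round $t>t_0$ draw $u_t$ uniformly from the unit sphere of $\mathbb R^{n-1}$, independently of the past, and sample the menu from a solution $z_t$ of the linear program "$z_t$ is a distribution over menus which induces the item distribution $x_t+\delta u_t$ under the scores $\hat M(v)$ at the current memory vector $v$". With $\phi_t=1-\rho_t(e_{i_t})$, $g_t=\frac{n-1}{\delta}\phi_tu_t$ and $\mathcal K$ the intersection of $H_c$ with the sets $\mathrm{IRD}(v,\hat M)$ for the memory vectors $v$ after the rounds $t_0+1,\dots,t$, let $x_{t+1}$ be the Euclidean projection of $x_t-\eta g_t$ to $\{x:\frac{r}{r-\delta-\epsilon}x\in\mathcal K\}$. **Theorem.** There are absolute constants $C>0$ and $p\in\mathbb N$ with the following property. Let $2\le k\le n$, $S\ge1$, $\lambda\ge k^2/n$, $L\in\mathbb R$, $c<\log n$, and let $\mathcal M$ be $S$-locally learnable around $x_U$ by $\mathcal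 A$. There are $r$ and $\alpha$ with $$0<r\le C\frac{k^2}{n},\qquad \frac1C\cdot\frac{k}{n^2S}\le\alpha\le C\frac{k}{n^2S},$$ and $C',T_0$ (depending on $n,k,S,\lambda,L,c,\mathcal M,\mathcal A$ only), such that for every $T\ge T_0$ the algorithm can be run with $\epsilon=\delta=rT^{-1/4}$, $\eta=2/(nT^{3/4})$, accuracy $\epsilon'\in[\epsilon/C',\epsilon]$, numbers $t_{pad},t_{move}\in[\frac1{C'\epsilon^3},\frac{C'\log^pT}{\epsilon^3}]$ and $t_{query}\in[\frac1{C'\epsilon^2},\frac{C'\log^pT}{\epsilon^2}]$, so that $t_0\le C'T^{3/4}\log^pT$, and a suitable (measurable) rule for selecting a solution of the linear program from the current estimated scores, $x_t$ and $\delta u_t$, such that for every $\lambda$-dispersed $M\in\mathcal M$ with $L$-Lipschitz scoring functions $v\mapsto M(v)_i$ on $\Delta(n)$, and for all $G$ and $\rho_1,\dots,\rho_T$ as above: 1. for every $x\in H_c\cap\mathrm{EIRD}(M)$ the regret against $x$ is at most $$C\Big(t_0+nGT^{3/4}+\frac{(\delta+\epsilon)GT}{r}+\epsilon GT\Big),$$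 and it is at most $C'T^{3/4}\log^pT$; 2. with probability at least $1-CT^{-1/4}$ the empirical item distribution $v_T$ of all $T$ rounds satisfies $\min_{x\in H_c}d_{TV}(x,v_T)\le C\epsilon$. -/

import Mathlib

open MeasureTheory
open scoped BigOperators

/-! ### Preference models, entropy constraints, realizable distributions -/

/-- A preference model: memory vectors are mapped to score vectors in `[0,1]^n`; off the simplex
(in particular at the empty history) all scores are `1`. -/
structure PreferenceModel (n : ℕ) where
  score : (Fin n → ℝ) → Fin n → ℝ
  score_mem : ∀ v i, score v i ∈ Set.Icc (0 : ℝ) 1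
  score_off : ∀ v, v ∉ stdSimplex ℝ (Fin n) → ∀ i, score v i = 1

/-- The uniform vector `x_U`. -/
noncomputable def uniformVec (n : ℕ) : Fin n → ℝ := fun _ => 1 / (n : ℝ)

/-- Euclidean distance. -/
noncomputable def l2dist {n : ℕ} (x y : Fin n → ℝ) : ℝ := Real.sqrt (∑ i, (x i - y i) ^ 2)

/-- Total variation distance of two distributions. -/
noncomputable def tvDist {n : ℕ} (x y : Fin n → ℝ) : ℝ := (1 / 2) * ∑ i, |x i - y i|

/-- Value at `x` of the linear reward function with coefficients `a` (so `a i` is the reward of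
item `i`). -/
noncomputable def linearReward {n : ℕ} (a x : Fin n → ℝ) : ℝ := ∑ i, a i * x i

/-- Shannon entropy (natural logarithm). -/
noncomputable def entropy {n : ℕ} (v : Fin n → ℝ) : ℝ := ∑ i, Real.negMulLog (v i)

/-- The diversity constraint `H_c`. -/
def entropySet (n : ℕ) (c : ℝ) : Set (Fin n → ℝ) :=
  {v | v ∈ stdSimplex ℝ (Fin n) ∧ c ≤ entropy v}

/-- `H_c` is `ε`-satisfied by `v`. -/
def EntropySatisfied {n : ℕ} (c ε : ℝ) (v : Fin n → ℝ) : Prop :=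
  ∃ x ∈ entropySet n c, tvDist x v ≤ ε

/-- Choice distribution over the menu `K` when the scores are `s`. -/
noncomputable def menuDist {n : ℕ} (s : Fin n → ℝ) (K : Finset (Fin n)) : Fin n → ℝ :=
  fun i => if i ∈ K then s i / ∑ j ∈ K, s j else 0

/-- Instantaneously realizable distributions at `v` for the score function `F`. -/
noncomputable def IRD {n : ℕ} (k : ℕ) (F : (Fin n → ℝ) → Fin n → ℝ) (v : Fin n → ℝ) :
    Set (Fin n → ℝ) :=
  convexHull ℝ {p | ∃ K : Finset (Fin n), K.card = k ∧ p = menuDist (F v) K}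

/-- Everywhere instantaneously realizable distributions. -/
noncomputable def EIRD {n : ℕ} (k : ℕ) (F : (Fin n → ℝ) → Fin n → ℝ) : Set (Fin n → ℝ) :=
  ⋂ v ∈ stdSimplex ℝ (Fin n), IRD k F v

def Dispersed {n : ℕ} (lam : ℝ) (M : PreferenceModel n) : Prop :=
  ∀ v ∈ stdSimplex ℝ (Fin n), ∀ i, lam ≤ M.score v i

/-- Every scoring function `v ↦ M(v)_i` is `L`-Lipschitz on the simplex. -/
def LipschitzScores {n : ℕ} (L : ℝ) (M : PreferenceModel n) : Prop :=
  ∀ v ∈ stdSimplex ℝ (Fin n), ∀ w ∈ stdSimplex ℝ (Fin n), ∀ i,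
    |M.score v i - M.score w i| ≤ L * l2dist v w

/-- Rescaling of a score vector to total mass `1`. -/
noncomputable def normalizeScores {n : ℕ} (s : Fin n → ℝ) : Fin n → ℝ := fun i => s i / ∑ j, s j

/-- A local learning algorithm for the class `𝓜` around `vstar` with `S` queries.
For every radius `α > 0` and target accuracy `ε` it names `S` query points within distance `α` of
`vstar`; from answers which approximate the normalized scores at these points up to
`β = ε / F(α)` (so `β = Θ(ε)`, with a constant independent of the accuracy) it produces a hypothesis
whose normalized scores are `ε`-accurate on the whole simplex, whatever the model in the class. -/
structure LocalLearner {n : ℕ} (𝓜 : Set (PreferenceModel n)) (vstar : Fin n → ℝ) (S : ℕ) where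
  points : (α ε : ℝ) → Fin S → Fin n → ℝ
  hypothesis : (α ε : ℝ) → (Fin S → Fin n → ℝ) → (Fin n → ℝ) → Fin n → ℝ
  errorFactor : ℝ → ℝ
  errorFactor_pos : ∀ α, 0 < α → 0 < errorFactor α
  points_mem : ∀ α ε, 0 < α → 0 < ε → ε ≤ 1 → ∀ j,
    points α ε j ∈ stdSimplex ℝ (Fin n) ∧ l2dist (points α ε j) vstar ≤ α
  accurate : ∀ α ε, 0 < α → 0 < ε → ε ≤ 1 → ∀ M ∈ 𝓜, ∀ answers : Fin S → Fin n → ℝ,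
    (∀ j i, |answers j i - normalizeScores (M.score (points α ε j)) i| ≤ ε / errorFactor α) →
    ∀ x ∈ stdSimplex ℝ (Fin n),
      l2dist (normalizeScores (hypothesis α ε answers x)) (normalizeScores (M.score x)) ≤ ε

/-! ### Interaction protocol -/

/-- What the Recommender sees in one round: its menu, the chosen item, the item's reward. -/
structure Obs (n : ℕ) where
  menu : Finset (Fin n)
  item : Fin n
  reward : ℝ

/-- Number of selections of the item with index `m`. -/
def itemCount {n : ℕ} (h : List (Obs n)) (m : ℕ) : ℕ := h.countP (fun o => o.item.val = m)

/-- Memory vector: normalized histogram of the items selected so far (the zero vector, which is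
not in the simplex, for the empty history). -/
noncomputable def memory {n : ℕ} (h : List (Obs n)) : Fin n → ℝ :=
  fun i => (itemCount h i.val : ℝ) / (h.length : ℝ)

/-- Weights `z` on menus form a probability distribution on the menus of size `k`. -/
def IsMenuDistribution {n : ℕ} (k : ℕ) (z : Finset (Fin n) → ℝ) : Prop :=
  (∀ K, 0 ≤ z K) ∧ (∀ K, K.card ≠ k → z K = 0) ∧ ∑ K, z K = 1

/-- The simplex in `n - 1` free coordinates, centred at the uniform vector. -/
abbrev Reduced (n : ℕ) : Type := EuclideanSpace ℝ (Fin (n - 1))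

/-- The point of the hyperplane of total mass `1` with reduced coordinates `w`; the last
coordinate is determined by the others, and `0` goes to the uniform vector. -/
noncomputable def lift {n : ℕ} (w : Reduced n) : Fin n → ℝ :=
  fun i => if h : i.val < n - 1 then 1 / (n : ℝ) + w ⟨i.val, h⟩ else 1 / (n : ℝ) - ∑ j, w j

/-- Uniform probability distribution on the unit sphere of the reduced space. -/
noncomputable def sphereUniform (n : ℕ) : Measure (Metric.sphere (0 : Reduced n) 1) :=
  ((volume : Measure (Reduced n)).toSphere Set.univ)⁻¹ • (volume : Measure (Reduced n)).toSphere

/-- A (randomized) Recommender policy: given internal directions `u_0, u_1, …` and the observed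
history, a distribution over menus for the next round. -/
abbrev Policy (n : ℕ) : Type := (ℕ → Reduced n) → List (Obs n) → Finset (Fin n) → ℝ

/-- The menu and the item of each of the `T` rounds. -/
abbrev Trajectory (n T : ℕ) : Type := Fin T → Finset (Fin n) × Fin n

/-- The history observed by the Recommender along a trajectory. -/
def observed {n T : ℕ} (ρ : Fin T → Fin n → ℝ) (τ : Trajectory n T) : List (Obs n) :=
  List.ofFn fun t => ⟨(τ t).1, (τ t).2, ρ t (τ t).2⟩

/-- Conditional probability of a trajectory given the directions `u`: in every round the menu is
drawn from the policy and the item from the Agent's choice distribution at its memory vector. -/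
noncomputable def trajectoryProb {n T : ℕ} (π : Policy n) (M : PreferenceModel n)
    (ρ : Fin T → Fin n → ℝ) (u : ℕ → Reduced n) (τ : Trajectory n T) : ℝ :=
  ∏ t : Fin T, π u ((observed ρ τ).take t.val) (τ t).1 *
    menuDist (M.score (memory ((observed ρ τ).take t.val))) (τ t).1 (τ t).2

/-- The directions as an infinite sequence (only the first `T` are ever used). -/
noncomputable def directions {n T : ℕ} (ω : Fin T → Metric.sphere (0 : Reduced n) 1) :
    ℕ → Reduced n :=
  fun t => if h : t < T then (ω ⟨t, h⟩ : Reduced n) else 0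

/-- Expectation of a function of the trajectory over `T` rounds: the directions are independent
and uniform on the unit sphere. -/
noncomputable def expectation {n T : ℕ} (π : Policy n) (M : PreferenceModel n)
    (ρ : Fin T → Fin n → ℝ) (f : Trajectory n T → ℝ) : ℝ :=
  ∫ ω : Fin T → Metric.sphere (0 : Reduced n) 1,
    ∑ τ : Trajectory n T, trajectoryProb π M ρ (directions ω) τ * f τ
    ∂(Measure.pi fun _ => sphereUniform n)

open Classical in
/-- Probability of an event about the trajectory. -/
noncomputable def probability {n T : ℕ} (π : Policy n) (M : PreferenceModel n)
    (ρ : Fin T → Fin n → ℝ) (E : Trajectory n T → Prop) : ℝ :=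
  expectation π M ρ (fun τ => if E τ then 1 else 0)

/-- Expected regret over `T` rounds against playing the item distribution `x` in every round. -/
noncomputable def regretAgainst {n T : ℕ} (π : Policy n) (M : PreferenceModel n)
    (ρ : Fin T → Fin n → ℝ) (x : Fin n → ℝ) : ℝ :=
  ∑ t, linearReward (ρ t) x - expectation π M ρ (fun τ => ∑ t, ρ t (τ t).2)

/-! ### The learning phase -/

open Classical in
/-- The menus of `k` items with the largest values of `d` (several ones in the case of ties). -/
noncomputable def topMenus {n : ℕ} (k : ℕ) (d : Fin n → ℝ) : Finset (Finset (Fin n)) :=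
  (Finset.univ.powersetCard k).filter fun K => ∀ i ∈ K, ∀ j, j ∉ K → d j ≤ d i

open Classical in
/-- Show the `k` items with the largest values of `d`, ties being broken uniformly at random. -/
noncomputable def playTop {n : ℕ} (k : ℕ) (d : Fin n → ℝ) : Finset (Fin n) → ℝ :=
  fun K => if K ∈ topMenus k d then 1 / ((topMenus k d).card : ℝ) else 0

open Classical in
/-- Show a fixed menu. -/
noncomputable def playMenu {n : ℕ} (K₀ : Finset (Fin n)) : Finset (Fin n) → ℝ :=
  fun K => if K = K₀ then 1 else 0

/-- `UniformPad`: show the `k` items with the smallest counts. -/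
noncomputable def uniformPad {n : ℕ} (k : ℕ) (h : List (Obs n)) : Finset (Fin n) → ℝ :=
  playTop k fun i => -(itemCount h i.val : ℝ)

/-- `MoveTo(x)`, to be completed after `tEnd` rounds in total: show the `k` items with the largest
number of selections missing for the histogram `tEnd • x`. -/
noncomputable def moveTo {n : ℕ} (k : ℕ) (x : Fin n → ℝ) (tEnd : ℕ) (h : List (Obs n)) :
    Finset (Fin n) → ℝ :=
  playTop k fun i => (tEnd : ℝ) * x i - (itemCount h i.val : ℝ)

/-- Number of menus used by a query: `(n-1)/(k-1)`, rounded up. -/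
def numQueryMenus (n k : ℕ) : ℕ := (n - 1 + (k - 2)) / (k - 1)

/-- The `b`-th query menu: the item of index `0` and a block of `k - 1` consecutive items (the last
block is shifted so that it ends with the last item). -/
def queryMenu (n k b : ℕ) : Finset (Fin n) :=
  Finset.univ.filter fun i => i.val = 0 ∨
    (min (1 + b * (k - 1)) (n - (k - 1)) ≤ i.val ∧
      i.val < min (1 + b * (k - 1)) (n - (k - 1)) + (k - 1))

/-- Score estimate from a query which started after `start` rounds and held each menu for `tBlock`
rounds: frequency of each item relative to item `0` while the item's menu was shown, rescaled to
total mass `1`. -/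
noncomputable def queryEstimate {n : ℕ} (k start tBlock : ℕ) (h : List (Obs n)) : Fin n → ℝ :=
  normalizeScores fun i =>
    if i.val = 0 then 1 else
      (itemCount ((h.drop (start + (i.val - 1) / (k - 1) * tBlock)).take tBlock) i.val : ℝ) /
        (itemCount ((h.drop (start + (i.val - 1) / (k - 1) * tBlock)).take tBlock) 0 : ℝ)

/-! ### The optimization phase -/

/-- A solver for the linear program of `PlayDist`: given estimated scores `s` and a target
`x + w` (`x` the iterate and `w` the exploration step), it returns a menu
distribution which induces the target under `s` whenever there is one. -/
structure LPSolver (n k : ℕ) where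
  sol : (s : Fin n → ℝ) → (x w : Reduced n) → Finset (Fin n) → ℝ
  isMenuDistribution : ∀ s x w, IsMenuDistribution k (sol s x w)
  solves : ∀ s x w,
    (∃ z : Finset (Fin n) → ℝ, IsMenuDistribution k z ∧
      ∑ K, z K • menuDist s K = lift (x + w)) →
    ∑ K, sol s x w K • menuDist s K = lift (x + w)
  measurable : ∀ s K, Measurable fun q : Reduced n × Reduced n => sol s q.1 q.2 K

/-- Parameters of the algorithm. -/
structure Params (n k : ℕ) where
  tPad : ℕ
  tMove : ℕ
  /-- number of rounds for which a query holds each of its menus -/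
  tBlock : ℕ
  /-- radius of the ball of query points -/
  alpha : ℝ
  /-- accuracy requested from the local learner -/
  accuracy : ℝ
  r : ℝ
  delta : ℝ
  eps : ℝ
  /-- step size -/
  eta : ℝ
  lp : LPSolver n k

namespace Params

variable {n k : ℕ}

def tQuery (P : Params n k) : ℕ := numQueryMenus n k * P.tBlock

/-- Length of one pass of the learning loop: move to the query point, query, move back. -/
def tCycle (P : Params n k) : ℕ := 2 * P.tMove + P.tQuery

/-- Length of the learning phase with `S` queries. -/
def tLearn (P : Params n k) (S : ℕ) : ℕ := P.tPad + S * P.tCycle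

end Params

open Classical in
/-- Euclidean projection to a closed convex set (`0` if no nearest point exists). -/
noncomputable def proj {n : ℕ} (K : Set (Reduced n)) (y : Reduced n) : Reduced n :=
  if h : ∃ x ∈ K, ∀ z ∈ K, dist y x ≤ dist y z then h.choose else 0

section Algorithm

variable {n k S : ℕ} {𝓜 : Set (PreferenceModel n)}

/-- Learning phase, after the history `h`. -/
noncomputable def learnStep (A : LocalLearner 𝓜 (uniformVec n) S) (P : Params n k)
    (h : List (Obs n)) : Finset (Fin n) → ℝ :=
  if h.length < P.tPad then uniformPad k h
  else
    let j := (h.length - P.tPad) / P.tCycle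
    let s := (h.length - P.tPad) % P.tCycle
    if s < P.tMove then
      moveTo k (if hj : j < S then A.points P.alpha P.accuracy ⟨j, hj⟩ else uniformVec n)
        (P.tPad + j * P.tCycle + P.tMove) h
    else if s < P.tMove + P.tQuery then
      playMenu (queryMenu n k ((s - P.tMove) / P.tBlock))
    else
      moveTo k (uniformVec n) (P.tPad + (j + 1) * P.tCycle) h

/-- The hypothesis obtained from the query results recorded in the history. -/
noncomputable def learnedModel (A : LocalLearner 𝓜 (uniformVec n) S) (P : Params n k)
    (h : List (Obs n)) : (Fin n → ℝ) → Fin n → ℝ :=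
  A.hypothesis P.alpha P.accuracy fun j =>
    queryEstimate k (P.tPad + j.val * P.tCycle + P.tMove) P.tBlock h

/-- Decision set after `s` rounds of the optimization phase: `H_c` intersected with the sets
`IRD(v, M̂)` for the memory vectors `v` after each of these rounds. -/
noncomputable def decisionSet (A : LocalLearner 𝓜 (uniformVec n) S) (P : Params n k) (c : ℝ)
    (h : List (Obs n)) (s : ℕ) : Set (Reduced n) :=
  {w | lift w ∈ entropySet n c ∧ ∀ j, 1 ≤ j → j ≤ s →
    lift w ∈ IRD k (learnedModel A P h) (memory (h.take (P.tLearn S + j)))}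

/-- The contraction `{x | r / (r - δ - ε) x ∈ K}`. -/
def contracted (P : Params n k) (K : Set (Reduced n)) : Set (Reduced n) :=
  {w | (P.r / (P.r - P.delta - P.eps)) • w ∈ K}

/-- The iterates of RC-FKM, with loss `1 - reward` and the one-point gradient estimate
`(dimension / δ) · loss · direction`. -/
noncomputable def iterate (A : LocalLearner 𝓜 (uniformVec n) S) (P : Params n k) (c : ℝ)
    (u : ℕ → Reduced n) (h : List (Obs n)) : ℕ → Reduced n
  | 0 => 0
  | s + 1 =>
    proj (contracted P (decisionSet A P c h (s + 1)))
      (iterate A P c u h s -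
        P.eta • ((((n - 1 : ℕ) : ℝ) / P.delta *
          (1 - (h.map Obs.reward).getD (P.tLearn S + s) 0)) • u (P.tLearn S + s)))

/-- The two-phase algorithm: local learning near the uniform vector, then RC-FKM whose actions
`x + δ u` are turned into menu distributions by the linear program for the learned scores at the
current memory vector. -/
noncomputable def algorithm (A : LocalLearner 𝓜 (uniformVec n) S) (P : Params n k) (c : ℝ) :
    Policy n :=
  fun u h =>
    if h.length < P.tLearn S then learnStep A P h
    else
      P.lp.sol (learnedModel A P h (memory h)) (iterate A P c u h (h.length - P.tLearn S))
        (P.delta • u h.length)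

end Algorithm

/-! ### Choice distributions -/

/-! The theorem rests on two facts: the histogram can be steered, and the expected reward stays
exactly affine in the exploration step although the learned model is wrong.

Learning. Scores lie between `k ^ 2 / n` and `1`, so every displayed item is chosen with probability
at least `c = k / n`, and `c * k ≤ 1`. Showing the items with the largest deficits therefore keeps
all deficits below `c` times the remaining time, up to fluctuations. An exponential potential of the
excess grows per round by a factor `1 + 3 γ ^ 2` and a summand `9 n γ` at most
(`stepE_movePotential_le`), so a move ends within `n * D` of its target unless an event of
probability about `exp (-γ D)` occurs (`reaches_of_move`). With moves of order `log T / ε ^ 3`, `γ =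
ε ^ 2` and `D` a small multiple of `ε` times the length, the failure is `O(T ^ (-2))`. A query of
order `log T / ε ^ 2` shifts the histogram by a relative `O(ε)` only. By the Lipschitz condition it
then samples nearly constant choice distributions, and its frequencies give the scores up to `O(ε)`
(`reaches_of_query`, `abs_queryEstimate_sub_le`). As `α` is of order `k / (n ^ 2 S)`, the way to a
query point and back fits into the moves, and the cycles can be chained (`reaches_cycle`,
`reaches_learned`). The local learner turns the estimates into a globally accurate model.

Optimization. A distribution is inducible as soon as none of its entries exceeds the least
probability of a displayed item (`mem_menuHull_of_le`). Hence a fixed ball of radius `R` around the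
uniform vector lies in `H_c` and in every `IRD(v, M̂)`. This leaves room for exploration and for a
slightly contracted comparator (`OptConditions.comparator_mem`). The danger is the model error: with
an arbitrary solution of the linear program, a reward error of order `ε`, divided by `δ = ε`, would
bias the gradient estimate by a constant. The selection rule therefore uses weights which are affine
in the exploration step, with slopes of `ℓ¹`-norm at most `1 / R` (`exists_affine_solver`). Under
the true scores the expected reward is then affine in `δ u`, with a gradient off by a multiple of
the error over `R` (`exists_affine_reward`), and the first two moments of the sphere make the
one-point estimate exact for this gradient (`integral_sphere_affine_mul_linear`,
`le_integral_gainEstimate`). Projected gradient descent gives a bound along every history with a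
good model (`sum_gainEstimate_le`). Averaging over the direction of each round, which is independent
of the past, turns it into regret (`integral_iterateGap_le`, `OptConditions.regret_le`). The
accuracy is a multiple of `ε` small enough to absorb the powers of `n` and `1 / R`, which keeps the
constant in front of the regret terms absolute.

Diversity. All targets played lie in the convex set `H_c`, and the learning phase ends near the
uniform vector. So the average of the targets is in `H_c`, and the counts deviate from it by the
model error and a martingale of second moment at most `T` (`iterate_sq_countDeviation_le`,
`entropySatisfied_of_countDeviation`).

For fixed directions all expectations are iterates of the one-step operator `stepE`, so
concentration is a matter of drift inequalities and Markov's inequality. -/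

lemma sum_mul_le_sum_top {ι : Type*} [DecidableEq ι] {a p q : ι → ℝ} {K A : Finset ι}
    (hK : K.Nonempty) (top : ∀ i ∈ K, ∀ j, j ∉ K → a j ≤ a i)
    (hq : ∀ i, 0 ≤ q i) (hqp : ∀ i ∈ K, q i ≤ p i) (hp : ∑ i ∈ K, p i = 1)
    (hA : ∑ i ∈ A, q i ≤ 1) (hor : (∀ i, 0 ≤ a i) ∨ ∑ i ∈ A, q i = 1) :
    ∑ i ∈ A, q i * a i ≤ ∑ i ∈ K, p i * a i := by
  obtain ⟨i₀, hi₀, hmin⟩ := K.exists_min_image a hK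
  -- After subtracting `m` the weights are nonnegative on `K` and nonpositive off `K`, so dropping
  -- items outside `K` and replacing `q` by `p` on `K` only increases the sum. The shift costs `m`
  -- times the missing mass of `q`, which does no harm if `a ≥ 0` or if no mass is missing; moves
  -- need the first alternative, inducibility the second.
  set m := a i₀
  have h1 : ∑ i ∈ K, p i * a i = ∑ i ∈ K, p i * (a i - m) + m := by
    simp only [mul_sub, Finset.sum_sub_distrib, ← Finset.sum_mul, hp]; ring
  have h2 : ∑ i ∈ A, q i * a i = ∑ i ∈ A, q i * (a i - m) + m * ∑ i ∈ A, q i := by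
    simp only [mul_sub, Finset.sum_sub_distrib, ← Finset.sum_mul]; ring
  have h3 : ∑ i ∈ A, q i * (a i - m) ≤ ∑ i ∈ K, p i * (a i - m) := by
    calc ∑ i ∈ A, q i * (a i - m) ≤ ∑ i ∈ A, if i ∈ K then p i * (a i - m) else 0 := by
          refine Finset.sum_le_sum fun i _ => ?_
          split_ifs with h
          · exact mul_le_mul_of_nonneg_right (hqp i h) (sub_nonneg.2 (hmin i h))
          · exact mul_nonpos_of_nonneg_of_nonpos (hq i) (sub_nonpos.2 (top i₀ hi₀ i h))
      _ = ∑ i ∈ A ∩ K, p i * (a i - m) := by rw [Finset.sum_ite_mem]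
      _ ≤ _ := by
          refine Finset.sum_le_sum_of_subset_of_nonneg Finset.inter_subset_right fun i hi _ => ?_
          exact mul_nonneg ((hq i).trans (hqp i hi)) (sub_nonneg.2 (hmin i hi))
  have h4 : m * ∑ i ∈ A, q i ≤ m := by
    rcases hor with h | h
    · exact mul_le_of_le_one_right (h i₀) hA
    · rw [h, mul_one]
  linarith

lemma menuDist_of_mem {n : ℕ} (s : Fin n → ℝ) {K : Finset (Fin n)} {i : Fin n} (hi : i ∈ K) :
    menuDist s K i = s i / ∑ j ∈ K, s j := by simp [menuDist, hi]

lemma menuDist_of_notMem {n : ℕ} (s : Fin n → ℝ) {K : Finset (Fin n)} {i : Fin n} (hi : i ∉ K) :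
    menuDist s K i = 0 := by simp [menuDist, hi]

lemma sum_menuDist_mul {n : ℕ} (s : Fin n → ℝ) (K : Finset (Fin n)) (f : Fin n → ℝ) :
    ∑ i, menuDist s K i * f i = ∑ i ∈ K, menuDist s K i * f i := by
  symm
  refine Finset.sum_subset (Finset.subset_univ _) fun i _ hi => ?_
  rw [menuDist_of_notMem s hi, zero_mul]

lemma sum_menuDist {n : ℕ} {s : Fin n → ℝ} {K : Finset (Fin n)} (h : ∑ j ∈ K, s j ≠ 0) :
    ∑ i, menuDist s K i = 1 := by
  have := sum_menuDist_mul s K 1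
  simp only [Pi.one_apply, mul_one] at this
  rw [this, Finset.sum_congr rfl fun i hi => menuDist_of_mem s hi, ← Finset.sum_div, div_self h]

lemma sum_menuDist_on {n : ℕ} {s : Fin n → ℝ} {K : Finset (Fin n)} (h : ∑ i, menuDist s K i = 1) :
    ∑ i ∈ K, menuDist s K i = 1 := by
  have := sum_menuDist_mul s K 1
  simp only [Pi.one_apply, mul_one] at this
  rw [← this, h]

lemma menuDist_nonneg {n : ℕ} {s : Fin n → ℝ} {K : Finset (Fin n)} (h : ∀ j ∈ K, 0 ≤ s j)
    (i : Fin n) : 0 ≤ menuDist s K i := by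
  by_cases hi : i ∈ K
  · rw [menuDist_of_mem s hi]; exact div_nonneg (h i hi) (Finset.sum_nonneg h)
  · rw [menuDist_of_notMem s hi]

lemma menuDist_normalize {n : ℕ} {s : Fin n → ℝ} (h : ∑ j, s j ≠ 0) (K : Finset (Fin n)) :
    menuDist (normalizeScores s) K = menuDist s K := by
  ext i
  by_cases hi : i ∈ K
  · rw [menuDist_of_mem _ hi, menuDist_of_mem _ hi]
    simp only [normalizeScores, ← Finset.sum_div]
    rw [div_div_div_cancel_right₀ h]
  · rw [menuDist_of_notMem _ hi, menuDist_of_notMem _ hi]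

lemma normalizeScores_eq_menuDist {n : ℕ} (s : Fin n → ℝ) :
    normalizeScores s = menuDist s Finset.univ := by
  ext i; simp [normalizeScores, menuDist]

/-- The difference of the quotients has a numerator of size at most `(1 + |K|) κ` over a denominator
of at least `|K| mu`. The menu size cancels, so the bound serves single menus and full normalization
alike. -/
lemma abs_menuDist_sub_le {n : ℕ} {a b : Fin n → ℝ} {K : Finset (Fin n)} {mu κ : ℝ}
    (hmu : 0 < mu) (ha : ∀ j ∈ K, mu ≤ a j) (hb : ∀ j ∈ K, 0 ≤ b j) (hB : 0 < ∑ j ∈ K, b j)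
    (hab : ∀ j ∈ K, |a j - b j| ≤ κ) (hκ : 0 ≤ κ) (i : Fin n) :
    |menuDist a K i - menuDist b K i| ≤ 2 * κ / mu := by
  by_cases hi : i ∈ K
  swap
  · rw [menuDist_of_notMem _ hi, menuDist_of_notMem _ hi, sub_zero, abs_zero]; positivity
  have hcard : (1 : ℝ) ≤ K.card := by exact_mod_cast Finset.card_pos.2 ⟨i, hi⟩
  rw [menuDist_of_mem _ hi, menuDist_of_mem _ hi]
  set A := ∑ j ∈ K, a j
  set B := ∑ j ∈ K, b j
  have hA : K.card * mu ≤ A := by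
    have := Finset.card_nsmul_le_sum K a mu ha
    simpa using this
  have hA0 : 0 < A := lt_of_lt_of_le (by positivity) hA
  have hBA : |B - A| ≤ K.card * κ := by
    rw [← Finset.sum_sub_distrib]
    refine (Finset.abs_sum_le_sum_abs _ _).trans ?_
    have := Finset.sum_le_card_nsmul K (fun j => |b j - a j|) κ
      fun j hj => by rw [abs_sub_comm]; exact hab j hj
    simpa using this
  have hbB : b i / B ≤ 1 := (div_le_one hB).2 (Finset.single_le_sum hb hi)
  have hbB0 : 0 ≤ b i / B := div_nonneg (hb i hi) hB.le
  have e : a i / A - b i / B = ((a i - b i) + (b i / B) * (B - A)) / A := by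
    field_simp; ring
  rw [e, abs_div, abs_of_pos hA0]
  have h1 : |(a i - b i) + (b i / B) * (B - A)| ≤ κ + K.card * κ := by
    refine (abs_add_le _ _).trans (add_le_add (hab i hi) ?_)
    rw [abs_mul, abs_of_nonneg hbB0]
    exact (mul_le_of_le_one_left (abs_nonneg _) hbB).trans hBA
  rw [div_le_div_iff₀ hA0 hmu]
  calc _ ≤ (κ + K.card * κ) * mu := by gcongr
    _ ≤ 2 * κ * (K.card * mu) := by nlinarith [mul_nonneg hκ hmu.le]
    _ ≤ _ := by gcongr

/-- Distributions inducible by menus of size `k` under fixed scores. -/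
noncomputable def menuHull {n : ℕ} (k : ℕ) (s : Fin n → ℝ) : Set (Fin n → ℝ) :=
  convexHull ℝ {p | ∃ K : Finset (Fin n), K.card = k ∧ p = menuDist s K}

lemma finite_menuDists {n : ℕ} (k : ℕ) (s : Fin n → ℝ) :
    {p | ∃ K : Finset (Fin n), K.card = k ∧ p = menuDist s K}.Finite := by
  refine (Set.finite_range (menuDist s)).subset ?_
  rintro p ⟨K, -, rfl⟩; exact ⟨K, rfl⟩

lemma isClosed_menuHull {n : ℕ} (k : ℕ) (s : Fin n → ℝ) : IsClosed (menuHull k s) :=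
  (finite_menuDists k s).isClosed_convexHull ℝ

lemma convex_menuHull {n : ℕ} (k : ℕ) (s : Fin n → ℝ) : Convex ℝ (menuHull k s) :=
  convex_convexHull _ _

lemma mem_menuHull {n k : ℕ} {s q : Fin n → ℝ} : q ∈ menuHull k s ↔
    ∃ z : Finset (Fin n) → ℝ, IsMenuDistribution k z ∧ ∑ K, z K • menuDist s K = q := by
  classical
  constructor
  · intro hq
    have hconv : Convex ℝ {q | ∃ z : Finset (Fin n) → ℝ, IsMenuDistribution k z ∧
        ∑ K, z K • menuDist s K = q} := by
      rintro _ ⟨z, hz, rfl⟩ _ ⟨y, hy, rfl⟩ a b ha hb hab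
      refine ⟨a • z + b • y, ⟨fun K => ?_, fun K hK => ?_, ?_⟩, ?_⟩
      · have := hz.1 K; have := hy.1 K
        simp only [Pi.add_apply, Pi.smul_apply, smul_eq_mul]; positivity
      · simp [hz.2.1 K hK, hy.2.1 K hK]
      · simp [Finset.sum_add_distrib, ← Finset.mul_sum, hz.2.2, hy.2.2, hab]
      · simp [Finset.sum_add_distrib, add_smul, Finset.smul_sum, mul_smul]
    refine convexHull_min ?_ hconv hq
    rintro _ ⟨K, hK, rfl⟩
    refine ⟨fun K' => if K' = K then 1 else 0, ⟨fun K' => ?_, fun K' h => ?_, ?_⟩, ?_⟩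
    · dsimp only; split_ifs <;> norm_num
    · have : K' ≠ K := by rintro rfl; exact h hK
      simp [this]
    · simp
    · simp
  · rintro ⟨z, hz, rfl⟩
    have hs : ∑ K, z K • menuDist s K
        = ∑ K ∈ Finset.univ.filter (fun K : Finset (Fin n) => K.card = k), z K • menuDist s K := by
      rw [Finset.sum_filter]
      refine Finset.sum_congr rfl fun K _ => ?_
      split_ifs with h
      · rfl
      · rw [hz.2.1 K h, zero_smul]
    rw [hs]
    refine (convex_menuHull k s).sum_mem (fun K _ => hz.1 K) ?_ fun K hK => ?_
    · rw [Finset.sum_filter, ← hz.2.2]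
      refine Finset.sum_congr rfl fun K _ => ?_
      split_ifs with h
      · rfl
      · rw [hz.2.1 K h]
    · exact subset_convexHull _ _ ⟨K, (Finset.mem_filter.1 hK).2, rfl⟩

/-- The menu distributions of size `k` are probability vectors that give each item of the menu
probability at least `c`. -/
def MenusAtLeast {n : ℕ} (k : ℕ) (c : ℝ) (s : Fin n → ℝ) : Prop :=
  ∀ K : Finset (Fin n), K.card = k → ∑ i, menuDist s K i = 1 ∧ ∀ i ∈ K, c ≤ menuDist s K i

lemma exists_top_menu {n k : ℕ} (hk : k ≤ n) (a : Fin n → ℝ) :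
    ∃ K : Finset (Fin n), K.card = k ∧ ∀ i ∈ K, ∀ j, j ∉ K → a j ≤ a i := by
  classical
  induction k with
  | zero => exact ⟨∅, by simp⟩
  | succ k ih =>
    obtain ⟨K, hK, htop⟩ := ih (by omega)
    have hne : Kᶜ.Nonempty := by
      rw [← Finset.card_pos, Finset.card_compl, Fintype.card_fin]; omega
    obtain ⟨i₀, hi₀, hmax⟩ := Kᶜ.exists_max_image a hne
    have hi₀' := Finset.mem_compl.1 hi₀
    refine ⟨insert i₀ K, by rw [Finset.card_insert_of_notMem hi₀', hK], fun i hi j hj => ?_⟩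
    rw [Finset.mem_insert, not_or] at hj
    rcases Finset.mem_insert.1 hi with rfl | hi
    · exact hmax j (Finset.mem_compl.2 hj.2)
    · exact htop i hi j hj.2

/-- Otherwise a linear functional separates `q` from the hull. But the menu of the `k` items with
the largest coefficients gives each of its members at least `c`, hence at least as much as `q` does,
and so its value is not below that of `q`. -/
lemma mem_menuHull_of_le {n k : ℕ} {s q : Fin n → ℝ} {c : ℝ} (hk : 1 ≤ k) (hkn : k ≤ n)
    (hs : MenusAtLeast k c s) (hq0 : ∀ i, 0 ≤ q i) (hq1 : ∑ i, q i = 1) (hqc : ∀ i, q i ≤ c) :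
    q ∈ menuHull k s := by
  classical
  by_contra hnot
  obtain ⟨f, u, hf1, hf2⟩ := geometric_hahn_banach_closed_point (convex_menuHull k s)
    (isClosed_menuHull k s) hnot
  set a : Fin n → ℝ := fun i => f (Pi.single i 1)
  have hfa : ∀ x : Fin n → ℝ, f x = ∑ i, x i * a i := fun x => by
    conv_lhs => rw [pi_eq_sum_univ' x]
    rw [map_sum]
    refine Finset.sum_congr rfl fun i _ => ?_
    rw [map_smul, smul_eq_mul]
  obtain ⟨K, hK, htop⟩ := exists_top_menu hkn a
  have hKne : K.Nonempty := by rw [← Finset.card_pos]; omega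
  have h1 := sum_mul_le_sum_top (a := a) (p := menuDist s K) (q := q) (A := Finset.univ) hKne htop
    hq0 (fun i hi => (hqc i).trans ((hs K hK).2 i hi)) (sum_menuDist_on (hs K hK).1) hq1.le
    (Or.inr hq1)
  have h2 := hf1 (menuDist s K) (subset_convexHull _ _ ⟨K, hK, rfl⟩)
  rw [hfa, sum_menuDist_mul] at h2
  rw [hfa] at hf2
  linarith

/-! ### Vectors -/

lemma l2dist_eq_norm {n : ℕ} (x y : Fin n → ℝ) : l2dist x y = ‖WithLp.toLp 2 (x - y)‖ := by
  simp [l2dist, EuclideanSpace.norm_eq]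

lemma l2dist_nonneg {n : ℕ} (x y : Fin n → ℝ) : 0 ≤ l2dist x y := Real.sqrt_nonneg _

lemma abs_sub_le_l2dist {n : ℕ} (x y : Fin n → ℝ) (i : Fin n) : |x i - y i| ≤ l2dist x y := by
  rw [l2dist, ← Real.sqrt_sq_eq_abs]
  exact Real.sqrt_le_sqrt (Finset.single_le_sum (f := fun i => (x i - y i) ^ 2)
    (fun _ _ => sq_nonneg _) (Finset.mem_univ i))

lemma l2dist_le_of_abs_sub_le {n : ℕ} {x y : Fin n → ℝ} {κ : ℝ} (hκ : 0 ≤ κ)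
    (h : ∀ i, |x i - y i| ≤ κ) : l2dist x y ≤ n * κ := by
  have h1 : ∑ i, (x i - y i) ^ 2 ≤ (n * κ) ^ 2 := by
    calc ∑ i, (x i - y i) ^ 2 ≤ ∑ _i : Fin n, κ ^ 2 :=
          Finset.sum_le_sum fun i _ => sq_le_sq' (by linarith [abs_le.1 (h i)]) (abs_le.1 (h i)).2
      _ = n * κ ^ 2 := by simp
      _ ≤ (n * κ) ^ 2 := by
          rcases Nat.eq_zero_or_pos n with rfl | hn
          · simp
          · have : (1 : ℝ) ≤ n := by exact_mod_cast hn
            rw [mul_pow]; gcongr; nlinarith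
  exact Real.sqrt_le_iff.2 ⟨by positivity, h1⟩

lemma linearReward_sub {n : ℕ} (a x y : Fin n → ℝ) :
    linearReward a x - linearReward a y = linearReward a (x - y) := by
  simp [linearReward, mul_sub, Finset.sum_sub_distrib]

lemma uniformVec_mem {n : ℕ} (hn : 1 ≤ n) : uniformVec n ∈ stdSimplex ℝ (Fin n) := by
  have : (n : ℝ) ≠ 0 := by positivity
  refine ⟨fun i => by simp [uniformVec], by simp [uniformVec, this]⟩

/-- By linearity only `x - y` matters. It has total mass zero, so a small multiple of it added to
the uniform vector stays in the simplex, where the Lipschitz condition applies; both sides scale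
alike. -/
lemma abs_linearReward_le {n : ℕ} {a : Fin n → ℝ} {G : ℝ} (hn : 1 ≤ n)
    (hG : ∀ x ∈ stdSimplex ℝ (Fin n), ∀ y ∈ stdSimplex ℝ (Fin n),
      |linearReward a x - linearReward a y| ≤ G * l2dist x y)
    {x y : Fin n → ℝ} (hxy : ∑ i, x i = ∑ i, y i) :
    |linearReward a x - linearReward a y| ≤ G * l2dist x y := by
  have hn0 : (0 : ℝ) < n := by exact_mod_cast hn
  set z := x - y
  have hz : ∑ i, z i = 0 := by simp [z, hxy]
  have hS : 0 ≤ ∑ i, |z i| := Finset.sum_nonneg fun _ _ => abs_nonneg _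
  set τ : ℝ := 1 / (n * (1 + ∑ i, |z i|)) with hτ
  have hτ0 : 0 < τ := by positivity
  have hmem : uniformVec n + τ • z ∈ stdSimplex ℝ (Fin n) := by
    constructor
    · intro i
      have h1 : |z i| ≤ ∑ i, |z i| :=
        Finset.single_le_sum (f := fun i => |z i|) (fun _ _ => abs_nonneg _) (Finset.mem_univ i)
      have h2 : τ * |z i| ≤ 1 / n := by
        rw [hτ, div_mul_eq_mul_div, div_le_div_iff₀ (by positivity) hn0]; nlinarith
      have h3 := neg_abs_le (z i)
      simp only [uniformVec, Pi.add_apply, Pi.smul_apply, smul_eq_mul]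
      nlinarith
    · have := (uniformVec_mem hn).2
      simp only [Pi.add_apply, Pi.smul_apply, smul_eq_mul, Finset.sum_add_distrib,
        ← Finset.mul_sum, hz, this]; norm_num
  have h := hG _ hmem _ (uniformVec_mem hn)
  have e1 : linearReward a (τ • z) = τ * linearReward a z := by
    simp only [linearReward, Pi.smul_apply, smul_eq_mul, Finset.mul_sum]
    exact Finset.sum_congr rfl fun i _ => by ring
  rw [l2dist_eq_norm, linearReward_sub, add_sub_cancel_left, WithLp.toLp_smul, norm_smul, e1,
    abs_mul, Real.norm_eq_abs, abs_of_pos hτ0] at h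
  rw [l2dist_eq_norm, linearReward_sub]
  have h' : τ * |linearReward a z| ≤ τ * (G * ‖WithLp.toLp 2 z‖) := by linarith
  exact le_of_mul_le_mul_left h' hτ0

/-- Two vertices at positive distance force this. It is needed because the theorem quantifies over
all real `G`. -/
lemma lipschitzConst_nonneg {n : ℕ} {a : Fin n → ℝ} {G : ℝ} (hn : 2 ≤ n)
    (hG : ∀ x ∈ stdSimplex ℝ (Fin n), ∀ y ∈ stdSimplex ℝ (Fin n),
      |linearReward a x - linearReward a y| ≤ G * l2dist x y) : 0 ≤ G := by
  have h := hG _ (single_mem_stdSimplex ℝ (⟨0, by omega⟩ : Fin n)) _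
    (single_mem_stdSimplex ℝ (⟨1, by omega⟩ : Fin n))
  have h1 := abs_sub_le_l2dist (Pi.single (⟨0, by omega⟩ : Fin n) (1 : ℝ))
    (Pi.single (⟨1, by omega⟩ : Fin n) (1 : ℝ)) ⟨0, by omega⟩
  simp at h1
  by_contra hneg
  push Not at hneg
  have := abs_nonneg (linearReward a (Pi.single (⟨0, by omega⟩ : Fin n) (1 : ℝ)) -
    linearReward a (Pi.single (⟨1, by omega⟩ : Fin n) (1 : ℝ)))
  nlinarith

/-! ### Reduced coordinates -/

lemma sum_fin_eq_add {n : ℕ} (hn : 1 ≤ n) (f : Fin n → ℝ) :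
    ∑ i, f i = (∑ j : Fin (n - 1), f ⟨j, by omega⟩) + f ⟨n - 1, by omega⟩ := by
  obtain ⟨m, rfl⟩ : ∃ m, n = m + 1 := ⟨n - 1, by omega⟩
  exact Fin.sum_univ_castSucc f

lemma lift_apply_of_lt {n : ℕ} (w : Reduced n) {i : Fin n} (h : i.val < n - 1) :
    lift w i = 1 / (n : ℝ) + w ⟨i.val, h⟩ := by simp [lift, h]

lemma lift_apply_last {n : ℕ} (w : Reduced n) {i : Fin n} (h : ¬ i.val < n - 1) :
    lift w i = 1 / (n : ℝ) - ∑ j, w j := by simp [lift, h]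

lemma sum_lift {n : ℕ} (hn : 1 ≤ n) (w : Reduced n) : ∑ i, lift w i = 1 := by
  have hn0 : (n : ℝ) ≠ 0 := by positivity
  rw [sum_fin_eq_add hn, lift_apply_last w (by simp)]
  rw [Finset.sum_congr rfl fun (j : Fin (n - 1)) _ =>
    lift_apply_of_lt w (i := ⟨j.val, by omega⟩) j.2]
  simp only [Finset.sum_add_distrib, Finset.sum_const, Finset.card_univ, Fintype.card_fin,
    nsmul_eq_mul, Nat.cast_sub hn]
  field_simp; push_cast; ring

lemma lift_zero {n : ℕ} : lift (0 : Reduced n) = uniformVec n := by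
  ext i; simp only [lift, uniformVec]; split_ifs <;> simp

lemma lift_combo {n : ℕ} (x y : Reduced n) {a b : ℝ} (hab : a + b = 1) :
    lift (a • x + b • y) = a • lift x + b • lift y := by
  ext i
  by_cases h : i.val < n - 1
  · simp only [Pi.add_apply, Pi.smul_apply, smul_eq_mul, lift_apply_of_lt _ h, PiLp.add_apply,
      PiLp.smul_apply]
    linear_combination (-1 / (n : ℝ)) * hab
  · simp only [Pi.add_apply, Pi.smul_apply, smul_eq_mul, lift_apply_last _ h, PiLp.add_apply,
      PiLp.smul_apply, Finset.sum_add_distrib, ← Finset.mul_sum]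
    linear_combination (-1 / (n : ℝ)) * hab

/-- Reduced coordinates of a vector. -/
noncomputable def reduce {n : ℕ} (x : Fin n → ℝ) : Reduced n :=
  WithLp.toLp 2 fun j => x ⟨j, by omega⟩ - 1 / (n : ℝ)

lemma lift_reduce {n : ℕ} (hn : 1 ≤ n) {x : Fin n → ℝ} (hx : ∑ i, x i = 1) :
    lift (reduce x) = x := by
  ext i
  by_cases h : i.val < n - 1
  · rw [lift_apply_of_lt _ h]; simp [reduce]
  · rw [lift_apply_last _ h]
    have hi : i = ⟨n - 1, by omega⟩ := by ext; simp; omega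
    rw [sum_fin_eq_add hn] at hx
    have hn0 : (n : ℝ) ≠ 0 := by positivity
    simp only [reduce, Finset.sum_sub_distrib, Finset.sum_const, Finset.card_univ,
      Fintype.card_fin, nsmul_eq_mul, Nat.cast_sub hn]
    rw [hi]
    push_cast
    linear_combination -hx + (by field_simp; ring : (1 : ℝ) / n + ((n : ℝ) - 1) * (1 / n) - 1 = 0)

lemma norm_reduce_sub_le {n : ℕ} (hn : 1 ≤ n) (x y : Fin n → ℝ) :
    ‖reduce x - reduce y‖ ≤ l2dist x y := by
  rw [EuclideanSpace.norm_eq, l2dist]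
  refine Real.sqrt_le_sqrt ?_
  rw [sum_fin_eq_add hn]
  simp only [reduce, PiLp.sub_apply, Real.norm_eq_abs, sq_abs, sub_sub_sub_cancel_right]
  linarith [sq_nonneg (x ⟨n - 1, by omega⟩ - y ⟨n - 1, by omega⟩)]

lemma abs_sum_le_norm {m : ℕ} (w : EuclideanSpace ℝ (Fin m)) :
    ∑ j, |w j| ≤ m * ‖w‖ := by
  calc ∑ j, |w j| ≤ ∑ _j : Fin m, ‖w‖ :=
        Finset.sum_le_sum fun j _ => by simpa using PiLp.norm_apply_le w j
    _ = _ := by simp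

lemma l2dist_lift_le {n : ℕ} (hn : 1 ≤ n) (w w' : Reduced n) :
    l2dist (lift w) (lift w') ≤ n * ‖w - w'‖ := by
  have key : ∀ i, |lift w i - lift w' i| ^ 2 ≤ if i.val < n - 1 then
      ‖w - w'‖ ^ 2 else (∑ j, (w - w') j) ^ 2 := fun i => by
    by_cases h : i.val < n - 1
    · rw [lift_apply_of_lt _ h, lift_apply_of_lt _ h, if_pos h]
      have := PiLp.norm_apply_le (w - w') ⟨i.val, h⟩
      rw [Real.norm_eq_abs, PiLp.sub_apply] at this
      rw [add_sub_add_left_eq_sub]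
      gcongr
    · rw [lift_apply_last _ h, lift_apply_last _ h, if_neg h, sq_abs]
      simp only [PiLp.sub_apply, Finset.sum_sub_distrib]
      apply le_of_eq; ring
  have hcs : (∑ j, (w - w') j) ^ 2 ≤ ((n - 1 : ℕ) : ℝ) * ‖w - w'‖ ^ 2 := by
    have := sq_sum_le_card_mul_sum_sq (s := Finset.univ) (f := fun j => (w - w') j)
    rw [EuclideanSpace.norm_sq_eq]
    simpa using this
  have hn1 : (1 : ℝ) ≤ n := by exact_mod_cast hn
  have h1 : ∑ i, (lift w i - lift w' i) ^ 2 ≤ (n * ‖w - w'‖) ^ 2 := by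
    calc ∑ i, (lift w i - lift w' i) ^ 2
        ≤ ∑ i : Fin n, if i.val < n - 1 then ‖w - w'‖ ^ 2 else (∑ j, (w - w') j) ^ 2 :=
          Finset.sum_le_sum fun i _ => by rw [← sq_abs]; exact key i
      _ = ((n - 1 : ℕ) : ℝ) * ‖w - w'‖ ^ 2 + (∑ j, (w - w') j) ^ 2 := by
          rw [sum_fin_eq_add hn]; simp
      _ ≤ (n * ‖w - w'‖) ^ 2 := by
          rw [Nat.cast_sub hn] at *
          push_cast at *
          nlinarith [sq_nonneg (‖w - w'‖), sq_nonneg ((n : ℝ) - 1), mul_nonneg (sq_nonneg ((n : ℝ) - 1)) (sq_nonneg (‖w - w'‖))]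
  exact Real.sqrt_le_iff.2 ⟨by positivity, h1⟩

lemma continuous_lift {n : ℕ} : Continuous (lift : Reduced n → Fin n → ℝ) := by
  refine continuous_pi fun i => ?_
  by_cases h : i.val < n - 1
  · simp only [lift, h, dif_pos]; fun_prop
  · simp only [lift, h, dif_neg, not_false_eq_true]; fun_prop

/-! ### The entropy constraint -/

lemma continuous_entropy {n : ℕ} : Continuous (entropy : (Fin n → ℝ) → ℝ) := by
  unfold entropy
  exact continuous_finsetSum _ fun i _ => Real.continuous_negMulLog.comp (continuous_apply i)

lemma isClosed_entropySet (n : ℕ) (c : ℝ) : IsClosed (entropySet n c) :=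
  (isClosed_stdSimplex (𝕜 := ℝ) (Fin n)).inter (isClosed_le continuous_const continuous_entropy)

lemma convex_entropySet (n : ℕ) (c : ℝ) : Convex ℝ (entropySet n c) := by
  intro x hx y hy a b ha hb hab
  refine ⟨convex_stdSimplex ℝ (Fin n) hx.1 hy.1 ha hb hab, ?_⟩
  have h : a * entropy x + b * entropy y ≤ entropy (a • x + b • y) := by
    simp only [entropy, Finset.mul_sum, ← Finset.sum_add_distrib]
    exact Finset.sum_le_sum fun i _ => Real.concaveOn_negMulLog.2 (hx.1.1 i) (hy.1.1 i) ha hb hab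
  have h1 := mul_le_mul_of_nonneg_left hx.2 ha
  have h2 := mul_le_mul_of_nonneg_left hy.2 hb
  have h3 : a * c + b * c = c := by rw [← add_mul, hab, one_mul]
  show c ≤ entropy (a • x + b • y)
  linarith

lemma entropy_uniformVec {n : ℕ} (hn : 1 ≤ n) : entropy (uniformVec n) = Real.log n := by
  have : (n : ℝ) ≠ 0 := by positivity
  simp only [entropy, uniformVec, Real.negMulLog, one_div, Real.log_inv, Finset.sum_const,
    Finset.card_univ, Fintype.card_fin, nsmul_eq_mul]
  field_simp

/-- The uniform vector has entropy `log n > c` and positive entries, and both conditions are open.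
This is the only place where the slack in `c < log n` enters. -/
lemma exists_ball_subset_entropySet {n : ℕ} (hn : 1 ≤ n) {c : ℝ} (hc : c < Real.log n) :
    ∃ r > 0, ∀ w : Reduced n, ‖w‖ ≤ r → lift w ∈ entropySet n c := by
  have hn0 : (0 : ℝ) < n := by exact_mod_cast hn
  have h1 : ∀ᶠ w : Reduced n in nhds 0, c < entropy (lift w) :=
    (continuous_entropy.comp continuous_lift).continuousAt.eventually_const_lt
      (by simpa [lift_zero, entropy_uniformVec hn] using hc)
  have h2 : ∀ᶠ w : Reduced n in nhds 0, ∀ i, 0 < lift w i := by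
    rw [Filter.eventually_all]
    intro i
    exact ((continuous_apply i).comp continuous_lift).continuousAt.eventually_const_lt
      (by simpa [lift_zero, uniformVec] using hn0)
  obtain ⟨r, hr, h⟩ := Metric.eventually_nhds_iff.1 (h1.and h2)
  refine ⟨r / 2, by positivity, fun w hw => ?_⟩
  obtain ⟨h3, h4⟩ := h (show dist w 0 < r by rw [dist_zero_right]; linarith)
  exact ⟨⟨fun i => (h4 i).le, sum_lift hn w⟩, h3.le⟩

/-! ### Measurable solutions of the linear program -/

/-- Affine independence makes the map from weights to the pair (weighted sum, total mass) injective.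
A linear left inverse applied to `(q, 1)` returns the barycentric coordinates of `q`, which are
therefore continuous in `q`. -/
lemma exists_measurable_weights_of_affineIndependent {n k : ℕ} (s : Fin n → ℝ)
    {t : Finset (Fin n → ℝ)}
    (hts : ∀ p ∈ t, ∃ K : Finset (Fin n), K.card = k ∧ p = menuDist s K)
    (hind : AffineIndependent ℝ ((↑) : t → Fin n → ℝ)) :
    ∃ Z : (Fin n → ℝ) → Finset (Fin n) → ℝ, (∀ K, Measurable fun q => Z q K) ∧
      ∀ q ∈ convexHull ℝ (t : Set (Fin n → ℝ)), IsMenuDistribution k (Z q) ∧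
        ∑ K, Z q K • menuDist s K = q := by
  classical
  let Φ : (t → ℝ) →ₗ[ℝ] (Fin n → ℝ) × ℝ :=
    { toFun := fun w => (∑ p, w p • (p : Fin n → ℝ), ∑ p, w p)
      map_add' := fun x y => by simp [Finset.sum_add_distrib, add_smul]
      map_smul' := fun r x => by simp [Finset.smul_sum, Finset.mul_sum, mul_smul] }
  have hinj : LinearMap.ker Φ = ⊥ := by
    rw [LinearMap.ker_eq_bot']
    intro w hw
    have h1 : ∑ p, w p • (p : Fin n → ℝ) = 0 := congrArg Prod.fst hw
    have h2 : ∑ p, w p = 0 := congrArg Prod.snd hw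
    ext p
    exact affineIndependent_iff.1 hind Finset.univ w h2 h1 p (Finset.mem_univ p)
  obtain ⟨g, hg⟩ := LinearMap.exists_leftInverse_of_injective Φ hinj
  choose! κ hκ1 hκ2 using hts
  refine ⟨fun q K => ∑ p : t, if κ p = K then g (q, 1) p else 0, fun K => ?_, fun q hq => ?_⟩
  · have hgc : Measurable fun q : Fin n → ℝ => g (q, 1) :=
      (g.continuous_of_finiteDimensional.comp (by fun_prop)).measurable
    refine Finset.measurable_fun_sum _ fun p _ => ?_
    split_ifs
    · exact (measurable_pi_apply p).comp hgc
    · exact measurable_const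
  · obtain ⟨w, hw0, hw1, hwq⟩ := Finset.mem_convexHull'.1 hq
    have hgq : g (q, 1) = fun p : t => w p := by
      have : (q, (1 : ℝ)) = Φ fun p : t => w p := by
        refine Prod.ext ?_ ?_
        · change q = ∑ p : t, w p • (p : Fin n → ℝ)
          rw [← hwq, ← Finset.sum_coe_sort t]
        · change 1 = ∑ p : t, w p
          rw [← hw1, ← Finset.sum_coe_sort t]
      rw [this]
      exact LinearMap.congr_fun hg _
    simp only [hgq]
    refine ⟨⟨fun K => ?_, fun K hK => ?_, ?_⟩, ?_⟩
    · refine Finset.sum_nonneg fun p _ => ?_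
      split_ifs
      · exact hw0 p p.2
      · exact le_rfl
    · refine Finset.sum_eq_zero fun p _ => if_neg ?_
      rintro rfl
      exact hK (hκ1 p p.2)
    · rw [Finset.sum_comm]
      simp only [Finset.sum_ite_eq, Finset.mem_univ, if_true]
      rw [← hw1, ← Finset.sum_coe_sort t]
    · simp only [Finset.sum_smul, ite_smul, zero_smul]
      rw [Finset.sum_comm]
      simp only [Finset.sum_ite_eq, Finset.mem_univ, if_true]
      conv_rhs => rw [← hwq, ← Finset.sum_coe_sort t]
      exact Finset.sum_congr rfl fun p _ => by rw [← hκ2 p p.2]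

/-- By Carathéodory the hull is the union of finitely many simplices spanned by affinely independent
menu distributions. Weights are defined simplex by simplex, each simplex being closed, with a fixed
menu as the default outside the hull. -/
lemma exists_measurable_weights {n k : ℕ} (hkn : k ≤ n) (s : Fin n → ℝ) :
    ∃ Z : (Fin n → ℝ) → Finset (Fin n) → ℝ, (∀ K, Measurable fun q => Z q K) ∧
      (∀ q, IsMenuDistribution k (Z q)) ∧
      ∀ q ∈ menuHull k s, ∑ K, Z q K • menuDist s K = q := by
  classical
  have glue : ∀ 𝒯 : Finset (Finset (Fin n → ℝ)),
      (∀ t ∈ 𝒯, (∀ p ∈ t, ∃ K : Finset (Fin n), K.card = k ∧ p = menuDist s K) ∧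
        AffineIndependent ℝ ((↑) : t → Fin n → ℝ)) →
      ∃ Z : (Fin n → ℝ) → Finset (Fin n) → ℝ, (∀ K, Measurable fun q => Z q K) ∧
        (∀ q, IsMenuDistribution k (Z q)) ∧
        ∀ t ∈ 𝒯, ∀ q ∈ convexHull ℝ (t : Set (Fin n → ℝ)), ∑ K, Z q K • menuDist s K = q := by
    intro 𝒯
    induction 𝒯 using Finset.induction_on with
    | empty =>
      intro _
      obtain ⟨K₀, hK₀, -⟩ := exists_top_menu hkn s
      refine ⟨fun _ K => if K = K₀ then 1 else 0, fun K => measurable_const,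
        fun q => ⟨fun K => ?_, fun K hK => if_neg ?_, by simp⟩, by simp⟩
      · dsimp only; split_ifs <;> norm_num
      · rintro rfl; exact hK hK₀
    | insert t 𝒯 _ ih =>
      intro h
      obtain ⟨Z, hZ1, hZ2, hZ3⟩ := ih fun t' ht' => h t' (Finset.mem_insert_of_mem ht')
      obtain ⟨Y, hY1, hY2⟩ := exists_measurable_weights_of_affineIndependent s
        (h t (Finset.mem_insert_self _ _)).1 (h t (Finset.mem_insert_self _ _)).2
      have hmeas : MeasurableSet (convexHull ℝ (t : Set (Fin n → ℝ))) :=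
        (t.finite_toSet.isClosed_convexHull ℝ).measurableSet
      refine ⟨fun q => if q ∈ convexHull ℝ (t : Set (Fin n → ℝ)) then Y q else Z q,
        fun K => ?_, fun q => ?_, fun t' ht' q hq => ?_⟩
      · have : (fun q => (if q ∈ convexHull ℝ (t : Set (Fin n → ℝ)) then Y q else Z q) K)
            = fun q => if q ∈ convexHull ℝ (t : Set (Fin n → ℝ)) then Y q K else Z q K := by
          ext q; split_ifs <;> rfl
        rw [this]
        exact Measurable.ite hmeas (hY1 K) (hZ1 K)
      · dsimp only; split_ifs with hq
        · exact (hY2 q hq).1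
        · exact hZ2 q
      · dsimp only; split_ifs with hq'
        · exact (hY2 q hq').2
        · rcases Finset.mem_insert.1 ht' with rfl | ht'
          · exact absurd hq hq'
          · exact hZ3 t' ht' q hq
  obtain ⟨Z, hZ1, hZ2, hZ3⟩ := glue
    ((finite_menuDists k s).toFinset.powerset.filter fun t =>
      AffineIndependent ℝ ((↑) : t → Fin n → ℝ)) fun t ht => by
        rw [Finset.mem_filter, Finset.mem_powerset] at ht
        exact ⟨fun p hp => by simpa using ht.1 hp, ht.2⟩
  refine ⟨Z, hZ1, hZ2, fun q hq => ?_⟩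
  rw [menuHull, convexHull_eq_union] at hq
  simp only [Set.mem_iUnion] at hq
  obtain ⟨t, ht, hind, hqt⟩ := hq
  refine hZ3 t (Finset.mem_filter.2 ⟨Finset.mem_powerset.2 fun p hp => ?_, hind⟩) q hqt
  simpa using ht hp

/-! ### Solutions of the linear program that are affine in the exploration step. -/

/-- Linear part of `lift`. -/
noncomputable def liftLin (n : ℕ) : Reduced n →ₗ[ℝ] (Fin n → ℝ) where
  toFun w := lift w - uniformVec n
  map_add' x y := by
    ext i
    by_cases h : i.val < n - 1
    · simp only [Pi.sub_apply, Pi.add_apply, lift_apply_of_lt _ h, uniformVec, PiLp.add_apply]; ring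
    · simp only [Pi.sub_apply, Pi.add_apply, lift_apply_last _ h, uniformVec, PiLp.add_apply,
        Finset.sum_add_distrib]; ring
  map_smul' r x := by
    ext i
    by_cases h : i.val < n - 1
    · simp only [Pi.sub_apply, Pi.smul_apply, lift_apply_of_lt _ h, uniformVec, PiLp.smul_apply,
        smul_eq_mul, RingHom.id_apply]; ring
    · simp only [Pi.sub_apply, Pi.smul_apply, lift_apply_last _ h, uniformVec, PiLp.smul_apply,
        smul_eq_mul, RingHom.id_apply, ← Finset.mul_sum]; ring

lemma lift_eq {n : ℕ} (w : Reduced n) : lift w = uniformVec n + liftLin n w :=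
  (add_sub_cancel _ _).symm

/-- Coordinate directions of the reduced space. -/
noncomputable def unitDir (n : ℕ) (j : Fin (n - 1)) : Reduced n := EuclideanSpace.single j 1

lemma sum_smul_unitDir {n : ℕ} (w : Reduced n) : ∑ j, w j • unitDir n j = w := by
  ext i
  simp [unitDir, Pi.single_apply]

/-- The vertices of the cross-polytope of radius `R` are inducible. -/
def CrossInHull {n : ℕ} (k : ℕ) (R : ℝ) (s : Fin n → ℝ) : Prop :=
  ∀ j : Fin (n - 1), lift (R • unitDir n j) ∈ menuHull k s ∧
    lift (-(R • unitDir n j)) ∈ menuHull k s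

/-- Solutions for the vertices `±R e_j` are mixed with coefficients `1 / (2 m) ± w_j / (2 R)`, where
`m = n - 1`. These are nonnegative since `|w_j| ≤ R / n`, and affine in `w`. The `ℓ¹`-bound on the
slopes is what later limits the influence of the model error on the gradient. -/
lemma exists_affine_weights {n k : ℕ} (hn : 2 ≤ n) {R : ℝ} (hR : 0 < R) {s : Fin n → ℝ}
    (hs : CrossInHull k R s) :
    ∃ (z : Finset (Fin n) → ℝ) (ζ : Fin (n - 1) → Finset (Fin n) → ℝ),
      (∀ j, ∑ K, |ζ j K| ≤ 1 / R) ∧ (∀ j K, K.card ≠ k → ζ j K = 0) ∧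
      ∀ w : Reduced n, n * ‖w‖ ≤ R → IsMenuDistribution k (fun K => z K + ∑ j, w j * ζ j K) ∧
        ∑ K, (z K + ∑ j, w j * ζ j K) • menuDist s K = lift w := by
  have hp : ∀ j, ∃ z, IsMenuDistribution k z ∧
      ∑ K, z K • menuDist s K = lift (R • unitDir n j) := fun j => mem_menuHull.1 (hs j).1
  have hm : ∀ j, ∃ z, IsMenuDistribution k z ∧
      ∑ K, z K • menuDist s K = lift (-(R • unitDir n j)) := fun j => mem_menuHull.1 (hs j).2
  choose zp hzp hzp' using hp
  choose zm hzm hzm' using hm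
  set m : ℝ := ((n - 1 : ℕ) : ℝ) with hmdef
  have hm1 : 1 ≤ m := by rw [hmdef]; exact_mod_cast (by omega : 1 ≤ n - 1)
  have hm0 : m ≠ 0 := by positivity
  have hmn : m ≤ n := by rw [hmdef]; exact_mod_cast (by omega : n - 1 ≤ n)
  have hform : ∀ (w : Reduced n) K,
      (∑ j, 1 / (2 * m) * (zp j K + zm j K)) + ∑ j, w j * (1 / (2 * R) * (zp j K - zm j K))
      = ∑ j, ((1 / (2 * m) + w j / (2 * R)) * zp j K + (1 / (2 * m) - w j / (2 * R)) * zm j K) := by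
    intro w K
    rw [← Finset.sum_add_distrib]
    exact Finset.sum_congr rfl fun j _ => by ring
  refine ⟨fun K => ∑ j, 1 / (2 * m) * (zp j K + zm j K),
    fun j K => 1 / (2 * R) * (zp j K - zm j K), fun j => ?_, fun j K hK => by
      dsimp only; rw [(hzp j).2.1 K hK, (hzm j).2.1 K hK]; ring, fun w hw => ?_⟩
  · calc ∑ K, |1 / (2 * R) * (zp j K - zm j K)| ≤ ∑ K, 1 / (2 * R) * (zp j K + zm j K) := by
          refine Finset.sum_le_sum fun K _ => ?_
          rw [abs_mul, abs_of_pos (by positivity : 0 < 1 / (2 * R))]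
          gcongr
          exact abs_le.2 ⟨by linarith [(hzp j).1 K], by linarith [(hzm j).1 K]⟩
      _ = 1 / R := by
          rw [← Finset.mul_sum, Finset.sum_add_distrib, (hzp j).2.2, (hzm j).2.2]
          field_simp; norm_num
  · have hwj : ∀ j, |w j| / (2 * R) ≤ 1 / (2 * m) := fun j => by
      have h1 : |w j| ≤ ‖w‖ := by simpa using PiLp.norm_apply_le w j
      rw [div_le_div_iff₀ (by positivity) (by positivity)]
      nlinarith [abs_nonneg (w j), mul_le_mul hmn h1 (abs_nonneg _) (by positivity)]
    have hwj' : ∀ j, 0 ≤ 1 / (2 * m) + w j / (2 * R) ∧ 0 ≤ 1 / (2 * m) - w j / (2 * R) := fun j => by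
      have h1 := hwj j
      rw [← abs_of_pos (by positivity : 0 < 2 * R), ← abs_div] at h1
      have := abs_le.1 h1
      exact ⟨by linarith, by linarith⟩
    have hsum1 : ∑ _j : Fin (n - 1), 1 / m = 1 := by
      simp [← hmdef, hm0]
    simp only [hform]
    refine ⟨⟨fun K => ?_, fun K hK => ?_, ?_⟩, ?_⟩
    · exact Finset.sum_nonneg fun j _ =>
        add_nonneg (mul_nonneg (hwj' j).1 ((hzp j).1 K)) (mul_nonneg (hwj' j).2 ((hzm j).1 K))
    · exact Finset.sum_eq_zero fun j _ => by rw [(hzp j).2.1 K hK, (hzm j).2.1 K hK]; ring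
    · rw [Finset.sum_comm]
      simp only [Finset.sum_add_distrib, ← Finset.mul_sum, (hzp _).2.2, (hzm _).2.2]
      rw [← Finset.sum_add_distrib]
      refine Eq.trans (Finset.sum_congr rfl fun j _ => ?_) hsum1
      field_simp; ring
    · simp only [Finset.sum_smul]
      rw [Finset.sum_comm]
      have : ∀ j, ∑ K, ((1 / (2 * m) + w j / (2 * R)) * zp j K
          + (1 / (2 * m) - w j / (2 * R)) * zm j K) • menuDist s K
          = (1 / m) • uniformVec n + liftLin n (w j • unitDir n j) := by
        intro j
        simp only [add_smul, mul_smul, Finset.sum_add_distrib, ← Finset.smul_sum, hzp', hzm']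
        rw [lift_eq, lift_eq, map_neg, map_smul, map_smul]
        ext i
        simp only [Pi.add_apply, Pi.smul_apply, Pi.neg_apply, smul_eq_mul]
        field_simp; ring
      rw [Finset.sum_congr rfl fun j _ => this j, Finset.sum_add_distrib, ← Finset.sum_smul, hsum1,
        ← map_sum, sum_smul_unitDir, one_smul, lift_eq]

/-- A solver which, on targets in the contraction of the inducible set, answers by a weight vector
that is affine in the exploration step. -/
lemma exists_affine_solver {n k : ℕ} (hkn : k ≤ n) (hn : 2 ≤ n) {θ R r : ℝ} (hθ0 : 0 < θ)
    (hθ1 : θ < 1) (hR : 0 < R) (hr : n * r ≤ R) :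
    ∃ lp : LPSolver n k, ∀ s, CrossInHull k R s → ∀ x : Reduced n,
      lift ((1 - θ)⁻¹ • x) ∈ menuHull k s →
      ∃ (z : Finset (Fin n) → ℝ) (ζ : Fin (n - 1) → Finset (Fin n) → ℝ),
        (∀ j, ∑ K, |ζ j K| ≤ 1 / R) ∧ (∀ j K, K.card ≠ k → ζ j K = 0) ∧
        ∀ w : Reduced n, ‖w‖ ≤ θ * r → (∀ K, lp.sol s x w K = z K + ∑ j, w j * ζ j K) ∧
          ∑ K, lp.sol s x w K • menuDist s K = lift (x + w) := by
  classical
  choose Z hZ1 hZ2 hZ3 using fun s : Fin n → ℝ => exists_measurable_weights (k := k) hkn s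
  have hex : ∀ s : Fin n → ℝ, ∃ (z : Finset (Fin n) → ℝ) (ζ : Fin (n - 1) → Finset (Fin n) → ℝ),
      CrossInHull k R s → (∀ j, ∑ K, |ζ j K| ≤ 1 / R) ∧ (∀ j K, K.card ≠ k → ζ j K = 0) ∧
      ∀ w : Reduced n, n * ‖w‖ ≤ R → IsMenuDistribution k (fun K => z K + ∑ j, w j * ζ j K) ∧
        ∑ K, (z K + ∑ j, w j * ζ j K) • menuDist s K = lift w := fun s => by
    by_cases h : CrossInHull k R s
    · obtain ⟨z, ζ, h1⟩ := exists_affine_weights hn hR h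
      exact ⟨z, ζ, fun _ => h1⟩
    · exact ⟨0, 0, fun h' => absurd h' h⟩
  choose zb ζb hb using hex
  -- The affine rule applies only here; all other targets fall back to the measurable weights `Z`,
  -- so that every feasible program is still solved.
  let cond : (Fin n → ℝ) → Reduced n → Reduced n → Prop := fun s x w =>
    CrossInHull k R s ∧ lift ((1 - θ)⁻¹ • x) ∈ menuHull k s ∧ ‖w‖ ≤ θ * r
  have h1θ : 0 < 1 - θ := by linarith
  have hw : ∀ w : Reduced n, ‖w‖ ≤ θ * r → n * ‖θ⁻¹ • w‖ ≤ R := fun w hw => by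
    rw [norm_smul, norm_inv, Real.norm_eq_abs, abs_of_pos hθ0]
    refine le_trans ?_ hr
    gcongr
    rw [inv_mul_le_iff₀ hθ0]; exact hw
  -- The target is split as `x + w = (1 - θ) ((1 - θ)⁻¹ x) + θ (θ⁻¹ w)`. The weights of the first
  -- part may depend on `x` in any measurable way; only the second part has to be affine in `w`, and
  -- it stays inside the cross-polytope because `n * r ≤ R`.
  let V : (Fin n → ℝ) → Reduced n → Reduced n → Finset (Fin n) → ℝ := fun s x w K =>
    (1 - θ) * Z s (lift ((1 - θ)⁻¹ • x)) K + θ * (zb s K + ∑ j, (θ⁻¹ • w) j * ζb s j K)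
  have hV : ∀ s x w, cond s x w → IsMenuDistribution k (V s x w) ∧
      ∑ K, V s x w K • menuDist s K = lift (x + w) := by
    rintro s x w ⟨h1, h2, h3⟩
    obtain ⟨hd, he⟩ := (hb s h1).2.2 _ (hw w h3)
    refine ⟨⟨fun K => ?_, fun K hK => ?_, ?_⟩, ?_⟩
    · exact add_nonneg (mul_nonneg h1θ.le ((hZ2 s _).1 K)) (mul_nonneg hθ0.le (hd.1 K))
    · have := hd.2.1 K hK
      simp only [V, (hZ2 s _).2.1 K hK, this]; ring
    · simp only [V, Finset.sum_add_distrib, ← Finset.mul_sum, (hZ2 s _).2.2]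
      have := hd.2.2
      simp only [Finset.sum_add_distrib] at this
      rw [this]; ring
    · simp only [V, add_smul (_ * _), mul_smul]
      rw [Finset.sum_add_distrib, ← Finset.smul_sum, ← Finset.smul_sum, he, hZ3 s _ h2,
        ← lift_combo _ _ (by ring : (1 - θ) + θ = 1), smul_smul, smul_smul,
        mul_inv_cancel₀ h1θ.ne', mul_inv_cancel₀ hθ0.ne', one_smul, one_smul]
  refine ⟨⟨fun s x w => if cond s x w then V s x w else Z s (lift (x + w)), fun s x w => ?_,
    fun s x w hex => ?_, fun s K => ?_⟩, fun s hs x hx => ?_⟩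
  · split_ifs with h
    · exact (hV s x w h).1
    · exact hZ2 s _
  · split_ifs with h
    · exact (hV s x w h).2
    · exact hZ3 s _ (mem_menuHull.2 hex)
  -- For fixed `s` this part of `cond` is constant; the remaining part is the preimage of a closed
  -- set in `(x, w)`.
  · by_cases hs : CrossInHull k R s
    · have e : (fun q : Reduced n × Reduced n =>
          (if cond s q.1 q.2 then V s q.1 q.2 else Z s (lift (q.1 + q.2))) K)
          = fun q => if cond s q.1 q.2 then V s q.1 q.2 K else Z s (lift (q.1 + q.2)) K := by
        ext q; split_ifs <;> rfl
      rw [e]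
      have hcl : Measurable (lift : Reduced n → Fin n → ℝ) := continuous_lift.measurable
      refine Measurable.ite ?_ ?_ ?_
      · have hset : {q : Reduced n × Reduced n | cond s q.1 q.2}
            = (fun q : Reduced n × Reduced n => lift ((1 - θ)⁻¹ • q.1)) ⁻¹' menuHull k s
              ∩ {q | ‖q.2‖ ≤ θ * r} := by
          ext q; simp [cond, hs]
        rw [hset]
        exact (hcl.comp (by fun_prop) (isClosed_menuHull k s).measurableSet).inter
          (measurableSet_le (by fun_prop) (by fun_prop))
      · have h1 : Measurable fun q : Reduced n × Reduced n => Z s (lift ((1 - θ)⁻¹ • q.1)) K :=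
          (hZ1 s K).comp (hcl.comp (by fun_prop))
        have h2 : Measurable fun q : Reduced n × Reduced n =>
            zb s K + ∑ j, (θ⁻¹ • q.2) j * ζb s j K := by fun_prop
        exact (h1.const_mul _).add (h2.const_mul _)
      · exact (hZ1 s K).comp (hcl.comp (by fun_prop))
    · have e : (fun q : Reduced n × Reduced n =>
          (if cond s q.1 q.2 then V s q.1 q.2 else Z s (lift (q.1 + q.2))) K)
          = fun q => Z s (lift (q.1 + q.2)) K := by
        ext q; rw [if_neg]; exact fun h => hs h.1
      rw [e]
      exact (hZ1 s K).comp (continuous_lift.measurable.comp (by fun_prop))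
  · refine ⟨fun K => (1 - θ) * Z s (lift ((1 - θ)⁻¹ • x)) K + θ * zb s K, ζb s, (hb s hs).1,
      (hb s hs).2.1,
      fun w hw' => ?_⟩
    have hc : cond s x w := ⟨hs, hx, hw'⟩
    simp only [if_pos hc]
    refine ⟨fun K => ?_, (hV s x w hc).2⟩
    simp only [V, PiLp.smul_apply, smul_eq_mul]
    rw [mul_add, Finset.mul_sum, ← add_assoc]
    congr 1
    refine Finset.sum_congr rfl fun j _ => ?_
    field_simp

/-! ### The uniform distribution on the sphere -/

lemma isProbabilityMeasure_sphereUniform {n : ℕ} (hn : 2 ≤ n) :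
    IsProbabilityMeasure (sphereUniform n) := by
  have : Nonempty (Fin (n - 1)) := ⟨⟨0, by omega⟩⟩
  have : Nontrivial (Reduced n) := inferInstance
  constructor
  rw [sphereUniform, Measure.smul_apply, smul_eq_mul]
  refine ENNReal.inv_mul_cancel ?_ (measure_ne_top _ _)
  rw [Ne, Measure.measure_univ_eq_zero]
  exact Measure.toSphere_ne_zero _

/-- Action of a linear isometry on the unit sphere. -/
noncomputable def sphereMap {n : ℕ} (φ : Reduced n ≃ₗᵢ[ℝ] Reduced n) (v : Metric.sphere (0 : Reduced n) 1) :
    Metric.sphere (0 : Reduced n) 1 :=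
  ⟨φ v, by simp⟩

lemma continuous_sphereMap {n : ℕ} (φ : Reduced n ≃ₗᵢ[ℝ] Reduced n) : Continuous (sphereMap φ) := by
  unfold sphereMap
  fun_prop

-- The measure of a set on the sphere is a multiple of the volume of the cone over it, and a linear
-- isometry maps cones to cones and preserves volume.
open scoped Pointwise in
lemma map_sphereUniform {n : ℕ} (φ : Reduced n ≃ₗᵢ[ℝ] Reduced n) :
    Measure.map (sphereMap φ) (sphereUniform n) = sphereUniform n := by
  have hm := (continuous_sphereMap φ).measurable
  rw [sphereUniform, Measure.map_smul]
  congr 1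
  ext s hs
  rw [Measure.map_apply hm hs, Measure.toSphere_apply' _ hs, Measure.toSphere_apply' _ (hm hs)]
  congr 1
  have hset : Set.Ioo (0 : ℝ) 1 • ((↑) '' (sphereMap φ ⁻¹' s) : Set (Reduced n))
      = φ ⁻¹' (Set.Ioo (0 : ℝ) 1 • ((↑) '' s)) := by
    ext x
    constructor
    · rintro ⟨a, ha, _, ⟨v, hv, rfl⟩, rfl⟩
      exact ⟨a, ha, _, ⟨sphereMap φ v, hv, rfl⟩, by simp [sphereMap]⟩
    · rintro ⟨a, ha, _, ⟨v, hv, rfl⟩, hx⟩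
      have hx' : x = a • φ.symm v := by
        rw [← map_smul]; exact (φ.symm_apply_eq.2 hx).symm
      refine ⟨a, ha, φ.symm v, ⟨⟨φ.symm v, by simp⟩, ?_, rfl⟩, hx'.symm⟩
      have : sphereMap φ ⟨φ.symm v, by simp⟩ = v := by ext1; simp [sphereMap]
      rw [Set.mem_preimage, this]; exact hv
  rw [hset]
  exact φ.measurePreserving.measure_preimage_emb φ.toHomeomorph.measurableEmbedding _

lemma integral_sphereMap {n : ℕ} (φ : Reduced n ≃ₗᵢ[ℝ] Reduced n)
    {f : Metric.sphere (0 : Reduced n) 1 → ℝ} (hf : Continuous f) :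
    ∫ v, f (sphereMap φ v) ∂(sphereUniform n) = ∫ v, f v ∂(sphereUniform n) := by
  conv_rhs => rw [← map_sphereUniform φ]
  exact (integral_map (continuous_sphereMap φ).aemeasurable hf.aestronglyMeasurable).symm

lemma integral_sphere_coord {n : ℕ} (j : Fin (n - 1)) :
    ∫ v, (v : Reduced n) j ∂(sphereUniform n) = 0 := by
  have h := integral_sphereMap (LinearIsometryEquiv.neg ℝ)
    (f := fun v : Metric.sphere (0 : Reduced n) 1 => (v : Reduced n) j) (by fun_prop)
  simp only [sphereMap, LinearIsometryEquiv.coe_neg, PiLp.neg_apply, integral_neg] at h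
  linarith

/-- Reflecting the `j`-th coordinate preserves the measure and flips the sign of the integrand. -/
lemma integral_sphere_mul_of_ne {n : ℕ} {j l : Fin (n - 1)} (hjl : j ≠ l) :
    ∫ v, (v : Reduced n) j * (v : Reduced n) l ∂(sphereUniform n) = 0 := by
  let φ : Reduced n ≃ₗᵢ[ℝ] Reduced n := LinearIsometryEquiv.piLpCongrRight 2
    fun i => if i = j then LinearIsometryEquiv.neg ℝ else LinearIsometryEquiv.refl ℝ ℝ
  have h := integral_sphereMap φ
    (f := fun v : Metric.sphere (0 : Reduced n) 1 => (v : Reduced n) j * (v : Reduced n) l)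
    (by fun_prop)
  have h1 : ∀ v : Reduced n, (φ v) j = - v j := fun v => by simp [φ]
  have h2 : ∀ v : Reduced n, (φ v) l = v l := fun v => by simp [φ, hjl.symm]
  simp only [sphereMap, h1, h2, neg_mul, integral_neg] at h
  linarith

lemma integrable_sphere {n : ℕ} (hn : 2 ≤ n) {f : Metric.sphere (0 : Reduced n) 1 → ℝ}
    (hf : Continuous f) : Integrable f (sphereUniform n) := by
  have := isProbabilityMeasure_sphereUniform hn
  have : CompactSpace (Metric.sphere (0 : Reduced n) 1) :=
    isCompact_iff_compactSpace.1 (isCompact_sphere _ _)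
  obtain ⟨C, hC⟩ := (isCompact_range hf).isBounded.exists_norm_le
  exact Integrable.of_bound hf.aestronglyMeasurable C (ae_of_all _ fun v => hC _ ⟨v, rfl⟩)

/-- Swapping coordinates shows that all `n - 1` second moments agree, and on the unit sphere they
add up to `1`. -/
lemma integral_sphere_sq {n : ℕ} (hn : 2 ≤ n) (j : Fin (n - 1)) :
    ∫ v, (v : Reduced n) j * (v : Reduced n) j ∂(sphereUniform n) = 1 / ((n - 1 : ℕ) : ℝ) := by
  have := isProbabilityMeasure_sphereUniform hn
  have heq : ∀ l, ∫ v, (v : Reduced n) l * (v : Reduced n) l ∂(sphereUniform n)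
      = ∫ v, (v : Reduced n) j * (v : Reduced n) j ∂(sphereUniform n) := fun l => by
    have h := integral_sphereMap (LinearIsometryEquiv.piLpCongrLeft 2 ℝ ℝ (Equiv.swap j l))
      (f := fun v : Metric.sphere (0 : Reduced n) 1 => (v : Reduced n) j * (v : Reduced n) j)
      (by fun_prop)
    rw [← h]
    simp [sphereMap, LinearIsometryEquiv.piLpCongrLeft_apply, Equiv.piCongrLeft'_apply]
  have hsum : ∑ l, ∫ v, (v : Reduced n) l * (v : Reduced n) l ∂(sphereUniform n) = 1 := by
    rw [← integral_finsetSum _ fun l _ => integrable_sphere hn (by fun_prop)]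
    have : ∀ v : Metric.sphere (0 : Reduced n) 1,
        ∑ l, (v : Reduced n) l * (v : Reduced n) l = 1 := fun v => by
      have h1 : ‖(v : Reduced n)‖ ^ 2 = 1 := by simp
      rw [EuclideanSpace.norm_sq_eq] at h1
      exact (Finset.sum_congr rfl fun l _ => by rw [Real.norm_eq_abs, sq_abs, sq]).trans h1
    simp [this]
  simp only [heq, Finset.sum_const, Finset.card_univ, Fintype.card_fin, nsmul_eq_mul] at hsum
  have : ((n - 1 : ℕ) : ℝ) ≠ 0 := by
    have : n - 1 ≠ 0 := by omega
    exact_mod_cast this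
  rw [eq_div_iff this]
  linarith

/-- Only first and second moments occur: the mean kills the constant `a`, and the covariance is the
identity over `n - 1`. For an affine reward this makes the one-point gradient estimate exactly
unbiased, without any smoothing error. -/
lemma integral_sphere_affine_mul_linear {n : ℕ} (hn : 2 ≤ n) (a : ℝ) (b d : Fin (n - 1) → ℝ) :
    ∫ v, (a + ∑ j, (v : Reduced n) j * b j) * (∑ l, (v : Reduced n) l * d l) ∂(sphereUniform n)
      = (∑ j, b j * d j) / ((n - 1 : ℕ) : ℝ) := by
  have e : ∀ v : Metric.sphere (0 : Reduced n) 1,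
      (a + ∑ j, (v : Reduced n) j * b j) * (∑ l, (v : Reduced n) l * d l)
      = (∑ l, (a * d l) * (v : Reduced n) l)
        + ∑ j, ∑ l, (b j * d l) * ((v : Reduced n) j * (v : Reduced n) l) := fun v => by
    rw [add_mul, Finset.mul_sum, Finset.sum_mul_sum]
    congr 1
    · exact Finset.sum_congr rfl fun _ _ => by ring
    · exact Finset.sum_congr rfl fun _ _ => Finset.sum_congr rfl fun _ _ => by ring
  simp only [e]
  rw [integral_add (integrable_sphere hn (by fun_prop)) (integrable_sphere hn (by fun_prop)),
    integral_finsetSum _ fun l _ => integrable_sphere hn (by fun_prop),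
    integral_finsetSum _ fun l _ => integrable_sphere hn (by fun_prop)]
  simp only [integral_const_mul, integral_sphere_coord, mul_zero, Finset.sum_const_zero, zero_add]
  rw [Finset.sum_div]
  refine Finset.sum_congr rfl fun j _ => ?_
  rw [integral_finsetSum _ fun l _ => integrable_sphere hn (by fun_prop)]
  simp only [integral_const_mul]
  rw [Finset.sum_eq_single j]
  · rw [integral_sphere_sq hn]; ring
  · intro l _ hl
    rw [integral_sphere_mul_of_ne hl.symm, mul_zero]
  · simp

/-! ### Resampling one coordinate of a product measure -/

lemma measurePreserving_update {α : Type*} [MeasurableSpace α] {T : ℕ} (σ : Measure α)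
    [IsProbabilityMeasure σ] (t : Fin T) :
    MeasurePreserving (fun p : (Fin T → α) × α => Function.update p.1 t p.2)
      ((Measure.pi fun _ : Fin T => σ).prod σ) (Measure.pi fun _ => σ) := by
  refine ⟨measurable_update', ?_⟩
  symm
  refine Measure.pi_eq fun s hs => ?_
  rw [Measure.map_apply measurable_update' (MeasurableSet.univ_pi hs)]
  have hset : (fun p : (Fin T → α) × α => Function.update p.1 t p.2) ⁻¹' Set.univ.pi s
      = (Set.univ.pi fun i => if i = t then Set.univ else s i) ×ˢ s t := by
    ext ⟨ω, v⟩
    simp only [Set.mem_preimage, Set.mem_pi, Set.mem_univ, true_implies, Set.mem_prod]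
    constructor
    · intro h
      refine ⟨fun i => ?_, by simpa using h t⟩
      split_ifs with hi
      · trivial
      · simpa [hi] using h i
    · rintro ⟨h1, h2⟩ i
      by_cases hi : i = t
      · subst hi; simpa using h2
      · simpa [hi] using h1 i
  rw [hset, Measure.prod_prod, Measure.pi_pi, ← Finset.mul_prod_erase _ _ (Finset.mem_univ t),
    ← Finset.mul_prod_erase _ (fun i => σ (s i)) (Finset.mem_univ t), if_pos rfl, measure_univ,
    one_mul, mul_comm]
  congr 1
  exact Finset.prod_congr rfl fun i hi => by rw [if_neg (Finset.ne_of_mem_erase hi)]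

/-- A fresh draw of one coordinate does not change the law. This takes the place of conditioning on
the other directions. -/
lemma integral_pi_update {α : Type*} [MeasurableSpace α] {T : ℕ} (σ : Measure α)
    [IsProbabilityMeasure σ] (t : Fin T) {F : (Fin T → α) → ℝ} (hF : Measurable F) {B : ℝ}
    (hB : ∀ ω, |F ω| ≤ B) :
    ∫ ω, F ω ∂(Measure.pi fun _ => σ)
      = ∫ ω, ∫ v, F (Function.update ω t v) ∂σ ∂(Measure.pi fun _ => σ) := by
  have hmp := measurePreserving_update σ t
  conv_lhs => rw [← hmp.map_eq]
  rw [integral_map hmp.measurable.aemeasurable hF.aestronglyMeasurable]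
  rw [integral_prod]
  exact Integrable.of_bound (hF.comp hmp.measurable).aestronglyMeasurable B
    (ae_of_all _ fun p => hB _)

/-! ### Expectations over trajectories as iterated one-step expectations -/

/-- Transition weights of the next menu and item. -/
abbrev Transition (n : ℕ) : Type := List (Obs n) → Finset (Fin n) → Fin n → ℝ

structure IsTransition {n : ℕ} (W : Transition n) : Prop where
  nonneg : ∀ h K i, 0 ≤ W h K i
  sum_eq_one : ∀ h, ∑ K, ∑ i, W h K i = 1

/-- The history extended by one round. -/
def addRound {n : ℕ} (R : ℕ → Fin n → ℝ) (h : List (Obs n)) (K : Finset (Fin n)) (i : Fin n) :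
    List (Obs n) := h ++ [⟨K, i, R h.length i⟩]

@[simp] lemma length_addRound {n : ℕ} (R : ℕ → Fin n → ℝ) (h : List (Obs n)) (K : Finset (Fin n))
    (i : Fin n) : (addRound R h K i).length = h.length + 1 := by simp [addRound]

/-- One-step expectation operator. -/
noncomputable def stepE {n : ℕ} (W : Transition n) (R : ℕ → Fin n → ℝ)
    (f : List (Obs n) → ℝ) (h : List (Obs n)) : ℝ :=
  ∑ K, ∑ i, W h K i * f (addRound R h K i)

section stepE

variable {n : ℕ} {W : Transition n} {R : ℕ → Fin n → ℝ}

lemma stepE_mono (hW : IsTransition W) {f g : List (Obs n) → ℝ} {h : List (Obs n)}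
    (hfg : ∀ K i, W h K i ≠ 0 → f (addRound R h K i) ≤ g (addRound R h K i)) :
    stepE W R f h ≤ stepE W R g h := by
  refine Finset.sum_le_sum fun K _ => Finset.sum_le_sum fun i _ => ?_
  by_cases h0 : W h K i = 0
  · rw [h0, zero_mul, zero_mul]
  · exact mul_le_mul_of_nonneg_left (hfg K i h0) (hW.nonneg h K i)

lemma stepE_const_mul_add (hW : IsTransition W) (f : List (Obs n) → ℝ) (a b : ℝ)
    (h : List (Obs n)) : stepE W R (fun h' => a * f h' + b) h = a * stepE W R f h + b := by
  have : ∀ K i, W h K i * (a * f (addRound R h K i) + b)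
      = a * (W h K i * f (addRound R h K i)) + W h K i * b := fun K i => by ring
  simp only [stepE, this, Finset.sum_add_distrib, ← Finset.mul_sum, ← Finset.sum_mul,
    hW.sum_eq_one, one_mul]

lemma stepE_sum {ι : Type*} (s : Finset ι) (f : ι → List (Obs n) → ℝ) (h : List (Obs n)) :
    stepE W R (fun h' => ∑ j ∈ s, f j h') h = ∑ j ∈ s, stepE W R (f j) h := by
  simp only [stepE, Finset.mul_sum]
  rw [Finset.sum_comm (s := s)]
  refine Finset.sum_congr rfl fun K _ => ?_
  rw [Finset.sum_comm]

/-- The comparison is needed only on histories that satisfy the invariant: transitions that might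
destroy it carry weight zero. -/
lemma iterate_mono_of_inv (hW : IsTransition W) {Inv : List (Obs n) → Prop} {tb : ℕ}
    (step : ∀ h, Inv h → h.length < tb → ∀ K i, W h K i ≠ 0 → Inv (addRound R h K i))
    {f g : List (Obs n) → ℝ} : ∀ (m : ℕ) (h : List (Obs n)), Inv h → h.length + m ≤ tb →
      (∀ h', Inv h' → h'.length = h.length + m → f h' ≤ g h') →
      (stepE W R)^[m] f h ≤ (stepE W R)^[m] g h
  | 0, h, hI, _, hfg => hfg h hI rfl
  | m + 1, h, hI, hl, hfg => by
    rw [Function.iterate_succ_apply', Function.iterate_succ_apply']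
    refine stepE_mono hW fun K i hne => ?_
    refine iterate_mono_of_inv hW step m _ (step h hI (by omega) K i hne) ?_ fun h' hI' hl' => ?_
    · rw [length_addRound]; omega
    · refine hfg h' hI' ?_
      rw [hl', length_addRound]; omega

lemma iterate_mono (hW : IsTransition W) {f g : List (Obs n) → ℝ} {m : ℕ} {h : List (Obs n)}
    (hfg : ∀ h', h'.length = h.length + m → f h' ≤ g h') :
    (stepE W R)^[m] f h ≤ (stepE W R)^[m] g h :=
  iterate_mono_of_inv (Inv := fun _ => True) hW (fun _ _ _ _ _ _ => trivial) m h trivial le_rfl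
    fun h' _ => hfg h'

lemma iterate_congr (hW : IsTransition W) {f g : List (Obs n) → ℝ} {m : ℕ} {h : List (Obs n)}
    (hfg : ∀ h', h'.length = h.length + m → f h' = g h') :
    (stepE W R)^[m] f h = (stepE W R)^[m] g h :=
  le_antisymm (iterate_mono hW fun h' hl => (hfg h' hl).le)
    (iterate_mono hW fun h' hl => (hfg h' hl).ge)

lemma iterate_const_mul_add (hW : IsTransition W) (f : List (Obs n) → ℝ) (a b : ℝ) (m : ℕ) :
    (stepE W R)^[m] (fun h' => a * f h' + b) = fun h => a * (stepE W R)^[m] f h + b := by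
  induction m with
  | zero => rfl
  | succ m ih =>
    rw [Function.iterate_succ_apply', ih, Function.iterate_succ_apply']
    ext h
    exact stepE_const_mul_add hW _ a b h

lemma iterate_const (hW : IsTransition W) (b : ℝ) (m : ℕ) (h : List (Obs n)) :
    (stepE W R)^[m] (fun _ => b) h = b := by
  have := congrFun (iterate_const_mul_add (R := R) hW (fun _ => 0) 0 b m) h
  simpa using this

lemma iterate_sum {ι : Type*} (s : Finset ι) (f : ι → List (Obs n) → ℝ) (m : ℕ) :
    (stepE W R)^[m] (fun h' => ∑ j ∈ s, f j h') = fun h => ∑ j ∈ s, (stepE W R)^[m] (f j) h := by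
  induction m with
  | zero => rfl
  | succ m ih =>
    rw [Function.iterate_succ_apply', ih]
    ext h
    rw [stepE_sum]
    exact Finset.sum_congr rfl fun j _ => by rw [Function.iterate_succ_apply']

/-- Rounds after the first `t` contribute weights summing to one, so quantities of different rounds
can all be evaluated over the full horizon. -/
lemma iterate_take (hW : IsTransition W) (f : List (Obs n) → ℝ) {t T : ℕ} (htT : t ≤ T) :
    (stepE W R)^[T] (fun h => f (h.take t)) [] = (stepE W R)^[t] f [] := by
  have aux : ∀ (m : ℕ) (h : List (Obs n)), t ≤ h.length →
      (stepE W R)^[m] (fun h => f (h.take t)) h = f (h.take t) := by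
    intro m
    induction m with
    | zero => intro h _; rfl
    | succ m ih =>
      intro h hl
      rw [Function.iterate_succ_apply']
      have e : ∀ K i, (stepE W R)^[m] (fun h => f (h.take t)) (addRound R h K i) = f (h.take t) :=
        fun K i => by
          rw [ih _ (by rw [length_addRound]; omega), addRound, List.take_append_of_le_length hl]
      simp only [stepE, e, ← Finset.sum_mul, hW.sum_eq_one, one_mul]
  obtain ⟨m, rfl⟩ := Nat.exists_eq_add_of_le htT
  rw [Function.iterate_add_apply]
  refine iterate_congr hW fun h hl => ?_
  simp only [List.length_nil, zero_add] at hl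
  rw [aux m h hl.ge, List.take_of_length_le hl.le]

/-- Drift bound: if a potential grows in one step by a factor `a` and an increment `b` at most. -/
lemma iterate_le_of_drift (hW : IsTransition W) {Inv : List (Obs n) → Prop} {tb : ℕ}
    {Ψ : List (Obs n) → ℝ} {a b : ℝ} (ha : 1 ≤ a) (hb : 0 ≤ b)
    (step : ∀ h, Inv h → h.length < tb → ∀ K i, W h K i ≠ 0 → Inv (addRound R h K i))
    (drift : ∀ h, Inv h → h.length < tb → stepE W R Ψ h ≤ a * Ψ h + b) :
    ∀ (m : ℕ) (h : List (Obs n)), Inv h → h.length + m ≤ tb →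
      (stepE W R)^[m] Ψ h ≤ a ^ m * (Ψ h + m * b)
  | 0, h, _, _ => by simp
  | m + 1, h, hI, hl => by
    have ha0 : 0 ≤ a ^ m := by positivity
    rw [Function.iterate_succ_apply']
    calc stepE W R ((stepE W R)^[m] Ψ) h
        ≤ stepE W R (fun h' => a ^ m * Ψ h' + a ^ m * (m * b)) h := by
          refine stepE_mono hW fun K i hne => ?_
          have := iterate_le_of_drift hW ha hb step drift m _ (step h hI (by omega) K i hne)
            (by rw [length_addRound]; omega)
          linarith
      _ = a ^ m * stepE W R Ψ h + a ^ m * (m * b) := stepE_const_mul_add hW _ _ _ _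
      _ ≤ a ^ m * (a * Ψ h + b) + a ^ m * (m * b) := by
          gcongr; exact drift h hI (by omega)
      _ ≤ a ^ (m + 1) * (Ψ h + (m + 1 : ℕ) * b) := by
          have h1 : a ^ m * ((m + 1) * b) ≤ a ^ (m + 1) * ((m + 1) * b) := by
            refine mul_le_mul_of_nonneg_right ?_ (by positivity)
            rw [pow_succ]; nlinarith
          push_cast
          rw [pow_succ] at *
          nlinarith

open Classical in
/-- Markov's inequality for the drift bound. -/
lemma iterate_indicator_le_of_drift (hW : IsTransition W) {Inv : List (Obs n) → Prop} {tb : ℕ}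
    {Ψ : List (Obs n) → ℝ} {a b : ℝ} (ha : 1 ≤ a) (hb : 0 ≤ b)
    (step : ∀ h, Inv h → h.length < tb → ∀ K i, W h K i ≠ 0 → Inv (addRound R h K i))
    (drift : ∀ h, Inv h → h.length < tb → stepE W R Ψ h ≤ a * Ψ h + b)
    {Bad : List (Obs n) → Prop} {y : ℝ} (hy : 0 < y) (hΨ : ∀ h, 0 ≤ Ψ h)
    (hbad : ∀ h, Inv h → h.length = tb → Bad h → y ≤ Ψ h)
    {m : ℕ} {h : List (Obs n)} (hI : Inv h) (hl : h.length + m = tb) :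
    (stepE W R)^[m] (fun h' => if Bad h' then 1 else 0) h ≤ a ^ m * (Ψ h + m * b) / y := by
  calc (stepE W R)^[m] (fun h' => if Bad h' then 1 else 0) h
      ≤ (stepE W R)^[m] (fun h' => y⁻¹ * Ψ h' + 0) h := by
        refine iterate_mono_of_inv hW step m h hI hl.le fun h' hI' hl' => ?_
        split_ifs with hB
        · rw [add_zero, inv_mul_eq_div, le_div_iff₀ hy, one_mul]
          exact hbad h' hI' (hl'.trans hl) hB
        · have := hΨ h'; positivity
    _ = y⁻¹ * (stepE W R)^[m] Ψ h + 0 := by rw [iterate_const_mul_add hW]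
    _ ≤ y⁻¹ * (a ^ m * (Ψ h + m * b)) := by
        rw [add_zero]
        exact mul_le_mul_of_nonneg_left
          (iterate_le_of_drift hW ha hb step drift m h hI hl.le) (by positivity)
    _ = _ := by rw [inv_mul_eq_div]

open Classical in
/-- Starting from histories in `G₀`, the set `G₁` is missed after `m` rounds with probability at
most `η`. -/
def Reaches (W : Transition n) (R : ℕ → Fin n → ℝ) (G₀ G₁ : List (Obs n) → Prop) (m : ℕ)
    (η : ℝ) : Prop :=
  ∀ h, G₀ h → (stepE W R)^[m] (fun h' => if G₁ h' then 0 else 1) h ≤ η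

lemma Reaches.trans (hW : IsTransition W) {G₀ G₁ G₂ : List (Obs n) → Prop} {m m' : ℕ} {η η' : ℝ}
    (h1 : Reaches W R G₀ G₁ m η) (h2 : Reaches W R G₁ G₂ m' η') (hη' : 0 ≤ η') :
    Reaches W R G₀ G₂ (m + m') (η + η') := by
  classical
  intro h hG
  rw [Function.iterate_add_apply]
  calc _ ≤ (stepE W R)^[m] (fun h' => 1 * (if G₁ h' then 0 else 1) + η') h := by
        refine iterate_mono hW fun h' _ => ?_
        split_ifs with hG1
        · simpa using h2 h' hG1
        · refine (iterate_mono (g := fun _ => 1) hW fun h'' _ => ?_).trans ?_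
          · split_ifs <;> norm_num
          · rw [iterate_const hW]; linarith
    _ ≤ η + η' := by
        rw [iterate_const_mul_add hW]
        simp only [one_mul]
        have := h1 h hG
        gcongr

/-- A property which all extensions of the starting histories inherit costs no probability. Earlier
estimates are carried through later stages in this way. -/
lemma Reaches.and_of_prefix (hW : IsTransition W) {G₀ G₁ Q : List (Obs n) → Prop} {m : ℕ} {η : ℝ}
    (h : Reaches W R G₀ G₁ m η) (hQ : ∀ h h', G₀ h → h <+: h' → Q h') :
    Reaches W R G₀ (fun h => G₁ h ∧ Q h) m η := by
  classical
  intro l hl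
  refine le_trans ?_ (h l hl)
  refine iterate_mono_of_inv (Inv := fun h' => l <+: h') hW
    (fun h' hp _ K i _ => hp.trans (List.prefix_append _ _)) m l List.prefix_rfl le_rfl
    fun h' hp _ => ?_
  have := hQ l h' hl hp
  simp only [this, and_true]
  convert le_rfl

lemma Reaches.mono (hW : IsTransition W) {G₀ G₁ G₀' G₁' : List (Obs n) → Prop} {m : ℕ} {η η' : ℝ}
    (h : Reaches W R G₀ G₁ m η) (h0 : ∀ h, G₀' h → G₀ h) (h1 : ∀ h, G₁ h → G₁' h) (hη : η ≤ η') :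
    Reaches W R G₀' G₁' m η' := by
  classical
  intro l hl
  refine (iterate_mono hW fun h' _ => ?_).trans ((h l (h0 l hl)).trans hη)
  split_ifs with ha hb hb
  · exact le_rfl
  · norm_num
  · exact absurd (h1 _ hb) ha
  · exact le_rfl

end stepE

/-- Transition weights of a policy interacting with an agent. -/
noncomputable def transition {n : ℕ} (π : Policy n) (M : PreferenceModel n) (u : ℕ → Reduced n) :
    Transition n := fun h K i => π u h K * menuDist (M.score (memory h)) K i

lemma isTransition_transition {n k : ℕ} (hk : 1 ≤ k) {π : Policy n} {M : PreferenceModel n}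
    {u : ℕ → Reduced n} (hπ : ∀ h, IsMenuDistribution k (π u h)) (hM : ∀ v i, 0 < M.score v i) :
    IsTransition (transition π M u) := by
  refine ⟨fun h K i => mul_nonneg ((hπ h).1 K) (menuDist_nonneg (fun j _ => (hM _ j).le) i),
    fun h => ?_⟩
  simp only [transition, ← Finset.mul_sum]
  rw [← (hπ h).2.2]
  refine Finset.sum_congr rfl fun K _ => ?_
  by_cases hK : K.card = k
  · have : 0 < ∑ j ∈ K, M.score (memory h) j :=
      Finset.sum_pos (fun j _ => hM _ j) (Finset.card_pos.1 (by omega))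
    rw [sum_menuDist this.ne', mul_one]
  · rw [(hπ h).2.1 K hK, zero_mul]

lemma length_observed {n T : ℕ} (ρ : Fin T → Fin n → ℝ) (τ : Trajectory n T) :
    (observed ρ τ).length = T := by simp [observed]

lemma observed_snoc {n T : ℕ} (R : ℕ → Fin n → ℝ) (τ : Trajectory n T)
    (a : Finset (Fin n) × Fin n) :
    observed (fun t : Fin (T + 1) => R t) (Fin.snoc τ a : Trajectory n (T + 1))
      = addRound R (observed (fun t : Fin T => R t) τ) a.1 a.2 := by
  rw [addRound, length_observed, observed, List.ofFn_succ', List.concat_eq_append]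
  simp [observed, Fin.snoc_castSucc, Fin.snoc_last]

lemma trajectoryProb_snoc {n T : ℕ} (π : Policy n) (M : PreferenceModel n) (R : ℕ → Fin n → ℝ)
    (u : ℕ → Reduced n) (τ : Trajectory n T) (a : Finset (Fin n) × Fin n) :
    trajectoryProb π M (fun t : Fin (T + 1) => R t) u (Fin.snoc τ a : Trajectory n (T + 1))
      = trajectoryProb π M (fun t : Fin T => R t) u τ *
        transition π M u (observed (fun t : Fin T => R t) τ) a.1 a.2 := by
  have hl := length_observed (fun t : Fin T => R t) τ
  rw [trajectoryProb, Fin.prod_univ_castSucc, observed_snoc, addRound]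
  congr 1
  · refine Finset.prod_congr rfl fun t _ => ?_
    rw [List.take_append_of_le_length (by rw [hl]; simp), Fin.snoc_castSucc]
    rfl
  · rw [Fin.snoc_last, Fin.val_last, List.take_append_of_le_length hl.ge,
      List.take_of_length_le hl.le, transition]

/-- Induction on the horizon, splitting off the last round. It translates sums over trajectories
into iterates of `stepE`, in which the rest of the argument is phrased. -/
lemma sum_trajectoryProb_mul {n : ℕ} (π : Policy n) (M : PreferenceModel n) (R : ℕ → Fin n → ℝ)
    (u : ℕ → Reduced n) : ∀ (T : ℕ) (f : List (Obs n) → ℝ),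
    ∑ τ : Trajectory n T, trajectoryProb π M (fun t : Fin T => R t) u τ *
      f (observed (fun t : Fin T => R t) τ) = (stepE (transition π M u) R)^[T] f []
  | 0, f => by simp [trajectoryProb, observed]
  | T + 1, f => by
    rw [Function.iterate_succ_apply, ← sum_trajectoryProb_mul π M R u T]
    rw [← (Fin.snocEquiv fun _ : Fin (T + 1) => Finset (Fin n) × Fin n).sum_comp,
      Fintype.sum_prod_type_right]
    refine Finset.sum_congr rfl fun τ _ => ?_
    rw [stepE, Finset.mul_sum, Fintype.sum_prod_type]
    refine Finset.sum_congr rfl fun K _ => ?_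
    rw [Finset.mul_sum]
    refine Finset.sum_congr rfl fun i _ => ?_
    have e : (Fin.snocEquiv fun _ : Fin (T + 1) => Finset (Fin n) × Fin n) ((K, i), τ)
        = (Fin.snoc τ (K, i) : Trajectory n (T + 1)) := rfl
    rw [e, trajectoryProb_snoc, observed_snoc, mul_assoc]

/-- The reward functions as an infinite sequence. -/
noncomputable def rewardSeq {n T : ℕ} (ρ : Fin T → Fin n → ℝ) : ℕ → Fin n → ℝ :=
  fun t => if h : t < T then ρ ⟨t, h⟩ else 0

lemma rewardSeq_coe {n T : ℕ} (ρ : Fin T → Fin n → ℝ) :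
    (fun t : Fin T => rewardSeq ρ t) = ρ := by
  ext t i; simp [rewardSeq]

lemma sum_trajectoryProb_mul' {n T : ℕ} (π : Policy n) (M : PreferenceModel n)
    (ρ : Fin T → Fin n → ℝ) (u : ℕ → Reduced n) (f : List (Obs n) → ℝ) :
    ∑ τ : Trajectory n T, trajectoryProb π M ρ u τ * f (observed ρ τ)
      = (stepE (transition π M u) (rewardSeq ρ))^[T] f [] := by
  rw [← sum_trajectoryProb_mul, rewardSeq_coe]

/-! ### Counts -/

lemma itemCount_addRound {n : ℕ} (R : ℕ → Fin n → ℝ) (h : List (Obs n)) (K : Finset (Fin n))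
    (i : Fin n) (m : ℕ) :
    itemCount (addRound R h K i) m = itemCount h m + if i.val = m then 1 else 0 := by
  simp [itemCount, addRound, List.countP_append, List.countP_cons]

lemma sum_itemCount {n : ℕ} (h : List (Obs n)) :
    ∑ i : Fin n, (itemCount h i.val : ℝ) = h.length := by
  induction h with
  | nil => simp [itemCount]
  | cons o h ih =>
    have : ∀ i : Fin n, (itemCount (o :: h) i.val : ℝ)
        = itemCount h i.val + if o.item = i then 1 else 0 := fun i => by
      simp [itemCount, List.countP_cons, Fin.ext_iff]
    simp only [this, Finset.sum_add_distrib, ih]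
    simp

/-! ### One-step estimates -/

/-- The left side is the mean of `exp (-γ (X - p))` for a Bernoulli variable `X` of mean `p`, so the
linear terms cancel. Moves use it for positive `γ` with `p = c`, queries for both signs. -/
lemma exp_mul_bernoulli_le {γ p : ℝ} (hγ : |γ| ≤ 1) (hp0 : 0 ≤ p) (hp1 : p ≤ 1) :
    Real.exp (γ * p) * (1 - p * (1 - Real.exp (-γ))) ≤ 1 + 3 * γ ^ 2 := by
  have hx : |γ * p| ≤ 1 := by
    rw [abs_mul, abs_of_nonneg hp0]; exact mul_le_one₀ hγ hp0 hp1
  have h1 := (abs_le.1 (Real.abs_exp_sub_one_sub_id_le hx)).2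
  have h2 := (abs_le.1 (Real.abs_exp_sub_one_sub_id_le (x := -γ) (by rwa [abs_neg]))).2
  have h3 : 0 ≤ 1 - p * (1 - Real.exp (-γ)) := by
    nlinarith [mul_nonneg hp0 (Real.exp_pos (-γ)).le]
  have h4 : 1 - p * (1 - Real.exp (-γ)) ≤ 1 - p * γ + p * γ ^ 2 := by nlinarith
  calc _ ≤ (1 + γ * p + (γ * p) ^ 2) * (1 - p * γ + p * γ ^ 2) := by
        refine mul_le_mul (by linarith) h4 h3 ?_
        nlinarith [sq_nonneg (γ * p + 1 / 2)]
    _ = 1 + p * γ ^ 2 + γ * (γ ^ 2 * (p ^ 2 * (1 - p))) + γ ^ 2 * (γ ^ 2 * p ^ 3) := by ring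
    _ ≤ 1 + 3 * γ ^ 2 := by
        obtain ⟨h5, h6⟩ := abs_le.1 hγ
        have g2 : γ ^ 2 ≤ 1 := by nlinarith
        have q1 : p ^ 2 * (1 - p) ≤ 1 :=
          mul_le_one₀ (by nlinarith) (by linarith) (by linarith)
        have q1' : 0 ≤ p ^ 2 * (1 - p) := mul_nonneg (sq_nonneg p) (by linarith)
        have q2 : p ^ 3 ≤ 1 := pow_le_one₀ hp0 hp1
        have q2' : 0 ≤ p ^ 3 := by positivity
        have e1 : p * γ ^ 2 ≤ γ ^ 2 := by nlinarith [sq_nonneg γ]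
        have e2 : γ * (γ ^ 2 * (p ^ 2 * (1 - p))) ≤ γ ^ 2 := by
          have : 0 ≤ γ ^ 2 * (p ^ 2 * (1 - p)) := by positivity
          nlinarith [sq_nonneg γ]
        have e3 : γ ^ 2 * (γ ^ 2 * p ^ 3) ≤ γ ^ 2 := by
          have : γ ^ 2 * p ^ 3 ≤ 1 := mul_le_one₀ g2 q2' q2
          nlinarith [sq_nonneg γ]
        linarith

lemma stepE_le_of_forall_menu {n k : ℕ} {W : Transition n} {R : ℕ → Fin n → ℝ}
    {f : List (Obs n) → ℝ} {h : List (Obs n)} {z : Finset (Fin n) → ℝ}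
    {p : Finset (Fin n) → Fin n → ℝ} (hz : IsMenuDistribution k z)
    (hWz : ∀ K i, W h K i = z K * p K i) {B : ℝ}
    (hB : ∀ K, z K ≠ 0 → ∑ i, p K i * f (addRound R h K i) ≤ B) : stepE W R f h ≤ B := by
  calc stepE W R f h = ∑ K, z K * ∑ i, p K i * f (addRound R h K i) := by
        simp only [stepE, hWz, Finset.mul_sum, mul_assoc]
    _ ≤ ∑ K, z K * B := by
        refine Finset.sum_le_sum fun K _ => ?_
        by_cases h0 : z K = 0
        · rw [h0, zero_mul, zero_mul]
        · exact mul_le_mul_of_nonneg_left (hB K h0) (hz.1 K)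
    _ = B := by rw [← Finset.sum_mul, hz.2.2, one_mul]

lemma mem_topMenus {n k : ℕ} {d : Fin n → ℝ} {K : Finset (Fin n)} :
    K ∈ topMenus k d ↔ K.card = k ∧ ∀ i ∈ K, ∀ j, j ∉ K → d j ≤ d i := by
  simp [topMenus, Finset.mem_powersetCard]

lemma playTop_ne_zero {n k : ℕ} {d : Fin n → ℝ} {K : Finset (Fin n)} (h : playTop k d K ≠ 0) :
    K.card = k ∧ ∀ i ∈ K, ∀ j, j ∉ K → d j ≤ d i := by
  rw [← mem_topMenus]
  by_contra hK
  simp [playTop, hK] at h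

lemma isMenuDistribution_playTop {n k : ℕ} (hkn : k ≤ n) (d : Fin n → ℝ) :
    IsMenuDistribution k (playTop k d) := by
  classical
  refine ⟨fun K => ?_, fun K hK => ?_, ?_⟩
  · unfold playTop; split_ifs <;> positivity
  · by_contra h
    exact hK (playTop_ne_zero h).1
  · obtain ⟨K, hK⟩ := exists_top_menu hkn d
    have hne : (topMenus k d).Nonempty := ⟨K, mem_topMenus.2 hK⟩
    have : ((topMenus k d).card : ℝ) ≠ 0 := by exact_mod_cast hne.card_pos.ne'
    simp only [playTop, Finset.sum_ite_mem, Finset.univ_inter, Finset.sum_const, nsmul_eq_mul]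
    field_simp

/-- Negative counts differ from the deficits relative to the uniform vector by a constant, so
padding is a move to the uniform vector. -/
lemma playTop_add_const {n k : ℕ} (d : Fin n → ℝ) (a : ℝ) :
    playTop k (fun i => a + d i) = playTop k d := by
  have : topMenus k (fun i => a + d i) = topMenus k d := by
    ext K; simp [mem_topMenus]
  unfold playTop; rw [this]

lemma isMenuDistribution_playMenu {n k : ℕ} {K₀ : Finset (Fin n)} (h : K₀.card = k) :
    IsMenuDistribution k (playMenu K₀) := by
  classical
  refine ⟨fun K => ?_, fun K hK => ?_, ?_⟩
  · unfold playMenu; split_ifs <;> norm_num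
  · refine if_neg ?_
    rintro rfl; exact hK h
  · simp [playMenu]

/-! ### Moving the histogram -/

section Move

variable {n k : ℕ} {W : Transition n} {R : ℕ → Fin n → ℝ}

/-- Number of selections of each item missing for the histogram `tb • x`. -/
noncomputable def deficit (x : Fin n → ℝ) (tb : ℕ) (h : List (Obs n)) (i : Fin n) : ℝ :=
  (tb : ℝ) * x i - (itemCount h i.val : ℝ)

lemma deficit_addRound (x : Fin n → ℝ) (tb : ℕ) (h : List (Obs n)) (K : Finset (Fin n))
    (i j : Fin n) :
    deficit x tb (addRound R h K i) j = deficit x tb h j - if i = j then 1 else 0 := by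
  simp only [deficit, itemCount_addRound, Fin.ext_iff]
  split_ifs <;> push_cast <;> ring

lemma sum_deficit {x : Fin n → ℝ} (hx : ∑ i, x i = 1) (tb : ℕ) (h : List (Obs n)) :
    ∑ i, deficit x tb h i = tb - h.length := by
  simp only [deficit, Finset.sum_sub_distrib, ← Finset.mul_sum, hx, sum_itemCount, mul_one]

open Classical in
/-- Either no item has been selected too often, or fewer than `k` items miss a full selection. -/
def MoveInv (k : ℕ) (x : Fin n → ℝ) (tb : ℕ) (h : List (Obs n)) : Prop :=
  (∀ i, 0 ≤ deficit x tb h i) ∨ (Finset.univ.filter fun i => 1 ≤ deficit x tb h i).card < k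

/-- Deficits never increase, which preserves the second alternative. If it fails, at least `k` items
miss a full selection. Were the chosen item not among them, all of them would lie in the menu, where
they leave out the chosen item and so number less than `k`. Hence the chosen deficit is at least `1`
and stays nonnegative. -/
lemma moveInv_addRound {x : Fin n → ℝ} {tb : ℕ} {h : List (Obs n)} (hI : MoveInv k x tb h)
    {K : Finset (Fin n)} (hK : K.card = k)
    (top : ∀ i ∈ K, ∀ j, j ∉ K → deficit x tb h j ≤ deficit x tb h i) {i : Fin n} (hi : i ∈ K) :
    MoveInv k x tb (addRound R h K i) := by
  classical
  have hle : ∀ j, deficit x tb (addRound R h K i) j ≤ deficit x tb h j := fun j => by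
    rw [deficit_addRound]; split_ifs <;> linarith
  by_cases hc : (Finset.univ.filter fun i => 1 ≤ deficit x tb h i).card < k
  · right
    refine lt_of_le_of_lt (Finset.card_le_card fun j hj => ?_) hc
    simp only [Finset.mem_filter, Finset.mem_univ, true_and] at hj ⊢
    exact hj.trans (hle j)
  · left
    have h0 := hI.resolve_right hc
    intro j
    rw [deficit_addRound]
    split_ifs with hij
    · subst hij
      have : 1 ≤ deficit x tb h i := by
        by_contra hlt
        push Not at hlt
        refine hc (lt_of_lt_of_le (Finset.card_lt_card (t := K) ?_) hK.le)
        have hsub : (Finset.univ.filter fun i => 1 ≤ deficit x tb h i) ⊆ K := fun l hl => by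
          by_contra hlK
          have := top i hi l hlK
          simp only [Finset.mem_filter, Finset.mem_univ, true_and] at hl
          linarith
        refine (Finset.ssubset_iff_of_subset hsub).2 ⟨i, hi, ?_⟩
        simpa using hlt
      linarith
    · simpa using h0 j

/-- The point is `c * |A| ≤ 1`, for then the constant weight `c` on `A` can be compared with the
menu. If no deficit is negative, more than `1 / c` items above the threshold would have a total
deficit exceeding the remaining time, which is the sum of all deficits. Otherwise `|A| < k` and `c *
k ≤ 1`. -/
lemma le_sum_menu {x : Fin n → ℝ} {tb : ℕ} {h : List (Obs n)} (hk : 1 ≤ k)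
    (hx : ∑ i, x i = 1) (hl : h.length ≤ tb) (hI : MoveInv k x tb h) {c : ℝ} (hc0 : 0 < c)
    (hck : c * k ≤ 1) {K : Finset (Fin n)} (hK : K.card = k)
    (top : ∀ i ∈ K, ∀ j, j ∉ K → deficit x tb h j ≤ deficit x tb h i) {p : Fin n → ℝ}
    (hp : ∀ i ∈ K, c ≤ p i) (hp1 : ∑ i ∈ K, p i = 1) {a : Fin n → ℝ} (ha : ∀ i, 0 ≤ a i)
    (hmono : ∀ i j, deficit x tb h i ≤ deficit x tb h j → a i ≤ a j) {A : Finset (Fin n)}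
    (hA : ∀ i, i ∈ A ↔ c * ((tb : ℝ) - h.length) + 1 ≤ deficit x tb h i) :
    c * ∑ i ∈ A, a i ≤ ∑ i ∈ K, p i * a i := by
  classical
  have hrem : (0 : ℝ) ≤ (tb : ℝ) - h.length := sub_nonneg.2 (by exact_mod_cast hl)
  have hcard : c * A.card ≤ 1 := by
    rcases hI with h0 | hlt
    · have h1 : A.card * (c * ((tb : ℝ) - h.length) + 1) ≤ (tb : ℝ) - h.length := by
        refine le_of_le_of_eq ?_ (sum_deficit hx tb h)
        calc (A.card : ℝ) * (c * ((tb : ℝ) - h.length) + 1)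
            = ∑ _i ∈ A, (c * ((tb : ℝ) - h.length) + 1) := by rw [Finset.sum_const, nsmul_eq_mul]
          _ ≤ ∑ i ∈ A, deficit x tb h i := Finset.sum_le_sum fun i hi => (hA i).1 hi
          _ ≤ _ := Finset.sum_le_sum_of_subset_of_nonneg (Finset.subset_univ _) fun i _ _ => h0 i
      by_contra hgt
      push Not at hgt
      have hA0 : (0 : ℝ) ≤ A.card := by positivity
      have hpos : (0 : ℝ) < A.card := by
        rcases hA0.eq_or_lt with h2 | h2
        · rw [← h2] at hgt; linarith
        · exact h2
      nlinarith
    · have hsub : A ⊆ Finset.univ.filter fun i => 1 ≤ deficit x tb h i := fun i hi => by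
        simp only [Finset.mem_filter, Finset.mem_univ, true_and]
        have := (hA i).1 hi
        nlinarith [mul_nonneg hc0.le hrem]
      have h2 : (A.card : ℝ) ≤ k := by
        exact_mod_cast ((Finset.card_le_card hsub).trans_lt hlt).le
      nlinarith
  have := sum_mul_le_sum_top (a := a) (p := p) (q := fun _ => c) (A := A)
    (Finset.card_pos.1 (by omega)) (fun i hi j hj => hmono j i (top i hi j hj)) (fun _ => hc0.le)
    hp hp1 (by rw [Finset.sum_const, nsmul_eq_mul, mul_comm]; exact hcard) (Or.inl ha)
  rwa [← Finset.mul_sum] at this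

/-- Exponential potential of the deficits relative to `c` times the remaining time. -/
noncomputable def movePotential (γ c : ℝ) (x : Fin n → ℝ) (tb : ℕ) (h : List (Obs n)) : ℝ :=
  ∑ i, Real.exp (γ * (deficit x tb h i - c * ((tb : ℝ) - h.length)))

lemma movePotential_addRound (γ c : ℝ) (x : Fin n → ℝ) (tb : ℕ) (h : List (Obs n))
    (K : Finset (Fin n)) (i : Fin n) :
    movePotential γ c x tb (addRound R h K i) = Real.exp (γ * c) * (movePotential γ c x tb h -
      (1 - Real.exp (-γ)) * Real.exp (γ * (deficit x tb h i - c * ((tb : ℝ) - h.length)))) := by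
  have : ∀ j, Real.exp (γ * (deficit x tb (addRound R h K i) j
      - c * ((tb : ℝ) - (addRound R h K i).length)))
      = Real.exp (γ * c) * (Real.exp (γ * (deficit x tb h j - c * ((tb : ℝ) - h.length)))
        - if i = j then (1 - Real.exp (-γ)) *
          Real.exp (γ * (deficit x tb h j - c * ((tb : ℝ) - h.length))) else 0) := fun j => by
    rw [deficit_addRound, length_addRound]
    push_cast
    split_ifs with hij
    · rw [show γ * (deficit x tb h j - 1 - c * ((tb : ℝ) - (h.length + 1)))
        = γ * c + (-γ + γ * (deficit x tb h j - c * ((tb : ℝ) - h.length))) by ring,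
        Real.exp_add, Real.exp_add]
      ring
    · rw [show γ * (deficit x tb h j - 0 - c * ((tb : ℝ) - (h.length + 1)))
        = γ * c + γ * (deficit x tb h j - c * ((tb : ℝ) - h.length)) by ring, Real.exp_add]
      ring
  simp only [movePotential, this, ← Finset.mul_sum, Finset.sum_sub_distrib, Finset.sum_ite_eq,
    Finset.mem_univ, if_true]

/-- In one round all terms grow by `exp (γ c)`, and the chosen one shrinks by `exp (-γ)`. By
`le_sum_menu` the decrease is at least what it would be if each item above the threshold were chosen
with probability `c`, so these terms are balanced up to `3 γ ^ 2`. Each item below the threshold has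
a term of at most `e` and only affects the additive constant. -/
lemma stepE_movePotential_le {x : Fin n → ℝ} {tb : ℕ} {h : List (Obs n)} (hk : 1 ≤ k)
    (hkn : k ≤ n) (hx : ∑ i, x i = 1) (hl : h.length ≤ tb) (hI : MoveInv k x tb h) {c : ℝ}
    (hc0 : 0 < c) (hck : c * k ≤ 1) {s : Fin n → ℝ} (hs : MenusAtLeast k c s)
    (hWs : ∀ K i, W h K i = playTop k (deficit x tb h) K * menuDist s K i) {γ : ℝ} (hγ0 : 0 < γ)
    (hγ1 : γ ≤ 1) :
    stepE W R (movePotential γ c x tb) h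
      ≤ (1 + 3 * γ ^ 2) * movePotential γ c x tb h + 9 * n * γ := by
  classical
  have hk1 : (1 : ℝ) ≤ k := by exact_mod_cast hk
  have hc1 : c ≤ 1 := by nlinarith
  refine stepE_le_of_forall_menu (p := menuDist s) (isMenuDistribution_playTop hkn _) hWs
    fun K hK => ?_
  obtain ⟨hKc, top⟩ := playTop_ne_zero hK
  set a : Fin n → ℝ := fun i => Real.exp (γ * (deficit x tb h i - c * ((tb : ℝ) - h.length)))
    with ha
  have ha0 : ∀ i, 0 ≤ a i := fun i => (Real.exp_pos _).le
  set Φ := movePotential γ c x tb h with hΦ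
  have hΦa : Φ = ∑ i, a i := rfl
  simp only [movePotential_addRound]
  have e1 : ∑ i, menuDist s K i * (Real.exp (γ * c) * (Φ - (1 - Real.exp (-γ)) * a i))
      = Real.exp (γ * c) * (Φ - (1 - Real.exp (-γ)) * ∑ i ∈ K, menuDist s K i * a i) := by
    have e2 : ∀ i, menuDist s K i * (Real.exp (γ * c) * (Φ - (1 - Real.exp (-γ)) * a i))
        = Real.exp (γ * c) * Φ * menuDist s K i
          - Real.exp (γ * c) * (1 - Real.exp (-γ)) * (menuDist s K i * a i) := fun i => by ring
    simp only [e2, Finset.sum_sub_distrib, ← Finset.mul_sum, (hs K hKc).1, sum_menuDist_mul]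
    ring
  rw [e1]
  set A := Finset.univ.filter fun i => c * ((tb : ℝ) - h.length) + 1 ≤ deficit x tb h i with hAdef
  have hKA := le_sum_menu hk hx hl hI hc0 hck hKc top (hs K hKc).2 (sum_menuDist_on (hs K hKc).1)
    ha0 (fun i j hij => Real.exp_le_exp.2 (by nlinarith)) (A := A) (by simp [hAdef])
  set B := Finset.univ.filter
    (fun i => ¬ (c * ((tb : ℝ) - h.length) + 1 ≤ deficit x tb h i)) with hBdef
  have hlow : ∑ i ∈ B, a i ≤ n * Real.exp 1 := by
    calc _ ≤ ∑ i ∈ B, Real.exp 1 := by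
          refine Finset.sum_le_sum fun i hi => Real.exp_le_exp.2 ?_
          have := (Finset.mem_filter.1 hi).2
          push Not at this
          nlinarith
      _ ≤ ∑ _i : Fin n, Real.exp 1 :=
          Finset.sum_le_sum_of_subset_of_nonneg (Finset.filter_subset _ _)
            fun _ _ _ => (Real.exp_pos _).le
      _ = n * Real.exp 1 := by simp
  have hsplit : Φ - n * Real.exp 1 ≤ ∑ i ∈ A, a i := by
    have := Finset.sum_filter_add_sum_filter_not Finset.univ
      (fun i => c * ((tb : ℝ) - h.length) + 1 ≤ deficit x tb h i) a
    rw [hΦa]; linarith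
  have hg0 : 0 ≤ 1 - Real.exp (-γ) := by
    have := Real.exp_le_one_iff.2 (by linarith : -γ ≤ 0); linarith
  have hg1 : 1 - Real.exp (-γ) ≤ γ := by have := Real.add_one_le_exp (-γ); linarith
  have hΦ0 : 0 ≤ Φ := Finset.sum_nonneg fun i _ => ha0 i
  have hexp : Real.exp (γ * c) ≤ Real.exp 1 := Real.exp_le_exp.2 (by nlinarith)
  -- One factor `e` bounds `exp (γ c)`, the other the terms below the threshold.
  have hee : Real.exp 1 * Real.exp 1 ≤ 9 := by
    have := Real.exp_one_lt_d9; have := Real.exp_pos 1; nlinarith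
  calc Real.exp (γ * c) * (Φ - (1 - Real.exp (-γ)) * ∑ i ∈ K, menuDist s K i * a i)
      ≤ Real.exp (γ * c) * (Φ - (1 - Real.exp (-γ)) * (c * (Φ - n * Real.exp 1))) := by
        gcongr
        exact (mul_le_mul_of_nonneg_left hsplit hc0.le).trans hKA
    _ = (Real.exp (γ * c) * (1 - c * (1 - Real.exp (-γ)))) * Φ
        + Real.exp (γ * c) * ((1 - Real.exp (-γ)) * (c * (n * Real.exp 1))) := by ring
    _ ≤ (1 + 3 * γ ^ 2) * Φ + Real.exp 1 * (γ * (1 * (n * Real.exp 1))) := by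
        gcongr
        exact exp_mul_bernoulli_le (by rw [abs_of_pos hγ0]; exact hγ1) hc0.le hc1
    _ = (1 + 3 * γ ^ 2) * Φ + (Real.exp 1 * Real.exp 1) * (n * γ) := by ring
    _ ≤ (1 + 3 * γ ^ 2) * Φ + 9 * (n * γ) := by gcongr
    _ = _ := by ring

/-- `MoveTo` reaches its target up to small errors. -/
lemma reaches_of_move (hW : IsTransition W) (hk : 1 ≤ k) (hkn : k ≤ n) {x : Fin n → ℝ}
    (hx : ∑ i, x i = 1) {ta m : ℕ} {c : ℝ} (hc0 : 0 < c) (hck : c * k ≤ 1)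
    (hplay : ∀ h, ta ≤ h.length → h.length < ta + m → ∃ s, MenusAtLeast k c s ∧
      ∀ K i, W h K i = playTop k (deficit x (ta + m) h) K * menuDist s K i)
    {γ : ℝ} (hγ0 : 0 < γ) (hγ1 : γ ≤ 1) {D : ℝ} (hD : 0 ≤ D) :
    Reaches W R (fun h => h.length = ta ∧
        ∀ i, 0 ≤ deficit x (ta + m) h i ∧ deficit x (ta + m) h i ≤ c * m)
      (fun h => h.length = ta + m ∧ ∀ i, |deficit x (ta + m) h i| ≤ n * D) m
      (Real.exp (3 * γ ^ 2 * m) * (n + m * (9 * n * γ)) / Real.exp (γ * D)) := by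
  classical
  rintro h ⟨hl, hd⟩
  let Inv : List (Obs n) → Prop := fun h => ta ≤ h.length ∧ MoveInv k x (ta + m) h
  have hInv : Inv h := ⟨hl.ge, Or.inl fun i => (hd i).1⟩
  have key := iterate_indicator_le_of_drift (W := W) (R := R) hW (Inv := Inv) (tb := ta + m)
    (Ψ := movePotential γ c x (ta + m)) (a := 1 + 3 * γ ^ 2) (b := 9 * n * γ)
    (by nlinarith [sq_nonneg γ]) (by positivity)
    (fun h hI hlt K i hne => by
      obtain ⟨s, hs, hWs⟩ := hplay h hI.1 hlt
      rw [hWs] at hne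
      obtain ⟨hKc, top⟩ := playTop_ne_zero (left_ne_zero_of_mul hne)
      have hi : i ∈ K := by
        by_contra hi
        rw [menuDist_of_notMem s hi, mul_zero] at hne
        exact hne rfl
      exact ⟨by rw [length_addRound]; exact hI.1.trans (Nat.le_succ _),
        moveInv_addRound hI.2 hKc top hi⟩)
    (fun h hI hlt => by
      obtain ⟨s, hs, hWs⟩ := hplay h hI.1 hlt
      exact stepE_movePotential_le hk hkn hx hlt.le hI.2 hc0 hck hs hWs hγ0 hγ1)
    (Bad := fun h => ¬ (h.length = ta + m ∧ ∀ i, |deficit x (ta + m) h i| ≤ n * D))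
    (y := Real.exp (γ * D)) (Real.exp_pos _)
    (fun h => Finset.sum_nonneg fun i _ => (Real.exp_pos _).le)
    (fun h _ hlen hbad => by
      have hbad' : ¬ ∀ i, |deficit x (ta + m) h i| ≤ n * D := fun h' => hbad ⟨hlen, h'⟩
      -- At the end of the move the deficits sum to zero, so an upper bound `D` for all of them
      -- yields the lower bound `-(n - 1) D`. The potential thus has to control one side only.
      have hex : ∃ i, D < deficit x (ta + m) h i := by
        by_contra hno
        push Not at hno
        refine hbad' fun i => ?_
        have hn1 : (1 : ℝ) ≤ n := by exact_mod_cast hk.trans hkn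
        have hs := sum_deficit hx (ta + m) h
        rw [hlen, sub_self, ← Finset.add_sum_erase _ _ (Finset.mem_univ i)] at hs
        have h2 : ∑ j ∈ Finset.univ.erase i, deficit x (ta + m) h j ≤ (n - 1) * D := by
          refine (Finset.sum_le_card_nsmul _ _ D fun j _ => hno j).trans ?_
          rw [Finset.card_erase_of_mem (Finset.mem_univ i), Finset.card_univ, Fintype.card_fin,
            nsmul_eq_mul, Nat.cast_sub (hk.trans hkn), Nat.cast_one]
        exact abs_le.2 ⟨by nlinarith, by nlinarith [hno i]⟩
      obtain ⟨i, hi⟩ := hex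
      refine le_trans ?_ (Finset.single_le_sum (f := fun i =>
        Real.exp (γ * (deficit x (ta + m) h i - c * (((ta + m : ℕ) : ℝ) - h.length))))
        (fun _ _ => (Real.exp_pos _).le) (Finset.mem_univ i))
      rw [hlen, sub_self, mul_zero, sub_zero]
      exact Real.exp_le_exp.2 (by nlinarith))
    hInv (by rw [hl])
  -- At the start every deficit is at most `c * m`, that is `c` times the remaining time, so all
  -- exponents are nonpositive.
  have hΨ : movePotential γ c x (ta + m) h ≤ n := by
    calc movePotential γ c x (ta + m) h ≤ ∑ _i : Fin n, (1 : ℝ) := by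
          refine Finset.sum_le_sum fun i _ => Real.exp_le_one_iff.2 ?_
          rw [hl]; push_cast
          have := (hd i).2
          nlinarith
      _ = n := by simp
  have hpow : (1 + 3 * γ ^ 2) ^ m ≤ Real.exp (3 * γ ^ 2 * m) := by
    rw [mul_comm _ (m : ℝ), Real.exp_nat_mul]
    gcongr
    linarith [Real.add_one_le_exp (3 * γ ^ 2)]
  calc _ ≤ (1 + 3 * γ ^ 2) ^ m * (movePotential γ c x (ta + m) h + m * (9 * n * γ))
        / Real.exp (γ * D) := by
        convert key using 3 with h'
        split_ifs <;> rfl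
    _ ≤ _ := by
        have : 0 ≤ movePotential γ c x (ta + m) h :=
          Finset.sum_nonneg fun i _ => (Real.exp_pos _).le
        gcongr

end Move

/-! ### Queries -/

lemma card_queryMenu {n k : ℕ} (hk : 2 ≤ k) (hkn : k ≤ n) (b : ℕ) : (queryMenu n k b).card = k := by
  set a := min (1 + b * (k - 1)) (n - (k - 1)) with ha
  have ha1 : 1 ≤ a := le_min (by omega) (by omega)
  have ha2 : a + (k - 1) ≤ n := by
    have : a ≤ n - (k - 1) := min_le_right _ _
    omega
  have h : (queryMenu n k b).map Fin.valEmbedding = insert 0 (Finset.Ico a (a + (k - 1))) := by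
    ext m
    simp only [queryMenu, Finset.mem_map, Finset.mem_filter, Finset.mem_univ, true_and,
      Fin.valEmbedding_apply, Finset.mem_insert, Finset.mem_Ico, ← ha]
    constructor
    · rintro ⟨i, hi, rfl⟩; exact hi
    · intro hm
      exact ⟨⟨m, by omega⟩, hm, rfl⟩
  rw [← Finset.card_map Fin.valEmbedding, h, Finset.card_insert_of_notMem, Nat.card_Ico]
  · omega
  · rw [Finset.mem_Ico]; omega

lemma zero_mem_queryMenu {n k : ℕ} (b : ℕ) (hn : 0 < n) : (⟨0, hn⟩ : Fin n) ∈ queryMenu n k b := by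
  simp [queryMenu]

lemma mem_queryMenu_block {n k : ℕ} (hk : 2 ≤ k) (i : Fin n) :
    i ∈ queryMenu n k ((i.val - 1) / (k - 1)) := by
  simp only [queryMenu, Finset.mem_filter, Finset.mem_univ, true_and]
  by_cases h0 : i.val = 0
  · exact Or.inl h0
  right
  have h1 := Nat.div_add_mod (i.val - 1) (k - 1)
  have h2 := Nat.mod_lt (i.val - 1) (by omega : 0 < k - 1)
  rw [mul_comm] at h1
  set b := (i.val - 1) / (k - 1)
  have := i.2
  rcases min_cases (1 + b * (k - 1)) (n - (k - 1)) with ⟨h, _⟩ | ⟨h, _⟩ <;> rw [h] <;> omega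

lemma block_lt_numQueryMenus {n k : ℕ} (hk : 2 ≤ k) (hkn : k ≤ n) (i : Fin n) :
    (i.val - 1) / (k - 1) < numQueryMenus n k := by
  have := i.2
  rw [numQueryMenus, Nat.div_lt_iff_lt_mul (by omega)]
  have h1 := Nat.div_add_mod (n - 1 + (k - 2)) (k - 1)
  have h2 := Nat.mod_lt (n - 1 + (k - 2)) (by omega : 0 < k - 1)
  rw [mul_comm] at h1
  omega

lemma numQueryMenus_le {n k : ℕ} (hk : 2 ≤ k) : numQueryMenus n k ≤ n := by
  rw [numQueryMenus]
  refine (Nat.div_le_iff_le_mul_add_pred (by omega)).2 ?_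
  obtain ⟨l, rfl⟩ : ∃ l, k = l + 2 := ⟨k - 2, by omega⟩
  simp only [Nat.add_sub_cancel, show l + 2 - 1 = l + 1 by omega]
  have : n ≤ (l + 1) * n := Nat.le_mul_of_pos_left n (by omega)
  omega

lemma numQueryMenus_pos {n k : ℕ} (hk : 2 ≤ k) (hkn : k ≤ n) : 1 ≤ numQueryMenus n k := by
  exact lt_of_le_of_lt (Nat.zero_le _) (block_lt_numQueryMenus hk hkn ⟨0, by omega⟩)

/-- The part of a history in the window of `len` rounds after the first `a` rounds. -/
def window {n : ℕ} (a len : ℕ) (h : List (Obs n)) : List (Obs n) := (h.drop a).take len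

lemma window_addRound_of_mem {n : ℕ} (R : ℕ → Fin n → ℝ) {a len : ℕ} {h : List (Obs n)}
    (K : Finset (Fin n)) (i : Fin n) (h1 : a ≤ h.length) (h2 : h.length < a + len) :
    window a len (addRound R h K i) = window a len h ++ [⟨K, i, R h.length i⟩] := by
  rw [window, window, addRound, List.drop_append_of_le_length h1,
    List.take_of_length_le (by simp; omega), List.take_of_length_le (by simp; omega)]

lemma window_addRound_of_notMem {n : ℕ} (R : ℕ → Fin n → ℝ) {a len : ℕ} {h : List (Obs n)}
    (K : Finset (Fin n)) (i : Fin n) (hh : h.length < a ∨ a + len ≤ h.length) :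
    window a len (addRound R h K i) = window a len h := by
  rw [window, window, addRound]
  rcases hh with hh | hh
  · rw [List.drop_of_length_le (by simp; omega), List.drop_of_length_le (by omega)]
  · rw [List.drop_append_of_le_length (by omega), List.take_append_of_le_length (by simp; omega)]

section Query

variable {n k : ℕ} {W : Transition n} {R : ℕ → Fin n → ℝ}

/-- Exponential potential of the deviation of the count of item `m` in a window from the value
expected when the item has probability `q`. -/
noncomputable def queryPotential (s q : ℝ) (a len : ℕ) (m : Fin n) (h : List (Obs n)) : ℝ :=
  Real.exp (s * ((itemCount (window a len h) m.val : ℝ) - q * (window a len h).length))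

/-- Outside the window the potential does not change. Inside, replacing `q` by the true probability
costs `exp (|s| κ)`, and the centred Bernoulli moment the rest. The summand `0` matches the form of
the drift lemma. -/
lemma stepE_queryPotential_le (hW : IsTransition W) {s q κ : ℝ} (hs : |s| ≤ 1) (hκ : 0 ≤ κ)
    {a len : ℕ} {m : Fin n} {h : List (Obs n)}
    (hplay : a ≤ h.length → h.length < a + len → ∃ (K₀ : Finset (Fin n)) (σ : Fin n → ℝ),
      K₀.card = k ∧ (∀ K i, W h K i = playMenu K₀ K * menuDist σ K i) ∧
      (∑ i, menuDist σ K₀ i = 1) ∧ (∀ i, 0 ≤ menuDist σ K₀ i) ∧ |menuDist σ K₀ m - q| ≤ κ) :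
    stepE W R (queryPotential s q a len m) h
      ≤ (Real.exp (|s| * κ) * (1 + 3 * s ^ 2)) * queryPotential s q a len m h + 0 := by
  have hq0 : 0 ≤ queryPotential s q a len m h := (Real.exp_pos _).le
  have hfac : 1 ≤ Real.exp (|s| * κ) * (1 + 3 * s ^ 2) := by
    have := Real.one_le_exp (mul_nonneg (abs_nonneg s) hκ)
    nlinarith [sq_nonneg s]
  by_cases hmem : a ≤ h.length ∧ h.length < a + len
  swap
  · have hne : h.length < a ∨ a + len ≤ h.length := by
      rcases lt_or_ge h.length a with h1 | h1
      · exact Or.inl h1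
      · exact Or.inr (by by_contra h2; exact hmem ⟨h1, by omega⟩)
    have e : stepE W R (queryPotential s q a len m) h = queryPotential s q a len m h := by
      have e1 : ∀ K i, queryPotential s q a len m (addRound R h K i)
          = queryPotential s q a len m h := fun K i => by
        rw [queryPotential, window_addRound_of_notMem R K i hne]; rfl
      simp only [stepE, e1, ← Finset.sum_mul, hW.sum_eq_one, one_mul]
    rw [e, add_zero]
    exact le_mul_of_one_le_left hq0 hfac
  · obtain ⟨K₀, σ, hK₀, hWσ, hsum, hnn, hclose⟩ := hplay hmem.1 hmem.2
    refine stepE_le_of_forall_menu (p := menuDist σ) (isMenuDistribution_playMenu hK₀) hWσ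
      fun K hK => ?_
    obtain rfl : K = K₀ := by
      by_contra hne
      exact hK (if_neg hne)
    have e1 : ∀ i, queryPotential s q a len m (addRound R h K i)
        = Real.exp (-(s * q)) * queryPotential s q a len m h
          * (1 - (1 - Real.exp s) * if m = i then 1 else 0) := fun i => by
      rw [queryPotential, window_addRound_of_mem R K i hmem.1 hmem.2]
      have : itemCount (window a len h ++ [(⟨K, i, R h.length i⟩ : Obs n)]) m.val
          = itemCount (window a len h) m.val + if m = i then 1 else 0 := by
        simp [itemCount, List.countP_append, List.countP_cons, Fin.ext_iff, eq_comm]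
      rw [this, List.length_append, List.length_singleton, queryPotential]
      split_ifs
      · push_cast
        rw [mul_one, sub_sub_cancel, ← Real.exp_add, ← Real.exp_add]
        congr 1; ring
      · push_cast
        rw [mul_zero, sub_zero, mul_one, ← Real.exp_add]
        congr 1; ring
    set p := menuDist σ K m with hp
    have hp1 : p ≤ 1 := by
      rw [← hsum]; exact Finset.single_le_sum (fun i _ => hnn i) (Finset.mem_univ m)
    have e2 : ∑ i, menuDist σ K i * queryPotential s q a len m (addRound R h K i)
        = Real.exp (-(s * q)) * queryPotential s q a len m h * (1 - p * (1 - Real.exp s)) := by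
      have e3 : ∀ i, menuDist σ K i * queryPotential s q a len m (addRound R h K i)
          = Real.exp (-(s * q)) * queryPotential s q a len m h * (menuDist σ K i
            - (1 - Real.exp s) * (menuDist σ K i * if m = i then 1 else 0)) := fun i => by
        rw [e1]; ring
      simp only [e3, ← Finset.mul_sum, Finset.sum_sub_distrib, hsum]
      simp only [mul_ite, mul_one, mul_zero, Finset.sum_ite_eq, Finset.mem_univ, if_true, ← hp]
      ring
    rw [e2, add_zero]
    have hb := exp_mul_bernoulli_le (γ := -s) (by rwa [abs_neg]) (hnn m) hp1
    rw [neg_neg, neg_sq] at hb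
    have e4 : Real.exp (-(s * q)) = Real.exp (s * (p - q)) * Real.exp (-s * p) := by
      rw [← Real.exp_add]; congr 1; ring
    have e5 : Real.exp (s * (p - q)) ≤ Real.exp (|s| * κ) := by
      refine Real.exp_le_exp.2 ((le_abs_self _).trans ?_)
      rw [abs_mul]; gcongr
    calc _ = Real.exp (s * (p - q)) * (Real.exp (-s * p) * (1 - p * (1 - Real.exp s)))
          * queryPotential s q a len m h := by rw [e4]; ring
      _ ≤ _ := by
          refine mul_le_mul_of_nonneg_right (mul_le_mul e5 hb ?_ (Real.exp_pos _).le) hq0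
          exact mul_nonneg (Real.exp_pos _).le (by nlinarith [mul_nonneg (hnn m) (Real.exp_pos s).le])

/-- The item frequencies seen in a query are close to the choice probabilities at the query
point. -/
def GoodCounts (k : ℕ) (σ : Fin n → ℝ) (y : ℝ) (start tBlock : ℕ) (h : List (Obs n)) : Prop :=
  ∀ i m : Fin n, |(itemCount (window (start + (i.val - 1) / (k - 1) * tBlock) tBlock h) m.val : ℝ)
    - menuDist σ (queryMenu n k ((i.val - 1) / (k - 1))) m * tBlock| ≤ y * tBlock

lemma reaches_of_query (hW : IsTransition W) (hk : 2 ≤ k) (hkn : k ≤ n) {ta tBlock : ℕ}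
    (htB : 0 < tBlock) {σ₀ x : Fin n → ℝ} {B κ y : ℝ} (hκ : 0 ≤ κ) (hy0 : 0 < y) (hy1 : y ≤ 1)
    (hκy : 4 * n * κ ≤ y)
    (hplay : ∀ h, ta ≤ h.length → h.length < ta + numQueryMenus n k * tBlock →
      (∀ i, |deficit x ta h i| ≤ B + (h.length - ta)) →
      ∃ σ : Fin n → ℝ,
        (∀ K i, W h K i = playMenu (queryMenu n k ((h.length - ta) / tBlock)) K * menuDist σ K i) ∧
        ∀ K : Finset (Fin n), K.card = k → (∑ i, menuDist σ K i = 1) ∧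
          ∀ i, 0 ≤ menuDist σ K i ∧ |menuDist σ K i - menuDist σ₀ K i| ≤ κ) :
    Reaches W R (fun h => h.length = ta ∧ ∀ i, |deficit x ta h i| ≤ B)
      (fun h => (h.length = ta + numQueryMenus n k * tBlock ∧
        ∀ i, |deficit x ta h i| ≤ B + (h.length - ta)) ∧ GoodCounts k σ₀ y ta tBlock h)
      (numQueryMenus n k * tBlock) (2 * n ^ 2 * Real.exp (-(tBlock * (y ^ 2 / (24 * n))))) := by
  classical
  rintro h ⟨hl, hd⟩
  set N := numQueryMenus n k with hN
  have hNn : (N : ℝ) ≤ n := by exact_mod_cast numQueryMenus_le hk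
  have hn1 : (1 : ℝ) ≤ n := by exact_mod_cast (by omega : 1 ≤ n)
  let Inv : List (Obs n) → Prop := fun h =>
    ta ≤ h.length ∧ ∀ i, |deficit x ta h i| ≤ B + (h.length - ta)
  have hInv : Inv h := ⟨hl.ge, fun i => by rw [hl, sub_self, add_zero]; exact hd i⟩
  have hstep : ∀ h, Inv h → h.length < ta + N * tBlock → ∀ K i, W h K i ≠ 0 →
      Inv (addRound R h K i) := by
    rintro h ⟨h1, h2⟩ _ K i _
    refine ⟨by rw [length_addRound]; omega, fun j => ?_⟩
    rw [deficit_addRound, length_addRound]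
    push_cast
    have := abs_le.1 (h2 j)
    split_ifs <;> exact abs_le.2 ⟨by linarith, by linarith⟩
  -- The drift lemma charges its factor in each of the at most `n * tBlock` rounds of the query, not
  -- just in the window. With this `s` and `κ ≤ y / (4 n)` the total exponent is at most half of the
  -- gain `s * y * tBlock`.
  set s := y / (12 * n) with hs
  have hs0 : 0 < s := by positivity
  have hs1 : s ≤ 1 := by
    rw [hs, div_le_one (by positivity)]; linarith
  have one : ∀ (i m : Fin n) (sg : ℝ), (sg = 1 ∨ sg = -1) →
      (stepE W R)^[N * tBlock] (fun h' => if y * tBlock < sg *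
        ((itemCount (window (ta + (i.val - 1) / (k - 1) * tBlock) tBlock h') m.val : ℝ)
          - menuDist σ₀ (queryMenu n k ((i.val - 1) / (k - 1))) m * tBlock) then 1 else 0) h
      ≤ Real.exp (-(tBlock * (y ^ 2 / (24 * n)))) := by
    intro i m sg hsg
    set b := (i.val - 1) / (k - 1) with hb
    have hbN : b < N := block_lt_numQueryMenus hk hkn i
    have hbN' : b * tBlock + tBlock ≤ N * tBlock := by nlinarith
    set q := menuDist σ₀ (queryMenu n k b) m with hq
    have hsg1 : |sg * s| = s := by
      rcases hsg with rfl | rfl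
      · rw [one_mul, abs_of_pos hs0]
      · rw [neg_one_mul, abs_neg, abs_of_pos hs0]
    have hsg2 : (sg * s) ^ 2 = s ^ 2 := by rw [← sq_abs, hsg1]
    have hwl : ∀ h' : List (Obs n), h'.length = ta + N * tBlock →
        (window (ta + b * tBlock) tBlock h').length = tBlock := fun h' hl' => by
      simp only [window, List.length_take, List.length_drop, hl']
      omega
    have key := iterate_indicator_le_of_drift (W := W) (R := R) hW (Inv := Inv)
      (tb := ta + N * tBlock) (Ψ := queryPotential (sg * s) q (ta + b * tBlock) tBlock m)
      (a := Real.exp (|sg * s| * κ) * (1 + 3 * (sg * s) ^ 2)) (b := 0)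
      (by
        have := Real.one_le_exp (mul_nonneg (abs_nonneg (sg * s)) hκ)
        nlinarith [sq_nonneg (sg * s)]) le_rfl hstep
      (fun h' hI hlt => stepE_queryPotential_le (k := k) hW (by rw [hsg1]; exact hs1) hκ
        fun h1 h2 => by
          obtain ⟨σ, hσ1, hσ2⟩ := hplay h' hI.1 hlt hI.2
          have hblock : (h'.length - ta) / tBlock = b := by
            rw [Nat.div_eq_iff htB]
            have h3 : b * tBlock = tBlock * b := mul_comm _ _
            constructor
            · omega
            · omega
          rw [hblock] at hσ1
          have hc := card_queryMenu hk hkn b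
          exact ⟨queryMenu n k b, σ, hc, hσ1, (hσ2 _ hc).1, fun i => ((hσ2 _ hc).2 i).1,
            ((hσ2 _ hc).2 m).2⟩)
      (Bad := fun h' => y * tBlock < sg *
        ((itemCount (window (ta + b * tBlock) tBlock h') m.val : ℝ) - q * tBlock))
      (y := Real.exp (s * (y * tBlock))) (Real.exp_pos _) (fun _ => (Real.exp_pos _).le)
      (fun h' _ hl' hbad => Real.exp_le_exp.2 (by
        rw [hwl h' hl']
        nlinarith))
      hInv (by rw [hl])
    refine key.trans ?_
    have h0 : queryPotential (sg * s) q (ta + b * tBlock) tBlock m h = 1 := by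
      have : window (ta + b * tBlock) tBlock h = [] := by
        rw [window, List.drop_of_length_le (by rw [hl]; omega), List.take_nil]
      simp [queryPotential, this, itemCount]
    rw [h0, mul_zero, add_zero, mul_one, hsg1, hsg2, div_le_iff₀ (Real.exp_pos _), ← Real.exp_add]
    have h1 : (Real.exp (s * κ) * (1 + 3 * s ^ 2)) ^ (N * tBlock)
        ≤ Real.exp ((N * tBlock : ℕ) * (s * κ + 3 * s ^ 2)) := by
      rw [Real.exp_nat_mul, Real.exp_add]
      gcongr
      linarith [Real.add_one_le_exp (3 * s ^ 2)]
    refine h1.trans (Real.exp_le_exp.2 ?_)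
    push_cast
    have htB0 : (0 : ℝ) ≤ tBlock := by positivity
    have e1 : s * κ + 3 * s ^ 2 ≤ s * y / (2 * n) := by
      have e2 : κ ≤ y / (4 * n) := by rw [le_div_iff₀ (by positivity)]; linarith
      have e3 : 3 * s = y / (4 * n) := by rw [hs]; field_simp; norm_num
      calc s * κ + 3 * s ^ 2 = s * (κ + 3 * s) := by ring
        _ ≤ s * (y / (4 * n) + y / (4 * n)) := by gcongr; exact e3.le
        _ = _ := by field_simp; norm_num
    calc (N : ℝ) * tBlock * (s * κ + 3 * s ^ 2) ≤ n * tBlock * (s * y / (2 * n)) := by gcongr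
      _ = -(tBlock * (y ^ 2 / (24 * n))) + s * (y * tBlock) := by
          rw [hs]; field_simp; ring
  calc _ ≤ (stepE W R)^[N * tBlock] (fun h' => ∑ im : (Fin n × Fin n) × Bool,
        if y * tBlock < (if im.2 then 1 else -1) *
        ((itemCount (window (ta + (im.1.1.val - 1) / (k - 1) * tBlock) tBlock h') im.1.2.val : ℝ)
          - menuDist σ₀ (queryMenu n k ((im.1.1.val - 1) / (k - 1))) im.1.2 * tBlock)
          then (1 : ℝ) else 0) h := by
        refine iterate_mono_of_inv hW hstep _ h hInv (by rw [hl]) fun h' hI hl' => ?_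
        split_ifs with hG
        · exact Finset.sum_nonneg fun im _ => by split_ifs <;> norm_num
        · have hng : ¬ GoodCounts k σ₀ y ta tBlock h' := fun hg =>
            hG ⟨⟨by rw [hl', hl], hI.2⟩, hg⟩
          simp only [GoodCounts, not_forall, not_le] at hng
          obtain ⟨i, m, him⟩ := hng
          rcases lt_abs.1 him with h1 | h1
          · refine le_trans ?_ (Finset.single_le_sum (fun im _ => ?_)
              (Finset.mem_univ (((i, m), true) : (Fin n × Fin n) × Bool)))
            · simp [h1]
            · split_ifs <;> norm_num
          · refine le_trans ?_ (Finset.single_le_sum (fun im _ => ?_)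
              (Finset.mem_univ (((i, m), false) : (Fin n × Fin n) × Bool)))
            · rw [if_pos]
              simpa using h1
            · split_ifs <;> norm_num
    _ ≤ ∑ im : (Fin n × Fin n) × Bool, Real.exp (-(tBlock * (y ^ 2 / (24 * n)))) := by
        rw [iterate_sum]
        refine Finset.sum_le_sum fun im _ => one _ _ _ ?_
        split_ifs <;> simp
    _ = _ := by
        simp only [Finset.sum_const, Finset.card_univ, Fintype.card_prod, Fintype.card_fin,
          Fintype.card_bool, nsmul_eq_mul]
        push_cast; ring

/-- Within a menu the score ratio to item `0` equals the ratio of the choice probabilities. Item `0`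
has probability at least `1 / n`, hence at least `tBlock / (2 n)` selections, and the ratios are off
by at most `2 n ^ 2 y`. Normalizing ratios which are at least `1 / n` multiplies this by `2 n`. -/
lemma abs_queryEstimate_sub_le (hk : 2 ≤ k) (hkn : k ≤ n) {start tBlock : ℕ} (htB : 0 < tBlock)
    {σ : Fin n → ℝ} {y : ℝ} (hy0 : 0 ≤ y) (hy : y ≤ 1 / (2 * n))
    (hσ : MenusAtLeast k (1 / n) σ) (hσ0 : ∀ i, 1 / (n : ℝ) ≤ σ i) (hσ1 : ∀ i, σ i ≤ 1)
    {h : List (Obs n)} (hg : GoodCounts k σ y start tBlock h) (i : Fin n) :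
    |queryEstimate k start tBlock h i - normalizeScores σ i| ≤ 4 * n ^ 3 * y := by
  have hn0 : 0 < n := by omega
  have hn : (0 : ℝ) < n := by exact_mod_cast hn0
  have htB0 : (0 : ℝ) < tBlock := by exact_mod_cast htB
  set o : Fin n := ⟨0, hn0⟩
  have hσo : 0 < σ o := lt_of_lt_of_le (by positivity) (hσ0 o)
  set e : Fin n → ℝ := fun i => if i.val = 0 then 1 else
      (itemCount ((h.drop (start + (i.val - 1) / (k - 1) * tBlock)).take tBlock) i.val : ℝ) /
        (itemCount ((h.drop (start + (i.val - 1) / (k - 1) * tBlock)).take tBlock) 0 : ℝ) with he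
  have e1 : normalizeScores σ = menuDist (fun i => σ i / σ o) Finset.univ := by
    ext i
    simp only [normalizeScores, menuDist, Finset.mem_univ, if_true, ← Finset.sum_div]
    rw [div_div_div_cancel_right₀ hσo.ne']
  have e2 : queryEstimate k start tBlock h = menuDist e Finset.univ := normalizeScores_eq_menuDist e
  have he0 : ∀ i, 0 ≤ e i := fun i => by simp only [he]; split_ifs <;> positivity
  have heo : e o = 1 := by simp [he, o]
  rw [abs_sub_comm, e1, e2]
  have hclose : ∀ j, |σ j / σ o - e j| ≤ 2 * n ^ 2 * y := by
    intro j
    by_cases hj : j.val = 0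
    · have : j = o := Fin.ext hj
      rw [this, heo, div_self hσo.ne', sub_self, abs_zero]; positivity
    · simp only [he, if_neg hj]
      have hjK := mem_queryMenu_block hk j
      set b := (j.val - 1) / (k - 1) with hb
      have hoK := zero_mem_queryMenu (k := k) b hn0
      set K := queryMenu n k b with hK
      have hKc : K.card = k := card_queryMenu hk hkn b
      have hgj := hg j j
      have hgo := hg j o
      rw [← hb, ← hK] at hgj hgo
      simp only [window] at hgj hgo
      change |(itemCount ((h.drop (start + b * tBlock)).take tBlock) 0 : ℝ) - _| ≤ _ at hgo
      set Nj : ℝ := ((itemCount ((h.drop (start + b * tBlock)).take tBlock) j.val : ℕ) : ℝ)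
      set No : ℝ := ((itemCount ((h.drop (start + b * tBlock)).take tBlock) 0 : ℕ) : ℝ)
      have hqo := (hσ K hKc).2 o hoK
      have hqj := (hσ K hKc).2 j hjK
      have hratio : σ j / σ o = menuDist σ K j / menuDist σ K o := by
        rw [menuDist_of_mem _ hjK, menuDist_of_mem _ hoK, div_div_div_cancel_right₀]
        exact (Finset.sum_pos (fun i _ => lt_of_lt_of_le (by positivity) (hσ0 i)) ⟨o, hoK⟩).ne'
      set qj := menuDist σ K j
      set qo := menuDist σ K o
      have hinv : (0 : ℝ) < 1 / n := by positivity
      have hqsum : qo + qj ≤ 1 := by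
        have hne : o ≠ j := fun h => hj (by rw [← h])
        have := Finset.sum_le_sum_of_subset_of_nonneg (Finset.subset_univ {o, j})
          (f := fun i => menuDist σ K i) fun i _ _ =>
            menuDist_nonneg (fun j _ => (hinv.le.trans (hσ0 j))) i
        rw [Finset.sum_pair hne, (hσ K hKc).1] at this
        exact this
      have hNo : tBlock * (1 / (2 * n)) ≤ No := by
        have := (abs_le.1 hgo).1
        have h2 : (1 : ℝ) / n = 1 / (2 * n) + 1 / (2 * n) := by field_simp; norm_num
        nlinarith
      have hNo0 : 0 < No := lt_of_lt_of_le (by positivity) hNo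
      have hqo0 : 0 < qo := by linarith
      have hqj0 : 0 < qj := by linarith
      rw [hratio, div_sub_div _ _ hqo0.ne' hNo0.ne', abs_div, abs_of_pos (mul_pos hqo0 hNo0),
        div_le_iff₀ (mul_pos hqo0 hNo0)]
      have hnum : |qj * No - qo * Nj| ≤ y * tBlock := by
        have : qj * No - qo * Nj = qj * (No - qo * tBlock) - qo * (Nj - qj * tBlock) := by ring
        rw [this]
        refine (abs_sub _ _).trans ?_
        rw [abs_mul, abs_mul, abs_of_pos hqo0, abs_of_pos hqj0]
        have hyt : 0 ≤ y * tBlock := by positivity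
        nlinarith
      refine hnum.trans ?_
      have hden : 1 / n * (tBlock * (1 / (2 * n))) ≤ qo * No := by gcongr
      calc y * tBlock = 2 * n ^ 2 * y * (1 / n * (tBlock * (1 / (2 * n)))) := by field_simp
        _ ≤ _ := by gcongr
  have := abs_menuDist_sub_le (a := fun i => σ i / σ o) (b := e) (K := Finset.univ)
    (mu := 1 / n) (κ := 2 * n ^ 2 * y) (by positivity)
    (fun j _ => by
      rw [le_div_iff₀ hσo]
      exact (mul_le_of_le_one_right (by positivity) (hσ1 o)).trans (hσ0 j))
    (fun j _ => he0 j)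
    (lt_of_lt_of_le one_pos (heo ▸ Finset.single_le_sum (fun j _ => he0 j) (Finset.mem_univ o)))
    (fun j _ => hclose j) (by positivity) i
  refine this.trans (le_of_eq ?_)
  field_simp; ring

end Query

/-! ### The learning phase -/

/-- All scores, on and off the simplex, are at least `k ^ 2 / n`. -/
lemma score_ge_of_dispersed {n k : ℕ} (hn : 1 ≤ n) {lam : ℝ} (hlam : (k : ℝ) ^ 2 / n ≤ lam)
    {M : PreferenceModel n} (hM : Dispersed lam M) (v : Fin n → ℝ) (i : Fin n) :
    (k : ℝ) ^ 2 / n ≤ M.score v i := by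
  by_cases hv : v ∈ stdSimplex ℝ (Fin n)
  · exact hlam.trans (hM v hv i)
  · rw [M.score_off v hv i]
    exact hlam.trans ((hM _ (uniformVec_mem hn) i).trans (M.score_mem _ i).2)

/-- Scores do not exceed `1`, so the dispersion assumption itself forces this. It is what gives `c *
k ≤ 1` for `c = k / n`. -/
lemma sq_le_of_dispersed {n k : ℕ} (hn : 1 ≤ n) {lam : ℝ} (hlam : (k : ℝ) ^ 2 / n ≤ lam)
    {M : PreferenceModel n} (hM : Dispersed lam M) : (k : ℝ) ^ 2 ≤ n := by
  have h := (score_ge_of_dispersed hn hlam hM (uniformVec n) ⟨0, hn⟩).trans (M.score_mem _ _).2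
  rwa [div_le_one (by exact_mod_cast hn)] at h

/-- The total score of a menu is at most `k`, so a member with score at least `k ^ 2 / n` gets
probability at least `k / n`. -/
lemma menusAtLeast_of_bounds {n k : ℕ} (hk : 1 ≤ k) (hn : 1 ≤ n) {s : Fin n → ℝ}
    (hs : ∀ i, (k : ℝ) ^ 2 / n ≤ s i) (hs1 : ∀ i, s i ≤ 1) : MenusAtLeast k ((k : ℝ) / n) s := by
  have hk0 : (0 : ℝ) < k := by exact_mod_cast hk
  have hn0 : (0 : ℝ) < n := by exact_mod_cast hn
  have hs0 : ∀ i, 0 < s i := fun i => lt_of_lt_of_le (by positivity) (hs i)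
  intro K hK
  have hKne : K.Nonempty := Finset.card_pos.1 (by omega)
  have hpos : 0 < ∑ j ∈ K, s j := Finset.sum_pos (fun j _ => hs0 j) hKne
  refine ⟨sum_menuDist hpos.ne', fun i hi => ?_⟩
  have hle : ∑ j ∈ K, s j ≤ k := by
    have := Finset.sum_le_card_nsmul K s 1 fun j _ => hs1 j
    rw [hK] at this; simpa using this
  rw [menuDist_of_mem _ hi, le_div_iff₀ hpos]
  calc (k : ℝ) / n * ∑ j ∈ K, s j ≤ k / n * k := by gcongr
    _ = (k : ℝ) ^ 2 / n := by ring
    _ ≤ s i := hs i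

lemma MenusAtLeast.mono {n k : ℕ} {c c' : ℝ} {s : Fin n → ℝ} (h : MenusAtLeast k c s)
    (hc : c' ≤ c) : MenusAtLeast k c' s :=
  fun K hK => ⟨(h K hK).1, fun i hi => hc.trans ((h K hK).2 i hi)⟩

lemma memory_mem_stdSimplex {n : ℕ} {h : List (Obs n)} (hl : 0 < h.length) :
    memory h ∈ stdSimplex ℝ (Fin n) := by
  refine ⟨fun i => by unfold memory; positivity, ?_⟩
  simp only [memory, ← Finset.sum_div, sum_itemCount]
  exact div_self (by positivity)

lemma queryEstimate_of_prefix {n k : ℕ} (hk : 2 ≤ k) (hkn : k ≤ n) {start tBlock : ℕ}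
    {h h' : List (Obs n)} (hp : h <+: h') (hl : start + numQueryMenus n k * tBlock ≤ h.length) :
    queryEstimate k start tBlock h' = queryEstimate k start tBlock h := by
  obtain ⟨t, rfl⟩ := hp
  unfold queryEstimate
  congr 1
  ext i
  have hb := block_lt_numQueryMenus hk hkn i
  have : (i.val - 1) / (k - 1) * tBlock + tBlock ≤ numQueryMenus n k * tBlock := by nlinarith
  rw [List.drop_append_of_le_length (by omega), List.take_append_of_le_length (by simp; omega)]

section Learning

variable {n k S : ℕ} {𝓜 : Set (PreferenceModel n)} {A : LocalLearner 𝓜 (uniformVec n) S}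
  {P : Params n k} {c : ℝ} {u : ℕ → Reduced n}

lemma tLearn_eq : P.tLearn S = P.tPad + S * P.tCycle := rfl

lemma tCycle_eq : P.tCycle = 2 * P.tMove + P.tQuery := rfl

lemma cycle_le_tLearn {j : ℕ} (hj : j < S) : P.tPad + (j + 1) * P.tCycle ≤ P.tLearn S := by
  rw [tLearn_eq]
  exact Nat.add_le_add_left (Nat.mul_le_mul_right _ hj) _

lemma algorithm_of_pad {h : List (Obs n)} (hl : h.length < P.tPad) :
    algorithm A P c u h = playTop k (deficit (uniformVec n) P.tPad h) := by
  have h1 : h.length < P.tLearn S := lt_of_lt_of_le hl (Nat.le_add_right _ _)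
  simp only [algorithm, if_pos h1, learnStep, if_pos hl, uniformPad]
  rw [← playTop_add_const _ ((P.tPad : ℝ) * (1 / n))]
  rfl

lemma algorithm_of_cycle {j s : ℕ} (hj : j < S) (hs : s < P.tCycle) {h : List (Obs n)}
    (hl : h.length = P.tPad + j * P.tCycle + s) :
    algorithm A P c u h = if s < P.tMove then
        playTop k (deficit (A.points P.alpha P.accuracy ⟨j, hj⟩)
          (P.tPad + j * P.tCycle + P.tMove) h)
      else if s < P.tMove + P.tQuery then playMenu (queryMenu n k ((s - P.tMove) / P.tBlock))
      else playTop k (deficit (uniformVec n) (P.tPad + (j + 1) * P.tCycle) h) := by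
  have h1 : h.length < P.tLearn S := by
    have := cycle_le_tLearn (P := P) hj
    rw [add_mul, one_mul] at this
    omega
  have h2 : ¬ h.length < P.tPad := by omega
  have h3 : h.length - P.tPad = s + P.tCycle * j := by rw [hl, mul_comm]; omega
  have h4 : (h.length - P.tPad) / P.tCycle = j := by
    rw [h3, Nat.add_mul_div_left _ _ (by omega), Nat.div_eq_of_lt hs, zero_add]
  have h5 : (h.length - P.tPad) % P.tCycle = s := by
    rw [h3, Nat.add_mul_mod_self_left, Nat.mod_eq_of_lt hs]
  simp only [algorithm, if_pos h1, learnStep, if_neg h2, h4, h5, dif_pos hj]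
  rfl

/-- The estimate at the `j`-th query point is accurate. -/
def EstimateOK (A : LocalLearner 𝓜 (uniformVec n) S) (P : Params n k) (M : PreferenceModel n)
    (β : ℝ) (j : Fin S) (h : List (Obs n)) : Prop :=
  ∀ i, |queryEstimate k (P.tPad + j.val * P.tCycle + P.tMove) P.tBlock h i
    - normalizeScores (M.score (A.points P.alpha P.accuracy j)) i| ≤ β

lemma estimateOK_of_prefix (hk : 2 ≤ k) (hkn : k ≤ n) {M : PreferenceModel n} {β : ℝ} {j : Fin S}
    {h h' : List (Obs n)} (hp : h <+: h')
    (hl : P.tPad + j.val * P.tCycle + P.tMove + P.tQuery ≤ h.length)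
    (hE : EstimateOK A P M β j h) : EstimateOK A P M β j h' := by
  intro i
  rw [queryEstimate_of_prefix hk hkn hp hl]
  exact hE i

/-- After `j` cycles the histogram is nearly uniform and the first `j` estimates are accurate. -/
def CycleGood (A : LocalLearner 𝓜 (uniformVec n) S) (P : Params n k) (M : PreferenceModel n)
    (β B : ℝ) (j : ℕ) (h : List (Obs n)) : Prop :=
  (h.length = P.tPad + j * P.tCycle ∧
    ∀ i, |deficit (uniformVec n) (P.tPad + j * P.tCycle) h i| ≤ B) ∧
  ∀ l : Fin S, l.val < j → EstimateOK A P M β l h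

/-- Failure bound for one move. -/
noncomputable def moveFailure (n m : ℕ) (γ D : ℝ) : ℝ :=
  Real.exp (3 * γ ^ 2 * m) * (n + m * (9 * n * γ)) / Real.exp (γ * D)

/-- Failure bound for one query. -/
noncomputable def queryFailure (n tBlock : ℕ) (y : ℝ) : ℝ :=
  2 * n ^ 2 * Real.exp (-(tBlock * (y ^ 2 / (24 * n))))

lemma moveFailure_nonneg (n m : ℕ) {γ D : ℝ} (hγ : 0 ≤ γ) : 0 ≤ moveFailure n m γ D := by
  unfold moveFailure; positivity

lemma queryFailure_nonneg (n tBlock : ℕ) (y : ℝ) : 0 ≤ queryFailure n tBlock y := by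
  unfold queryFailure; positivity

variable {M : PreferenceModel n} {R : ℕ → Fin n → ℝ} {γ D β y L lam : ℝ}

/-- Conditions on the parameters under which the learning phase succeeds. -/
structure LearnConditions (A : LocalLearner 𝓜 (uniformVec n) S) (P : Params n k)
    (L γ D β y : ℝ) : Prop where
  pad_eq : P.tPad = P.tMove
  move_pos : 0 < P.tMove
  block_pos : 0 < P.tBlock
  gamma_pos : 0 < γ
  gamma_le : γ ≤ 1
  D_nonneg : 0 ≤ D
  radius : P.alpha * P.tLearn S ≤ P.tMove / (2 * n)
  drift : n * D + 2 * P.tQuery ≤ P.tMove / (2 * n)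
  y_pos : 0 < y
  y_le : y ≤ 1 / (2 * n)
  y_beta : 4 * n ^ 3 * y ≤ β
  close : 4 * n * (2 * n ^ 2 * |L| * (n * D + 2 * P.tQuery) / P.tMove) ≤ y
  alpha_pos : 0 < P.alpha
  accuracy_pos : 0 < P.accuracy
  accuracy_le : P.accuracy ≤ 1

/-- At the empty history all deficits equal `tPad / n`, so padding is an admissible move. The first
round, whose memory vector is not in the simplex, is covered because the score bounds hold there
too. -/
lemma reaches_pad (hk : 2 ≤ k) (hkn : k ≤ n) (hlam : (k : ℝ) ^ 2 / n ≤ lam) (hM : Dispersed lam M)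
    (hW : IsTransition (transition (algorithm A P c) M u)) (hC : LearnConditions A P L γ D β y) :
    Reaches (transition (algorithm A P c) M u) R (fun h => h = [])
      (CycleGood A P M β (n * D) 0) P.tPad (moveFailure n P.tMove γ D) := by
  have hn : 1 ≤ n := by omega
  have hn0 : (0 : ℝ) < n := by exact_mod_cast hn
  have hk0 : (1 : ℝ) ≤ k := by exact_mod_cast (by omega : 1 ≤ k)
  have hkk := sq_le_of_dispersed hn hlam hM
  have h := reaches_of_move (R := R) hW (by omega : 1 ≤ k) hkn (uniformVec_mem hn).2 (ta := 0)
    (m := P.tPad) (c := k / n) (by positivity)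
    (by rw [div_mul_eq_mul_div, ← sq]; exact (div_le_one hn0).2 hkk)
    (fun h _ hl => ⟨M.score (memory h), menusAtLeast_of_bounds (by omega) hn
      (score_ge_of_dispersed hn hlam hM _) fun i => (M.score_mem _ i).2, fun K i => by
        rw [transition, algorithm_of_pad (by omega), Nat.zero_add]⟩)
    hC.gamma_pos hC.gamma_le hC.D_nonneg
  refine h.mono hW ?_ ?_ (by rw [moveFailure, hC.pad_eq])
  · rintro _ rfl
    refine ⟨rfl, fun i => ?_⟩
    simp only [deficit, itemCount, List.countP_nil, uniformVec, Nat.zero_add, Nat.cast_zero,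
      sub_zero]
    refine ⟨by positivity, ?_⟩
    rw [mul_one_div, div_mul_eq_mul_div]
    gcongr
    nlinarith [(Nat.cast_nonneg P.tPad : (0 : ℝ) ≤ P.tPad)]
  · rintro h ⟨h1, h2⟩
    simp only [Nat.zero_add] at h1 h2
    exact ⟨⟨by rw [h1]; ring, by simpa using h2⟩, fun l hl => absurd hl (Nat.not_lt_zero _)⟩

/-- Errors do not accumulate over the cycles: each move starts from a deviation it can correct and
ends with the same bound `n * D`. Three stages are chained, and the estimates already made are fixed
by the prefix of the history. -/
lemma reaches_cycle (hk : 2 ≤ k) (hkn : k ≤ n) (hlam : (k : ℝ) ^ 2 / n ≤ lam)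
    (hM : Dispersed lam M) (hLip : LipschitzScores L M)
    (hW : IsTransition (transition (algorithm A P c) M u)) (hC : LearnConditions A P L γ D β y)
    {j : ℕ} (hj : j < S) :
    Reaches (transition (algorithm A P c) M u) R (CycleGood A P M β (n * D) j)
      (CycleGood A P M β (n * D) (j + 1)) P.tCycle
      (moveFailure n P.tMove γ D + (queryFailure n P.tBlock y + moveFailure n P.tMove γ D)) := by
  have hn : 1 ≤ n := by omega
  have hn0 : (0 : ℝ) < n := by exact_mod_cast hn
  have hn1 : (1 : ℝ) ≤ n := by exact_mod_cast hn
  have hk2 : (2 : ℝ) ≤ k := by exact_mod_cast hk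
  have hkk := sq_le_of_dispersed hn hlam hM
  have hc0 : (0 : ℝ) < k / n := by positivity
  have hck : (k : ℝ) / n * k ≤ 1 := by
    rw [div_mul_eq_mul_div, ← sq]; exact (div_le_one hn0).2 hkk
  have hMA : ∀ v, MenusAtLeast k ((k : ℝ) / n) (M.score v) := fun v =>
    menusAtLeast_of_bounds (by omega) hn (score_ge_of_dispersed hn hlam hM v)
      fun i => (M.score_mem v i).2
  have hsc : ∀ v i, 1 / (n : ℝ) ≤ M.score v i := fun v i =>
    le_trans (by gcongr; nlinarith) (score_ge_of_dispersed hn hlam hM v i)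
  set x := A.points P.alpha P.accuracy ⟨j, hj⟩ with hx
  obtain ⟨hxS, hxd⟩ := A.points_mem P.alpha P.accuracy hC.alpha_pos hC.accuracy_pos
    hC.accuracy_le ⟨j, hj⟩
  rw [← hx] at hxS hxd
  set Tj := P.tPad + j * P.tCycle with hTj
  set m := P.tMove with hm
  set tQ := P.tQuery with htQ
  set B : ℝ := n * D with hB
  have hB0 : 0 ≤ B := mul_nonneg hn0.le hC.D_nonneg
  have hcyc : P.tCycle = m + (tQ + m) := by rw [tCycle_eq]; ring
  have hTj1 : P.tPad + (j + 1) * P.tCycle = Tj + m + tQ + m := by rw [hTj, add_mul, hcyc]; ring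
  have htot : Tj + m + tQ + m ≤ P.tLearn S := hTj1 ▸ cycle_le_tLearn hj
  have hdrift := hC.drift
  rw [← hm, ← htQ, ← hB] at hdrift
  have htQ0 : (0 : ℝ) ≤ tQ := by positivity
  have hm0 : (0 : ℝ) < m := by exact_mod_cast hC.move_pos
  have hmn : (m : ℝ) / n = m / (2 * n) + m / (2 * n) := by field_simp; norm_num
  have hxi : ∀ (t : ℕ) i, t ≤ P.tLearn S → |(t : ℝ) * (x i - 1 / n)| ≤ m / (2 * n) := by
    intro t i ht
    have ht' : (t : ℝ) ≤ P.tLearn S := by exact_mod_cast ht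
    rw [abs_mul, Nat.abs_cast]
    have := (abs_sub_le_l2dist x (uniformVec n) i).trans hxd
    calc (t : ℝ) * |x i - 1 / n| ≤ P.tLearn S * P.alpha := by gcongr; exact this
      _ ≤ _ := by rw [mul_comm]; exact hC.radius
  -- Here `k ≥ 2` matters. At the start of a move the deficits are `m / n` up to an error of at most
  -- `m / n`: half of it from the shift of the target, half from the old deviation and the query.
  -- They thus lie in the admissible range `[0, c * m]`.
  have hk2m : 2 * ((m : ℝ) / n) ≤ k / n * m := by
    rw [div_mul_eq_mul_div, ← mul_div_assoc]; gcongr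
  -- first move
  have s1 : Reaches (transition (algorithm A P c) M u) R
      (CycleGood A P M β B j) (fun h => (h.length = Tj + m ∧ ∀ i, |deficit x (Tj + m) h i| ≤ B) ∧
        ∀ l : Fin S, l.val < j → EstimateOK A P M β l h) m (moveFailure n m γ D) := by
    have h0 := reaches_of_move (R := R) hW (by omega : 1 ≤ k) hkn hxS.2 (ta := Tj) (m := m)
      hc0 hck (fun h h1 h2 => ⟨M.score (memory h), hMA _, fun K i => by
        rw [transition, algorithm_of_cycle hj (s := h.length - Tj) (by omega) (by omega),
          if_pos (by omega)]⟩)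
      hC.gamma_pos hC.gamma_le hC.D_nonneg
    refine Reaches.and_of_prefix hW (h0.mono hW (G₀' := CycleGood A P M β B j) ?_ (fun _ h => h)
      le_rfl) ?_
    · rintro h ⟨⟨h1, h2⟩, -⟩
      refine ⟨h1, fun i => ?_⟩
      have e : deficit x (Tj + m) h i = deficit (uniformVec n) Tj h i
          + ((Tj + m : ℕ) : ℝ) * (x i - 1 / n) + m / n := by
        simp only [deficit, uniformVec]; push_cast; ring
      have a1 := abs_le.1 (h2 i)
      have a2 := abs_le.1 (hxi (Tj + m) i (by omega))
      rw [e]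
      constructor <;> linarith
    · rintro h h' ⟨⟨h1, -⟩, h3⟩ hp l hl
      refine estimateOK_of_prefix hk hkn hp ?_ (h3 l hl)
      have : (l.val + 1) * P.tCycle ≤ j * P.tCycle := Nat.mul_le_mul_right _ hl
      rw [add_mul, one_mul] at this
      omega
  -- query
  have s2 : Reaches (transition (algorithm A P c) M u) R
      (fun h => (h.length = Tj + m ∧ ∀ i, |deficit x (Tj + m) h i| ≤ B) ∧
        ∀ l : Fin S, l.val < j → EstimateOK A P M β l h)
      (fun h => (h.length = Tj + m + tQ ∧ ∀ i, |deficit x (Tj + m) h i| ≤ B + tQ) ∧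
        ∀ l : Fin S, l.val < j + 1 → EstimateOK A P M β l h) tQ (queryFailure n P.tBlock y) := by
    have h0 := reaches_of_query (R := R) hW hk hkn (ta := Tj + m) hC.block_pos (σ₀ := M.score x)
      (x := x) (B := B) (κ := 2 * n ^ 2 * |L| * (B + 2 * tQ) / m) (y := y) (by positivity)
      hC.y_pos (hC.y_le.trans (by rw [div_le_one (by positivity)]; linarith)) hC.close
      (fun h h1 h2 h3 => ⟨M.score (memory h), fun K i => by
        rw [transition, algorithm_of_cycle hj (s := h.length - Tj)
          (by rw [hcyc]; change _ < _ + tQ at h2; omega) (by omega), if_neg (by omega),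
          if_pos (by change _ < _ + tQ at h2; omega), Nat.sub_sub], fun K hK => ?_⟩)
    · refine Reaches.mono hW (Reaches.and_of_prefix hW
        (Q := fun h => ∀ l : Fin S, l.val < j → EstimateOK A P M β l h)
        (h0.mono hW (G₀' := fun h => (h.length = Tj + m ∧ ∀ i, |deficit x (Tj + m) h i| ≤ B) ∧
        ∀ l : Fin S, l.val < j → EstimateOK A P M β l h) (fun h hh => hh.1) (fun _ h => h)
        le_rfl) ?_) (fun _ h => h) ?_ le_rfl
      · rintro h h' ⟨⟨h1, -⟩, h3⟩ hp l hl
        refine estimateOK_of_prefix hk hkn hp ?_ (h3 l hl)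
        have : (l.val + 1) * P.tCycle ≤ j * P.tCycle := Nat.mul_le_mul_right _ hl
        rw [add_mul, one_mul] at this
        omega
      · rintro h ⟨⟨⟨h1, h2⟩, h3⟩, h4⟩
        refine ⟨⟨h1, fun i => ?_⟩, fun l hl => ?_⟩
        · have := h2 i
          rw [h1] at this
          push_cast at this
          have e : (numQueryMenus n k : ℝ) * P.tBlock = tQ := by
            rw [htQ, Params.tQuery]; push_cast; ring
          linarith
        · rcases Nat.lt_succ_iff_lt_or_eq.1 hl with hl | hl
          · exact h4 l hl
          · obtain rfl : l = ⟨j, hj⟩ := Fin.ext hl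
            intro i
            refine (abs_queryEstimate_sub_le hk hkn hC.block_pos hC.y_pos.le hC.y_le
              ((hMA x).mono ?_) (hsc x) (fun i => (M.score_mem x i).2) h3 i).trans hC.y_beta
            gcongr; linarith
    · have hKne : K.Nonempty := Finset.card_pos.1 (by omega)
      have hpos : ∀ v i, 0 < M.score v i := fun v i => lt_of_lt_of_le (by positivity) (hsc v i)
      have hmem : memory h ∈ stdSimplex ℝ (Fin n) := memory_mem_stdSimplex (by
        have := hC.move_pos; omega)
      refine ⟨(hMA _ K hK).1, fun i => ⟨menuDist_nonneg (fun j _ => (hpos _ j).le) i, ?_⟩⟩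
      have hlen : (Tj : ℝ) + m ≤ h.length := by exact_mod_cast h1
      have hlen' : (h.length : ℝ) ≤ Tj + m + tQ := by
        have : h.length ≤ Tj + m + tQ := h2.le
        exact_mod_cast this
      have hTj0 : (0 : ℝ) ≤ Tj := by positivity
      have hl0 : (0 : ℝ) < h.length := by linarith
      -- Each query round changes a deficit by at most one and extends the reference histogram by
      -- one round; hence `2 * tQ`. The history has at least `m` rounds already.
      have hdist : ∀ i, |memory h i - x i| ≤ (B + 2 * tQ) / m := by
        intro i
        have e : memory h i - x i = -(deficit x (Tj + m) h i
            + ((h.length : ℝ) - (Tj + m)) * x i) / h.length := by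
          simp only [memory, deficit]; push_cast; field_simp; ring
        rw [e, abs_div, abs_neg, abs_of_pos hl0]
        have hx1 : x i ≤ 1 := (stdSimplex ℝ (Fin n)).mem_of_mem_of_subset hxS subset_rfl |>.2 ▸
          Finset.single_le_sum (fun i _ => hxS.1 i) (Finset.mem_univ i)
        have hx0 := hxS.1 i
        have a1 := h3 i
        push_cast at a1
        have a2 : |((h.length : ℝ) - (Tj + m)) * x i| ≤ tQ := by
          rw [abs_mul, abs_of_nonneg hx0, abs_of_nonneg (by linarith)]
          nlinarith
        have a3 : |deficit x (Tj + m) h i + ((h.length : ℝ) - (Tj + m)) * x i| ≤ B + 2 * tQ :=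
          (abs_add_le _ _).trans (by linarith)
        gcongr
        linarith
      have hl2 := l2dist_le_of_abs_sub_le (by positivity) hdist
      have hsd : ∀ i, |M.score (memory h) i - M.score x i| ≤ |L| * (n * ((B + 2 * tQ) / m)) := by
        intro i
        refine (hLip _ hmem _ hxS i).trans ?_
        exact mul_le_mul (le_abs_self L) hl2 (l2dist_nonneg _ _) (abs_nonneg L)
      refine (abs_menuDist_sub_le (mu := 1 / n) (by positivity) (fun j _ => hsc _ j)
        (fun j _ => (hpos _ j).le) (Finset.sum_pos (fun j _ => hpos _ j) hKne)
        (fun j _ => hsd j) (by positivity) i).trans (le_of_eq ?_)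
      field_simp
  -- back
  have s3 : Reaches (transition (algorithm A P c) M u) R
      (fun h => (h.length = Tj + m + tQ ∧ ∀ i, |deficit x (Tj + m) h i| ≤ B + tQ) ∧
        ∀ l : Fin S, l.val < j + 1 → EstimateOK A P M β l h)
      (CycleGood A P M β B (j + 1)) m (moveFailure n m γ D) := by
    have h0 := reaches_of_move (R := R) hW (by omega : 1 ≤ k) hkn (uniformVec_mem hn).2
      (ta := Tj + m + tQ) (m := m)
      hc0 hck (fun h h1 h2 => ⟨M.score (memory h), hMA _, fun K i => by
        rw [transition, algorithm_of_cycle hj (s := h.length - Tj) (by omega) (by omega),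
          if_neg (by omega), if_neg (by omega), hTj1]⟩)
      hC.gamma_pos hC.gamma_le hC.D_nonneg
    refine Reaches.mono hW (Reaches.and_of_prefix hW
      (Q := fun h => ∀ l : Fin S, l.val < j + 1 → EstimateOK A P M β l h)
      (h0.mono hW (G₀' := fun h => (h.length = Tj + m + tQ ∧
        ∀ i, |deficit x (Tj + m) h i| ≤ B + tQ) ∧
        ∀ l : Fin S, l.val < j + 1 → EstimateOK A P M β l h) ?_ (fun _ h => h) le_rfl) ?_)
      (fun _ h => h) ?_ le_rfl
    · rintro h ⟨⟨h1, h2⟩, -⟩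
      refine ⟨h1, fun i => ?_⟩
      -- The same computation as on the way out, with the target shift reversed; the query rounds
      -- raise the uniform target by `tQ / n`.
      have e : deficit (uniformVec n) (Tj + m + tQ + m) h i = deficit x (Tj + m) h i
          - ((Tj + m : ℕ) : ℝ) * (x i - 1 / n) + (tQ / n + m / n) := by
        simp only [deficit, uniformVec]; push_cast; ring
      have a1 := abs_le.1 (h2 i)
      have a2 := abs_le.1 (hxi (Tj + m) i (by omega))
      have a3 : (tQ : ℝ) / n ≤ tQ := div_le_self htQ0 hn1
      have a4 : 0 ≤ (tQ : ℝ) / n := by positivity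
      rw [e]
      constructor <;> linarith
    · rintro h h' ⟨⟨h1, -⟩, h3⟩ hp l hl
      refine estimateOK_of_prefix hk hkn hp ?_ (h3 l hl)
      have : l.val * P.tCycle ≤ j * P.tCycle := Nat.mul_le_mul_right _ (by omega)
      omega
    · rintro h ⟨⟨h1, h2⟩, h3⟩
      exact ⟨⟨by rw [h1, hTj1], by rw [hTj1]; exact h2⟩, h3⟩
  rw [hcyc]
  exact s1.trans hW (s2.trans hW s3 (moveFailure_nonneg n m hC.gamma_pos.le))
    (add_nonneg (queryFailure_nonneg _ _ _) (moveFailure_nonneg n m hC.gamma_pos.le))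

lemma reaches_learned (hk : 2 ≤ k) (hkn : k ≤ n) (hlam : (k : ℝ) ^ 2 / n ≤ lam)
    (hM : Dispersed lam M) (hLip : LipschitzScores L M)
    (hW : IsTransition (transition (algorithm A P c) M u)) (hC : LearnConditions A P L γ D β y) :
    Reaches (transition (algorithm A P c) M u) R (fun h => h = [])
      (CycleGood A P M β (n * D) S) (P.tLearn S)
      (moveFailure n P.tMove γ D + S *
        (2 * moveFailure n P.tMove γ D + queryFailure n P.tBlock y)) := by
  have h0 := moveFailure_nonneg n P.tMove (D := D) hC.gamma_pos.le
  have h1 := queryFailure_nonneg n P.tBlock y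
  have aux : ∀ j ≤ S, Reaches (transition (algorithm A P c) M u) R (fun h => h = [])
      (CycleGood A P M β (n * D) j) (P.tPad + j * P.tCycle)
      (moveFailure n P.tMove γ D + j *
        (2 * moveFailure n P.tMove γ D + queryFailure n P.tBlock y)) := by
    intro j
    induction j with
    | zero =>
      intro _
      have := reaches_pad (R := R) hk hkn hlam hM hW hC
      simpa using this
    | succ j ih =>
      intro hj
      have := (ih (by omega)).trans hW (reaches_cycle (R := R) hk hkn hlam hM hLip hW hC
        (j := j) (by omega)) (by positivity)
      rw [add_assoc, ← Nat.succ_mul] at this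
      refine this.mono hW (fun _ h => h) (fun _ h => h) (le_of_eq ?_)
      push_cast; ring
  exact aux S le_rfl

end Learning

/-! ### Projections -/

section Proj

variable {n : ℕ} {K : Set (Reduced n)}

lemma proj_spec (hcl : IsClosed K) (hne : K.Nonempty) (y : Reduced n) :
    proj K y ∈ K ∧ ∀ z ∈ K, dist y (proj K y) ≤ dist y z := by
  have h : ∃ x ∈ K, ∀ z ∈ K, dist y x ≤ dist y z := by
    obtain ⟨x, hx, he⟩ := hcl.exists_infDist_eq_dist hne y
    exact ⟨x, hx, fun z hz => he ▸ Metric.infDist_le_dist_of_mem hz⟩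
  rw [proj, dif_pos h]
  exact h.choose_spec

lemma inner_proj_le_zero (hcl : IsClosed K) (hconv : Convex ℝ K) (y : Reduced n) {z : Reduced n}
    (hz : z ∈ K) : inner ℝ (y - proj K y) (z - proj K y) ≤ 0 := by
  obtain ⟨h1, h2⟩ := proj_spec hcl ⟨z, hz⟩ y
  refine (norm_eq_iInf_iff_real_inner_le_zero hconv h1).1 ?_ z hz
  have : Nonempty K := ⟨⟨z, hz⟩⟩
  refine le_antisymm (le_ciInf fun w => ?_) (ciInf_le ⟨0, ?_⟩ (⟨_, h1⟩ : K))
  · simpa [dist_eq_norm] using h2 w w.2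
  · rintro _ ⟨w, rfl⟩; exact norm_nonneg _

lemma norm_proj_sub_le (hcl : IsClosed K) (hconv : Convex ℝ K) (y : Reduced n) {z : Reduced n}
    (hz : z ∈ K) : ‖proj K y - z‖ ≤ ‖y - z‖ := by
  have h := inner_proj_le_zero hcl hconv y hz
  have e : ‖y - z‖ ^ 2 = ‖y - proj K y‖ ^ 2 + 2 * inner ℝ (y - proj K y) (proj K y - z)
      + ‖proj K y - z‖ ^ 2 := by
    rw [← norm_add_sq_real, sub_add_sub_cancel]
  rw [show z - proj K y = -(proj K y - z) by abel, inner_neg_right] at h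
  refine le_of_sq_le_sq ?_ (norm_nonneg _)
  nlinarith [sq_nonneg ‖y - proj K y‖]

/-- Projections to closed convex sets are nonexpansive, and for the empty set the default value is
constant. Continuity is needed for the measurability of the iterates in the directions. -/
lemma continuous_proj (hcl : IsClosed K) (hconv : Convex ℝ K) : Continuous (proj K) := by
  rcases K.eq_empty_or_nonempty with rfl | hne
  · have : (proj (∅ : Set (Reduced n))) = fun _ => 0 := by
      ext1 y; rw [proj, dif_neg]; simp
    rw [this]; exact continuous_const
  · refine (LipschitzWith.of_dist_le_mul (K := 1) fun y y' => ?_).continuous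
    have h1 := inner_proj_le_zero hcl hconv y (proj_spec hcl hne y').1
    have h2 := inner_proj_le_zero hcl hconv y' (proj_spec hcl hne y).1
    set p := proj K y
    set p' := proj K y'
    rw [NNReal.coe_one, one_mul, dist_eq_norm, dist_eq_norm]
    have h3 : ‖p - p'‖ ^ 2 ≤ inner ℝ (y - y') (p - p') := by
      rw [← real_inner_self_eq_norm_sq]
      have e1 : inner ℝ (y - p) (p' - p) = - inner ℝ (y - p) (p - p') := by
        rw [← inner_neg_right, neg_sub]
      have e2 : inner ℝ (y - y') (p - p') - inner ℝ (p - p') (p - p')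
          = inner ℝ (y - p) (p - p') - inner ℝ (y' - p') (p - p') := by
        rw [← inner_sub_left, ← inner_sub_left]; congr 1; abel
      linarith
    have h4 := real_inner_le_norm (y - y') (p - p')
    by_contra hlt
    push Not at hlt
    nlinarith [norm_nonneg (y - y'), norm_nonneg (p - p')]

end Proj

/-! ### The optimization phase along one history -/

section Iterates

variable {n k S : ℕ} {𝓜 : Set (PreferenceModel n)} {A : LocalLearner 𝓜 (uniformVec n) S}
  {P : Params n k} {c : ℝ}

lemma isClosed_decisionSet (h : List (Obs n)) (s : ℕ) : IsClosed (decisionSet A P c h s) := by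
  have : decisionSet A P c h s = lift ⁻¹' entropySet n c ∩ ⋂ (j : ℕ) (_ : 1 ≤ j) (_ : j ≤ s),
      lift ⁻¹' menuHull k (learnedModel A P h (memory (h.take (P.tLearn S + j)))) := by
    ext w; simp [decisionSet, IRD, menuHull]
  rw [this]
  refine ((isClosed_entropySet n c).preimage continuous_lift).inter ?_
  exact isClosed_iInter fun j => isClosed_iInter fun _ => isClosed_iInter fun _ =>
    (isClosed_menuHull _ _).preimage continuous_lift

lemma convex_decisionSet (h : List (Obs n)) (s : ℕ) : Convex ℝ (decisionSet A P c h s) := by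
  rintro x ⟨hx1, hx2⟩ y ⟨hy1, hy2⟩ a b ha hb hab
  refine ⟨?_, fun j h1 h2 => ?_⟩
  · rw [lift_combo _ _ hab]
    exact convex_entropySet n c hx1 hy1 ha hb hab
  · rw [lift_combo _ _ hab]
    exact convex_menuHull _ _ (hx2 j h1 h2) (hy2 j h1 h2) ha hb hab

lemma isClosed_contracted {K : Set (Reduced n)} (hK : IsClosed K) : IsClosed (contracted P K) :=
  hK.preimage (continuous_const_smul _)

lemma convex_contracted {K : Set (Reduced n)} (hK : Convex ℝ K) : Convex ℝ (contracted P K) := by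
  intro x hx y hy a b ha hb hab
  have := hK hx hy ha hb hab
  simp only [contracted, Set.mem_ofPred_eq, smul_add] at this ⊢
  rwa [smul_comm _ a, smul_comm _ b]

lemma learnedModel_of_prefix (hk : 2 ≤ k) (hkn : k ≤ n) {h h' : List (Obs n)} (hp : h <+: h')
    (hl : P.tLearn S ≤ h.length) : learnedModel A P h' = learnedModel A P h := by
  unfold learnedModel
  congr 1
  ext1 j
  refine queryEstimate_of_prefix hk hkn hp ?_
  have := cycle_le_tLearn (P := P) j.2
  have e : P.tCycle = 2 * P.tMove + numQueryMenus n k * P.tBlock := rfl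
  rw [add_mul, one_mul, e] at this
  rw [e]
  omega

lemma decisionSet_of_prefix (hk : 2 ≤ k) (hkn : k ≤ n) {h h' : List (Obs n)} (hp : h <+: h')
    {s : ℕ} (hl : P.tLearn S + s ≤ h.length) :
    decisionSet A P c h' s = decisionSet A P c h s := by
  obtain ⟨t, rfl⟩ := hp
  unfold decisionSet
  rw [learnedModel_of_prefix hk hkn (List.prefix_append h t) (by omega)]
  ext w
  refine and_congr Iff.rfl (forall_congr' fun j => forall_congr' fun h1 => forall_congr' fun h2 => ?_)
  rw [List.take_append_of_le_length (by omega)]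

/-- Iterates can be read off any longer history. This lets the descent inequality be summed along
one complete history. -/
lemma iterate_of_prefix (hk : 2 ≤ k) (hkn : k ≤ n) {h h' : List (Obs n)} (hp : h <+: h')
    {u : ℕ → Reduced n} : ∀ {s : ℕ}, P.tLearn S + s ≤ h.length →
    iterate A P c u h' s = iterate A P c u h s
  | 0, _ => rfl
  | s + 1, hl => by
    have ih := iterate_of_prefix hk hkn hp (u := u) (s := s) (by omega)
    rw [iterate, iterate, ih, decisionSet_of_prefix hk hkn hp hl]
    obtain ⟨t, rfl⟩ := hp
    rw [List.map_append, List.getD_append _ _ _ _ (by simp; omega)]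

lemma iterate_congr_directions {h : List (Obs n)} {u u' : ℕ → Reduced n} : ∀ {s : ℕ},
    (∀ t, t < P.tLearn S + s → u t = u' t) → iterate A P c u h s = iterate A P c u' h s
  | 0, _ => rfl
  | s + 1, hu => by
    rw [iterate, iterate, iterate_congr_directions (s := s) fun t ht => hu t (by omega),
      hu (P.tLearn S + s) (by omega)]

lemma measurable_directions {T : ℕ} (t : ℕ) :
    Measurable fun ω : Fin T → Metric.sphere (0 : Reduced n) 1 => directions ω t := by
  by_cases h : t < T
  · simp only [directions, h, dif_pos]
    exact measurable_subtype_coe.comp (measurable_pi_apply _)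
  · simp only [directions, h, dif_neg, not_false_eq_true]
    exact measurable_const

lemma measurable_iterate {T : ℕ} (h : List (Obs n)) : ∀ s, Measurable
    fun ω : Fin T → Metric.sphere (0 : Reduced n) 1 => iterate A P c (directions ω) h s
  | 0 => measurable_const
  | s + 1 => by
    simp only [iterate]
    refine (continuous_proj (isClosed_contracted (isClosed_decisionSet h _))
      (convex_contracted (convex_decisionSet h _))).measurable.comp ?_
    refine (measurable_iterate h s).sub ?_
    exact ((measurable_directions _).const_smul (_ : ℝ)).const_smul (_ : ℝ)

lemma measurable_algorithm {T : ℕ} (h : List (Obs n)) (K : Finset (Fin n)) : Measurable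
    fun ω : Fin T → Metric.sphere (0 : Reduced n) 1 => algorithm A P c (directions ω) h K := by
  by_cases hl : h.length < P.tLearn S
  · simp only [algorithm, if_pos hl]; exact measurable_const
  · simp only [algorithm, if_neg hl]
    exact (P.lp.measurable _ K).comp
      ((measurable_iterate h _).prodMk ((measurable_directions _).const_smul P.delta))

lemma algorithm_congr_directions {h : List (Obs n)} {u u' : ℕ → Reduced n}
    (hu : ∀ t, t ≤ h.length → u t = u' t) : algorithm A P c u h = algorithm A P c u' h := by
  by_cases hl : h.length < P.tLearn S
  · simp only [algorithm, if_pos hl]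
  · simp only [algorithm, if_neg hl]
    rw [iterate_congr_directions (u := u) (u' := u') fun t ht => hu t (by omega), hu _ le_rfl]

lemma isMenuDistribution_algorithm (hk : 2 ≤ k) (hkn : k ≤ n) (u : ℕ → Reduced n)
    (h : List (Obs n)) : IsMenuDistribution k (algorithm A P c u h) := by
  by_cases hl : h.length < P.tLearn S
  · simp only [algorithm, if_pos hl, learnStep]
    split_ifs
    · exact isMenuDistribution_playTop hkn _
    · exact isMenuDistribution_playTop hkn _
    · exact isMenuDistribution_playTop hkn _
    · exact isMenuDistribution_playMenu (card_queryMenu hk hkn _)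
    · exact isMenuDistribution_playTop hkn _
  · simp only [algorithm, if_neg hl]
    exact P.lp.isMenuDistribution _ _ _

/-- Conditions on the parameters under which the optimization phase succeeds. -/
structure OptConditions (A : LocalLearner 𝓜 (uniformVec n) S) (P : Params n k) (c θ R : ℝ) :
    Prop where
  two_le : 2 ≤ k
  le_n : k ≤ n
  theta_pos : 0 < θ
  theta_lt : θ < 1
  r_pos : 0 < P.r
  delta_pos : 0 < P.delta
  eps_pos : 0 < P.eps
  theta_eq : P.delta + P.eps = θ * P.r
  R_pos : 0 < R
  R_le : R ≤ 1 / (4 * n ^ 2)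
  r_le : n * P.r ≤ R
  ball : ∀ w : Reduced n, ‖w‖ ≤ R → lift w ∈ entropySet n c
  acc_pos : 0 < P.accuracy
  acc_le : P.accuracy ≤ 1 / (4 * n ^ 3)
  acc_theta : 4 * n ^ 3 * P.accuracy ≤ R * θ
  tLearn_pos : 0 < P.tLearn S
  lp : ∀ s, CrossInHull k R s → ∀ x : Reduced n,
      lift ((1 - θ)⁻¹ • x) ∈ menuHull k s →
      ∃ (z : Finset (Fin n) → ℝ) (ζ : Fin (n - 1) → Finset (Fin n) → ℝ),
        (∀ j, ∑ K, |ζ j K| ≤ 1 / R) ∧ (∀ j K, K.card ≠ k → ζ j K = 0) ∧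
        ∀ w : Reduced n, ‖w‖ ≤ θ * P.r → (∀ K, P.lp.sol s x w K = z K + ∑ j, w j * ζ j K) ∧
          ∑ K, P.lp.sol s x w K • menuDist s K = lift (x + w)

/-- The learned model is accurate on the whole simplex. -/
def GoodModel (A : LocalLearner 𝓜 (uniformVec n) S) (P : Params n k) (M : PreferenceModel n)
    (h : List (Obs n)) : Prop :=
  ∀ v ∈ stdSimplex ℝ (Fin n),
    l2dist (normalizeScores (learnedModel A P h v)) (normalizeScores (M.score v)) ≤ P.accuracy

lemma goodModel_of_cycleGood {M : PreferenceModel n} (hM : M ∈ 𝓜) {B : ℝ} (hα : 0 < P.alpha)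
    (h1 : 0 < P.accuracy) (h2 : P.accuracy ≤ 1) {h : List (Obs n)}
    (hG : CycleGood A P M (P.accuracy / A.errorFactor P.alpha) B S h) : GoodModel A P M h :=
  A.accurate _ _ hα h1 h2 M hM _ fun j i => hG.2 j j.2 i

lemma goodModel_iff_of_prefix (hk : 2 ≤ k) (hkn : k ≤ n) {M : PreferenceModel n}
    {h h' : List (Obs n)} (hp : h <+: h') (hl : P.tLearn S ≤ h.length) :
    GoodModel A P M h' ↔ GoodModel A P M h := by
  unfold GoodModel; rw [learnedModel_of_prefix hk hkn hp hl]

/-- Scores which are accurate relative to true scores in `[1 / n, 1]`. -/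
lemma abs_menuDist_sub_le_of_l2dist {s σ : Fin n → ℝ} {ε : ℝ} (hn : 1 ≤ n) (hε0 : 0 ≤ ε)
    (hε : ε ≤ 1 / (2 * n ^ 2)) (hσ0 : ∀ i, 1 / (n : ℝ) ≤ σ i) (hσ1 : ∀ i, σ i ≤ 1)
    (hs : l2dist (normalizeScores s) (normalizeScores σ) ≤ ε) {K : Finset (Fin n)}
    (hK : K.Nonempty) :
    (∑ i, menuDist s K i = 1) ∧ (∀ i, 0 ≤ menuDist s K i) ∧
      ∀ i, |menuDist σ K i - menuDist s K i| ≤ 2 * n ^ 2 * ε := by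
  have hn0 : (0 : ℝ) < n := by exact_mod_cast hn
  have hσp : ∀ i, 0 < σ i := fun i => lt_of_lt_of_le (by positivity) (hσ0 i)
  have hu : (Finset.univ : Finset (Fin n)).Nonempty := ⟨⟨0, hn⟩, Finset.mem_univ _⟩
  have hσs : 0 < ∑ j, σ j := Finset.sum_pos (fun j _ => hσp j) hu
  have hσle : ∑ j, σ j ≤ n := by
    have := Finset.sum_le_card_nsmul Finset.univ σ 1 fun j _ => hσ1 j
    simpa using this
  have ha : ∀ i, (1 : ℝ) / (n : ℝ) ^ 2 ≤ normalizeScores σ i := fun i => by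
    rw [normalizeScores, le_div_iff₀ hσs]
    calc (1 : ℝ) / (n : ℝ) ^ 2 * ∑ j, σ j ≤ (1 : ℝ) / (n : ℝ) ^ 2 * (n : ℝ) := by gcongr
      _ = 1 / (n : ℝ) := by field_simp
      _ ≤ σ i := hσ0 i
  have hab : ∀ i, |normalizeScores σ i - normalizeScores s i| ≤ ε := fun i => by
    rw [abs_sub_comm]; exact (abs_sub_le_l2dist _ _ i).trans hs
  have hhalf : 1 / (n : ℝ) ^ 2 = 1 / (2 * n ^ 2) + 1 / (2 * n ^ 2) := by field_simp; norm_num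
  have hb : ∀ i, 0 < normalizeScores s i := fun i => by
    have h1 := ha i
    have h2 := (abs_le.1 (hab i)).2
    have h3 : (0 : ℝ) < 1 / (2 * n ^ 2) := by positivity
    linarith
  have hss : ∑ j, s j ≠ 0 := fun h0 => by
    have := hb ⟨0, hn⟩
    rw [normalizeScores, h0, div_zero] at this
    exact lt_irrefl _ this
  have hBK : 0 < ∑ j ∈ K, normalizeScores s j := Finset.sum_pos (fun j _ => hb j) hK
  rw [← menuDist_normalize hss, ← menuDist_normalize hσs.ne']
  refine ⟨sum_menuDist hBK.ne', menuDist_nonneg fun j _ => (hb j).le, fun i => ?_⟩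
  refine (abs_menuDist_sub_le (mu := 1 / (n : ℝ) ^ 2) (by positivity) (fun j _ => ha j)
    (fun j _ => (hb j).le) hBK (fun j _ => hab j) hε0 i).trans (le_of_eq ?_)
  field_simp

variable {θ R : ℝ} {M : PreferenceModel n} {lam : ℝ}

namespace OptConditions

variable (hO : OptConditions A P c θ R)
include hO

lemma one_le_n : (1 : ℝ) ≤ n := by
  have := hO.two_le; have := hO.le_n
  exact_mod_cast (by omega : 1 ≤ n)

lemma ratio_eq : P.r / (P.r - P.delta - P.eps) = (1 - θ)⁻¹ := by
  have h1 : P.r - P.delta - P.eps = P.r * (1 - θ) := by linear_combination -hO.theta_eq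
  rw [h1, ← div_div, div_self hO.r_pos.ne', one_div]

lemma acc_le' : P.accuracy ≤ 1 / (2 * n ^ 2) := by
  refine hO.acc_le.trans ?_
  have := hO.one_le_n
  apply one_div_le_one_div_of_le (by positivity)
  nlinarith [sq_nonneg (n : ℝ)]

lemma menuDist_close (hlam : (k : ℝ) ^ 2 / n ≤ lam) (hM : Dispersed lam M) {h : List (Obs n)}
    (hG : GoodModel A P M h) {v : Fin n → ℝ} (hv : v ∈ stdSimplex ℝ (Fin n)) {K : Finset (Fin n)}
    (hK : K.card = k) :
    (∑ i, menuDist (learnedModel A P h v) K i = 1) ∧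
    (∀ i, 0 ≤ menuDist (learnedModel A P h v) K i) ∧
    (∀ i, |menuDist (M.score v) K i - menuDist (learnedModel A P h v) K i|
      ≤ 2 * n ^ 2 * P.accuracy) := by
  have hk := hO.two_le
  have hn := hO.one_le_n
  have hk2 : (2 : ℝ) ≤ k := by exact_mod_cast hk
  have hn' : 1 ≤ n := by exact_mod_cast hn
  refine abs_menuDist_sub_le_of_l2dist hn' hO.acc_pos.le hO.acc_le'
    (fun i => le_trans ?_ (score_ge_of_dispersed hn' hlam hM v i))
    (fun i => (M.score_mem v i).2) (hG v hv) (Finset.card_pos.1 (by omega))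
  gcongr; nlinarith

/-- The true probabilities are at least `k / n ≥ 2 / n`, and the model error costs at most `1 / (2
n)`. The surplus over `1 / n` is what makes a ball around the uniform vector inducible. -/
lemma menusAtLeast_learned (hlam : (k : ℝ) ^ 2 / n ≤ lam) (hM : Dispersed lam M)
    {h : List (Obs n)} (hG : GoodModel A P M h) {v : Fin n → ℝ}
    (hv : v ∈ stdSimplex ℝ (Fin n)) : MenusAtLeast k (3 / (2 * n)) (learnedModel A P h v) := by
  have hk := hO.two_le
  have hn := hO.one_le_n
  have hk2 : (2 : ℝ) ≤ k := by exact_mod_cast hk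
  have hn' : 1 ≤ n := by exact_mod_cast hn
  intro K hK
  obtain ⟨h1, -, h3⟩ := hO.menuDist_close hlam hM hG hv hK
  refine ⟨h1, fun i hi => ?_⟩
  have h4 := (menusAtLeast_of_bounds (by omega) hn' (score_ge_of_dispersed hn' hlam hM v)
    (fun i => (M.score_mem v i).2) K hK).2 i hi
  have h5 := (abs_le.1 (h3 i)).2
  have h6 : 2 * (n : ℝ) ^ 2 * P.accuracy ≤ 1 / (2 * (n : ℝ)) := by
    calc 2 * (n : ℝ) ^ 2 * P.accuracy ≤ 2 * (n : ℝ) ^ 2 * (1 / (4 * (n : ℝ) ^ 3)) := by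
          gcongr; exact hO.acc_le
      _ = 1 / (2 * (n : ℝ)) := by field_simp; norm_num
  have h7 : (2 : ℝ) / n ≤ k / n := by gcongr
  have h8 : (2 : ℝ) / n = 3 / (2 * n) + 1 / (2 * n) := by field_simp; norm_num
  linarith

/-- Since `R ≤ 1 / (4 n ^ 2)`, the entries stay within `1 / (2 n)` of `1 / n`, so they are
nonnegative and at most `3 / (2 n)`, and `mem_menuHull_of_le` applies. -/
lemma lift_mem_menuHull {s : Fin n → ℝ} (hs : MenusAtLeast k (3 / (2 * n)) s) {w : Reduced n}
    (hw : ‖w‖ ≤ R) : lift w ∈ menuHull k s := by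
  have hk := hO.two_le
  have hn := hO.one_le_n
  have hn' : 1 ≤ n := by exact_mod_cast hn
  have hpos : (0 : ℝ) < 1 / (2 * (n : ℝ)) := by positivity
  have hdist : ∀ i, |lift w i - 1 / (n : ℝ)| ≤ 1 / (2 * (n : ℝ)) := fun i => by
    have h1 := abs_sub_le_l2dist (lift w) (lift 0) i
    have h2 := l2dist_lift_le hn' w 0
    rw [lift_zero] at h1 h2
    rw [sub_zero] at h2
    refine h1.trans (h2.trans ?_)
    calc (n : ℝ) * ‖w‖ ≤ n * (1 / (4 * n ^ 2)) := by gcongr; exact hw.trans hO.R_le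
      _ ≤ 1 / (2 * n) := by
          rw [mul_one_div, div_le_div_iff₀ (by positivity) (by positivity)]
          nlinarith [sq_nonneg (n : ℝ)]
  have e1 : (1 : ℝ) / n = 1 / (2 * n) + 1 / (2 * n) := by field_simp; norm_num
  have e2 : (3 : ℝ) / (2 * n) = 1 / n + 1 / (2 * n) := by field_simp; norm_num
  refine mem_menuHull_of_le (by omega) hO.le_n hs (fun i => ?_) (sum_lift hn' w) fun i => ?_
  · have := (abs_le.1 (hdist i)).1; linarith
  · have := (abs_le.1 (hdist i)).2; linarith

lemma crossInHull {s : Fin n → ℝ} (hs : MenusAtLeast k (3 / (2 * n)) s) : CrossInHull k R s := by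
  intro j
  have h : ‖R • unitDir n j‖ ≤ R := by
    rw [norm_smul, Real.norm_eq_abs, abs_of_pos hO.R_pos, unitDir, PiLp.norm_single]
    simp
  exact ⟨hO.lift_mem_menuHull hs h, hO.lift_mem_menuHull hs (by rwa [norm_neg])⟩

lemma zero_mem_contracted (hlam : (k : ℝ) ^ 2 / n ≤ lam) (hM : Dispersed lam M)
    {h : List (Obs n)} (hG : GoodModel A P M h) (hl : P.tLearn S ≤ h.length) (s : ℕ) :
    (0 : Reduced n) ∈ contracted P (decisionSet A P c h s) := by
  have ht := hO.tLearn_pos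
  have h0 : ‖(0 : Reduced n)‖ ≤ R := by rw [norm_zero]; exact hO.R_pos.le
  simp only [contracted, Set.mem_ofPred_eq, smul_zero]
  refine ⟨hO.ball 0 h0, fun j h1 h2 => ?_⟩
  refine hO.lift_mem_menuHull (hO.menusAtLeast_learned hlam hM hG ?_) h0
  exact memory_mem_stdSimplex (by simp; omega)

lemma iterate_mem_contracted (hlam : (k : ℝ) ^ 2 / n ≤ lam) (hM : Dispersed lam M)
    {h : List (Obs n)} (hG : GoodModel A P M h) (hl : P.tLearn S ≤ h.length)
    (u : ℕ → Reduced n) (s : ℕ) :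
    iterate A P c u h s ∈ contracted P (decisionSet A P c h s) := by
  cases s with
  | zero => exact hO.zero_mem_contracted hlam hM hG hl 0
  | succ s =>
    exact (proj_spec (isClosed_contracted (isClosed_decisionSet h _))
      ⟨0, hO.zero_mem_contracted hlam hM hG hl _⟩ _).1

lemma iterate_scaled_mem (hlam : (k : ℝ) ^ 2 / n ≤ lam) (hM : Dispersed lam M)
    {h : List (Obs n)} (hG : GoodModel A P M h) {s : ℕ} (hl : h.length = P.tLearn S + s)
    (u : ℕ → Reduced n) :
    lift ((1 - θ)⁻¹ • iterate A P c u h s) ∈ entropySet n c ∧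
    lift ((1 - θ)⁻¹ • iterate A P c u h s) ∈ menuHull k (learnedModel A P h (memory h)) := by
  have ht := hO.tLearn_pos
  have h1 := hO.iterate_mem_contracted hlam hM hG (by omega) u s
  simp only [contracted, Set.mem_ofPred_eq, hO.ratio_eq] at h1
  refine ⟨h1.1, ?_⟩
  -- In the first optimization round the decision set does not involve the current memory vector
  -- yet, but the iterate is the uniform vector, which is inducible under any accurate model.
  rcases Nat.eq_zero_or_pos s with rfl | hs
  · rw [iterate, smul_zero]
    refine hO.lift_mem_menuHull (hO.menusAtLeast_learned hlam hM hG ?_)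
      (by rw [norm_zero]; exact hO.R_pos.le)
    exact memory_mem_stdSimplex (by omega)
  · have := h1.2 s hs le_rfl
    rwa [List.take_of_length_le hl.le] at this

/-- The contracted comparator. -/
lemma comparator_mem (hlam : (k : ℝ) ^ 2 / n ≤ lam) (hM : Dispersed lam M)
    {h : List (Obs n)} (hG : GoodModel A P M h) (hl : P.tLearn S ≤ h.length)
    {x : Fin n → ℝ} (hx : x ∈ entropySet n c ∩ EIRD k M.score) (s : ℕ) :
    ((1 - θ) * (1 - θ / 2)) • reduce x ∈ contracted P (decisionSet A P c h s) := by
  have ht := hO.tLearn_pos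
  have hn := hO.one_le_n
  have hn' : 1 ≤ n := by exact_mod_cast hn
  have hθ0 := hO.theta_pos
  have hθ1 := hO.theta_lt
  have h1θ : (0 : ℝ) < 1 - θ := by linarith
  have hlx : lift (reduce x) = x := lift_reduce hn' hx.1.1.2
  simp only [contracted, Set.mem_ofPred_eq, hO.ratio_eq, smul_smul, ← mul_assoc,
    inv_mul_cancel₀ h1θ.ne', one_mul]
  refine ⟨?_, fun j h1 h2 => ?_⟩
  · have e : (1 - θ / 2) • reduce x = (1 - θ / 2) • reduce x + (θ / 2) • (0 : Reduced n) := by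
      rw [smul_zero, add_zero]
    rw [e, lift_combo _ _ (by ring), hlx]
    exact convex_entropySet n c hx.1 (hO.ball 0 (by rw [norm_zero]; exact hO.R_pos.le))
      (by linarith) (by linarith) (by ring)
  · set v := memory (h.take (P.tLearn S + j))
    have hv : v ∈ stdSimplex ℝ (Fin n) := memory_mem_stdSimplex (by simp; omega)
    have hxv : x ∈ menuHull k (M.score v) := by
      have := hx.2
      simp only [EIRD, Set.mem_iInter] at this
      exact this v hv
    obtain ⟨z, hz, hzx⟩ := mem_menuHull.1 hxv
    set s' := learnedModel A P h v
    set y := ∑ K, z K • menuDist s' K with hy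
    have hymem : y ∈ menuHull k s' := mem_menuHull.2 ⟨z, hz, rfl⟩
    have hyx : ∀ i, |x i - y i| ≤ 2 * n ^ 2 * P.accuracy := fun i => by
      rw [← hzx, hy]
      simp only [Finset.sum_apply, Pi.smul_apply, smul_eq_mul, ← Finset.sum_sub_distrib, ← mul_sub]
      refine (Finset.abs_sum_le_sum_abs _ _).trans ?_
      calc _ ≤ ∑ K, z K * (2 * n ^ 2 * P.accuracy) := by
            refine Finset.sum_le_sum fun K _ => ?_
            rw [abs_mul, abs_of_nonneg (hz.1 K)]
            by_cases hK : K.card = k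
            · exact mul_le_mul_of_nonneg_left ((hO.menuDist_close hlam hM hG hv hK).2.2 i) (hz.1 K)
            · rw [hz.2.1 K hK, zero_mul, zero_mul]
        _ = _ := by rw [← Finset.sum_mul, hz.2.2, one_mul]
    have hacc := hO.acc_pos
    have hl2 : l2dist x y ≤ n * (2 * n ^ 2 * P.accuracy) :=
      l2dist_le_of_abs_sub_le (by positivity) hyx
    have hysum : ∑ i, y i = 1 := by
      rw [hy]
      simp only [Finset.sum_apply, Pi.smul_apply, smul_eq_mul]
      rw [Finset.sum_comm, ← hz.2.2]
      refine Finset.sum_congr rfl fun K _ => ?_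
      rw [← Finset.mul_sum]
      by_cases hK : K.card = k
      · rw [(hO.menuDist_close hlam hM hG hv hK).1, mul_one]
      · rw [hz.2.1 K hK, zero_mul]
    -- The extra factor `1 - θ / 2` pays for the model error: `x` is inducible under the true
    -- scores, its counterpart `y` under the learned ones, and the rescaled difference lies in the
    -- inducible ball because the accuracy is at most a small multiple of `R * θ`.
    set b : Reduced n := ((1 - θ / 2) / (θ / 2)) • (reduce x - reduce y) with hb
    have hbn : ‖b‖ ≤ R := by
      rw [hb, norm_smul, Real.norm_eq_abs, abs_of_pos (by apply div_pos <;> linarith)]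
      have h3 := (norm_reduce_sub_le hn' x y).trans hl2
      calc (1 - θ / 2) / (θ / 2) * ‖reduce x - reduce y‖
          ≤ 1 / (θ / 2) * (n * (2 * n ^ 2 * P.accuracy)) := by gcongr; linarith
        _ = 4 * n ^ 3 * P.accuracy / θ := by field_simp; norm_num
        _ ≤ R := by rw [div_le_iff₀ hθ0]; exact hO.acc_theta
    have e : (1 - θ / 2) • reduce x = (1 - θ / 2) • reduce y + (θ / 2) • b := by
      rw [hb, smul_smul, mul_div_cancel₀ _ (by positivity), smul_sub, add_sub_cancel]
    show lift ((1 - θ / 2) • reduce x) ∈ menuHull k s'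
    rw [e, lift_combo _ _ (by ring), lift_reduce hn' hysum]
    exact convex_menuHull k s' hymem
      (hO.lift_mem_menuHull (hO.menusAtLeast_learned hlam hM hG hv) hbn)
      (by linarith) (by linarith) (by ring)

end OptConditions

lemma norm_le_of_lift_mem {w : Reduced n} (hn : 1 ≤ n) (hw : lift w ∈ stdSimplex ℝ (Fin n)) :
    ‖w‖ ≤ n := by
  have h1 : ∀ j, |w j| ≤ 1 := fun j => by
    have e := lift_apply_of_lt w (i := ⟨j.val, by omega⟩) j.2
    have h0 := hw.1 ⟨j.val, by omega⟩
    have h2 : lift w ⟨j.val, by omega⟩ ≤ 1 := by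
      rw [← hw.2]; exact Finset.single_le_sum (fun i _ => hw.1 i) (Finset.mem_univ _)
    have h3 : (0 : ℝ) ≤ 1 / n := by positivity
    have h4 : (1 : ℝ) / n ≤ 1 := by
      rw [div_le_one (by positivity)]; exact_mod_cast hn
    rw [e] at h0 h2
    exact abs_le.2 ⟨by simp only [Fin.eta] at h0; linarith, by simp only [Fin.eta] at h2; linarith⟩
  have h2 : ‖w‖ ^ 2 ≤ (n : ℝ) ^ 2 := by
    rw [EuclideanSpace.norm_sq_eq]
    calc ∑ j, ‖w j‖ ^ 2 ≤ ∑ _j : Fin (n - 1), (1 : ℝ) := by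
          refine Finset.sum_le_sum fun j _ => ?_
          rw [Real.norm_eq_abs]
          exact pow_le_one₀ (abs_nonneg _) (h1 j)
      _ ≤ (n : ℝ) := by simp
      _ ≤ (n : ℝ) ^ 2 := by
          have : (1 : ℝ) ≤ n := by exact_mod_cast hn
          nlinarith
  exact le_of_sq_le_sq h2 (by positivity)

/-- Regret of online gradient descent along a history. -/
lemma sum_inner_le (N : ℕ) {g xs : ℕ → Reduced n}
    {y : Reduced n} {η Γ : ℝ} (hη : 0 < η) (hg : ∀ s < N, ‖g s‖ ≤ Γ)
    (hstep : ∀ s < N, ‖xs (s + 1) - y‖ ≤ ‖xs s - η • g s - y‖) :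
    ∑ s ∈ Finset.range N, inner ℝ (g s) (xs s - y)
      ≤ ‖xs 0 - y‖ ^ 2 / (2 * η) + N * (η / 2 * Γ ^ 2) := by
  have key : ∀ s < N, inner ℝ (g s) (xs s - y)
      ≤ (‖xs s - y‖ ^ 2 - ‖xs (s + 1) - y‖ ^ 2) / (2 * η) + η / 2 * Γ ^ 2 := by
    intro s hs
    have h1 : ‖xs (s + 1) - y‖ ^ 2 ≤ ‖xs s - η • g s - y‖ ^ 2 := by gcongr; exact hstep s hs
    have h2 : ‖xs s - η • g s - y‖ ^ 2
        = ‖xs s - y‖ ^ 2 - 2 * (η * inner ℝ (g s) (xs s - y)) + η ^ 2 * ‖g s‖ ^ 2 := by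
      rw [show xs s - η • g s - y = (xs s - y) - η • g s by abel, norm_sub_sq_real,
        inner_smul_right, norm_smul, Real.norm_eq_abs, mul_pow, sq_abs, real_inner_comm]
    have h3 : ‖g s‖ ^ 2 ≤ Γ ^ 2 := by gcongr; exact hg s hs
    have h4 : η ^ 2 * ‖g s‖ ^ 2 ≤ η ^ 2 * Γ ^ 2 := by gcongr
    rw [← sub_le_iff_le_add, le_div_iff₀ (by positivity)]
    nlinarith
  calc _ ≤ ∑ s ∈ Finset.range N,
        ((‖xs s - y‖ ^ 2 - ‖xs (s + 1) - y‖ ^ 2) / (2 * η) + η / 2 * Γ ^ 2) :=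
        Finset.sum_le_sum fun s hs => key s (Finset.mem_range.1 hs)
    _ = (‖xs 0 - y‖ ^ 2 - ‖xs N - y‖ ^ 2) / (2 * η) + N * (η / 2 * Γ ^ 2) := by
        rw [Finset.sum_add_distrib, ← Finset.sum_div, Finset.sum_range_sub']
        simp
    _ ≤ _ := by
        gcongr
        linarith [sq_nonneg ‖xs N - y‖]

end Iterates

/-! ### Iterated expectations depending on parameters -/

section Parametric

variable {n : ℕ} {R : ℕ → Fin n → ℝ}

lemma measurable_iterate_stepE {Ω : Type*} [MeasurableSpace Ω] {W : Ω → Transition n}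
    (hW : ∀ h K i, Measurable fun ω => W ω h K i) {F : Ω → List (Obs n) → ℝ}
    (hF : ∀ h, Measurable fun ω => F ω h) : ∀ (m : ℕ) (h : List (Obs n)),
    Measurable fun ω => (stepE (W ω) R)^[m] (F ω) h
  | 0, h => hF h
  | m + 1, h => by
    simp only [Function.iterate_succ_apply', stepE]
    exact Finset.measurable_sum _ fun K _ => Finset.measurable_sum _ fun i _ =>
      (hW h K i).mul (measurable_iterate_stepE hW hF m _)

lemma abs_iterate_le {W : Transition n} (hW : IsTransition W) {f : List (Obs n) → ℝ} {B : ℝ}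
    {m : ℕ} {h : List (Obs n)} (hf : ∀ h', h'.length = h.length + m → |f h'| ≤ B) :
    |(stepE W R)^[m] f h| ≤ B := by
  rw [abs_le]
  constructor
  · rw [← iterate_const (R := R) hW (-B) m h]
    exact iterate_mono hW fun h' hl => (abs_le.1 (hf h' hl)).1
  · rw [← iterate_const (R := R) hW B m h]
    exact iterate_mono hW fun h' hl => (abs_le.1 (hf h' hl)).2

lemma iterate_congr_transition {W W' : Transition n} {tb : ℕ}
    (hWW : ∀ h, h.length < tb → W h = W' h) (f : List (Obs n) → ℝ) :
    ∀ (m : ℕ) (h : List (Obs n)), h.length + m ≤ tb →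
      (stepE W R)^[m] f h = (stepE W' R)^[m] f h
  | 0, _, _ => rfl
  | m + 1, h, hl => by
    simp only [Function.iterate_succ_apply', stepE]
    rw [hWW h (by omega)]
    refine Finset.sum_congr rfl fun K _ => Finset.sum_congr rfl fun i _ => ?_
    rw [iterate_congr_transition hWW f m _ (by rw [length_addRound]; omega)]

/-- The weights do not depend on the integration variable, so the integral passes through the finite
sums down to the last history. -/
lemma integral_iterate_stepE {α : Type*} [MeasurableSpace α] {σ : Measure α} {W : Transition n}
    {F : α → List (Obs n) → ℝ} {t : ℕ}
    (hF : ∀ h, h.length = t → Integrable (fun v => F v h) σ) :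
    ∀ (m : ℕ) (h : List (Obs n)), h.length + m = t →
      Integrable (fun v => (stepE W R)^[m] (F v) h) σ ∧
      ∫ v, (stepE W R)^[m] (F v) h ∂σ = (stepE W R)^[m] (fun h' => ∫ v, F v h' ∂σ) h
  | 0, h, hl => ⟨hF h hl, rfl⟩
  | m + 1, h, hl => by
    have ih := fun K i => integral_iterate_stepE (W := W) hF m (addRound R h K i)
      (by rw [length_addRound]; omega)
    simp only [Function.iterate_succ_apply', stepE]
    have h1 : ∀ K i, Integrable (fun v => W h K i * (stepE W R)^[m] (F v) (addRound R h K i)) σ :=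
      fun K i => (ih K i).1.const_mul _
    refine ⟨integrable_finsetSum _ fun K _ => integrable_finsetSum _ fun i _ => h1 K i, ?_⟩
    rw [integral_finsetSum _ fun K _ => integrable_finsetSum _ fun i _ => h1 K i]
    refine Finset.sum_congr rfl fun K _ => ?_
    rw [integral_finsetSum _ fun i _ => h1 K i]
    refine Finset.sum_congr rfl fun i _ => ?_
    rw [integral_const_mul, (ih K i).2]

lemma iterate_add {W : Transition n} (f g : List (Obs n) → ℝ) (m : ℕ) (h : List (Obs n)) :
    (stepE W R)^[m] (fun h' => f h' + g h') h = (stepE W R)^[m] f h + (stepE W R)^[m] g h := by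
  have := congrFun (iterate_sum (W := W) (R := R) Finset.univ (fun b : Bool => if b then f else g) m)
    h
  simpa using this

lemma iterate_succ_eq {W : Transition n} (hW : IsTransition W) {f g : List (Obs n) → ℝ} {t : ℕ}
    (hfg : ∀ h, h.length = t → stepE W R f h = g h) :
    (stepE W R)^[t + 1] f [] = (stepE W R)^[t] g [] := by
  rw [Function.iterate_succ_apply]
  exact iterate_congr hW fun h hl => hfg h (by simpa using hl)

/-- Conditional expectation of the next reward. -/
noncomputable def condReward (π : Policy n) (M : PreferenceModel n) (R : ℕ → Fin n → ℝ)
    (u : ℕ → Reduced n) (h : List (Obs n)) : ℝ :=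
  ∑ K, π u h K * linearReward (R h.length) (menuDist (M.score (memory h)) K)

lemma condReward_eq_stepE {π : Policy n} {M : PreferenceModel n} {u : ℕ → Reduced n}
    (h : List (Obs n)) : condReward π M R u h
      = ∑ K, ∑ i, transition π M u h K i * R h.length i := by
  simp only [condReward, linearReward, transition, Finset.mul_sum]
  exact Finset.sum_congr rfl fun K _ => Finset.sum_congr rfl fun i _ => by ring

/-- A quantity affine in the observed reward sees only the conditional mean of that reward, which is
how bandit feedback becomes an estimate of the linear reward. -/
lemma stepE_of_affine {π : Policy n} {M : PreferenceModel n} {u : ℕ → Reduced n}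
    (hW : IsTransition (transition π M u)) {f : List (Obs n) → ℝ} {h : List (Obs n)} {a b : ℝ}
    (hf : ∀ K i, f (addRound R h K i) = b * R h.length i + a) :
    stepE (transition π M u) R f h = b * condReward π M R u h + a := by
  have : ∀ K i, transition π M u h K i * f (addRound R h K i)
      = b * (transition π M u h K i * R h.length i) + transition π M u h K i * a := fun K i => by
    rw [hf]; ring
  simp only [stepE, this, Finset.sum_add_distrib, ← Finset.mul_sum, ← Finset.sum_mul,
    hW.sum_eq_one, one_mul, condReward_eq_stepE]

lemma condReward_mem_Icc {π : Policy n} {M : PreferenceModel n} {u : ℕ → Reduced n}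
    (hW : IsTransition (transition π M u)) {h : List (Obs n)}
    (hR : ∀ i, R h.length i ∈ Set.Icc (0 : ℝ) 1) : condReward π M R u h ∈ Set.Icc (0 : ℝ) 1 := by
  rw [condReward_eq_stepE]
  refine ⟨Finset.sum_nonneg fun K _ => Finset.sum_nonneg fun i _ =>
    mul_nonneg (hW.nonneg h K i) (hR i).1, ?_⟩
  rw [← hW.sum_eq_one h]
  exact Finset.sum_le_sum fun K _ => Finset.sum_le_sum fun i _ =>
    mul_le_of_le_one_right (hW.nonneg h K i) (hR i).2

lemma getD_addRound (h : List (Obs n)) (K : Finset (Fin n)) (i : Fin n) :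
    ((addRound R h K i).map Obs.reward).getD h.length 0 = R h.length i := by
  simp [addRound]

lemma linearReward_sum_smul {ι : Type*} (s : Finset ι) (a : Fin n → ℝ) (z : ι → ℝ)
    (p : ι → Fin n → ℝ) :
    linearReward a (∑ K ∈ s, z K • p K) = ∑ K ∈ s, z K * linearReward a (p K) := by
  simp only [linearReward, Finset.sum_apply, Pi.smul_apply, smul_eq_mul, Finset.mul_sum]
  rw [Finset.sum_comm]
  exact Finset.sum_congr rfl fun K _ => Finset.sum_congr rfl fun i _ => by ring

lemma linearReward_smul (a x : Fin n → ℝ) (b : ℝ) :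
    linearReward a (b • x) = b * linearReward a x := by
  simp only [linearReward, Pi.smul_apply, smul_eq_mul, Finset.mul_sum]
  exact Finset.sum_congr rfl fun i _ => by ring

lemma lift_add (x w : Reduced n) : lift (x + w) = lift x + liftLin n w := by
  rw [lift_eq, lift_eq, map_add, add_assoc]

lemma directions_update_self {T t : ℕ} (ht : t < T)
    (ω : Fin T → Metric.sphere (0 : Reduced n) 1) (v : Metric.sphere (0 : Reduced n) 1) :
    directions (Function.update ω ⟨t, ht⟩ v) t = v := by
  simp [directions, ht]

lemma directions_update_of_ne {T t t' : ℕ} (ht : t < T) (hne : t' ≠ t)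
    (ω : Fin T → Metric.sphere (0 : Reduced n) 1) (v : Metric.sphere (0 : Reduced n) 1) :
    directions (Function.update ω ⟨t, ht⟩ v) t' = directions ω t' := by
  unfold directions
  split_ifs with h
  · rw [Function.update_of_ne (by simpa using hne)]
  · rfl

lemma norm_directions {T t : ℕ} (ht : t < T)
    (ω : Fin T → Metric.sphere (0 : Reduced n) 1) : ‖directions ω t‖ = 1 := by
  simp [directions, ht]

end Parametric

/-! ### One round of the optimization phase -/

section Round

variable {n k S : ℕ} {𝓜 : Set (PreferenceModel n)} {A : LocalLearner 𝓜 (uniformVec n) S}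
  {P : Params n k} {c θ R : ℝ} {M : PreferenceModel n} {lam G : ℝ}

/-- Deviation of a choice distribution caused by the error of the learned model. -/
noncomputable def modelError (P : Params n k) : ℝ := n * (2 * n ^ 2 * P.accuracy)

lemma algorithm_eq_sol {h : List (Obs n)} {s : ℕ} (hl : h.length = P.tLearn S + s)
    (u : ℕ → Reduced n) : algorithm A P c u h
      = P.lp.sol (learnedModel A P h (memory h)) (iterate A P c u h s) (P.delta • u h.length) := by
  rw [algorithm, if_neg (by omega), show h.length - P.tLearn S = s by omega]

/-- The one-point estimate of the gain against a comparator. -/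
noncomputable def gainEstimate (A : LocalLearner 𝓜 (uniformVec n) S) (P : Params n k)
    (c : ℝ) (M : PreferenceModel n) (ρ : ℕ → Fin n → ℝ) (y : Reduced n) (u : ℕ → Reduced n)
    (h : List (Obs n)) : ℝ :=
  ((n - 1 : ℕ) : ℝ) / P.delta * ((1 - condReward (algorithm A P c) M ρ u h) *
    inner ℝ (u h.length) (iterate A P c u h (h.length - P.tLearn S) - y))

namespace OptConditions

variable (hO : OptConditions A P c θ R)
include hO

lemma modelError_nonneg : 0 ≤ modelError P := by
  have := hO.acc_pos
  unfold modelError; positivity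

lemma abs_reward_sub_le (hlam : (k : ℝ) ^ 2 / n ≤ lam) (hM : Dispersed lam M)
    {h : List (Obs n)} (hG : GoodModel A P M h) {v : Fin n → ℝ} (hv : v ∈ stdSimplex ℝ (Fin n))
    {K : Finset (Fin n)} (hK : K.card = k) {a : Fin n → ℝ} (hG0 : 0 ≤ G)
    (ha : ∀ x ∈ stdSimplex ℝ (Fin n), ∀ y ∈ stdSimplex ℝ (Fin n),
      |linearReward a x - linearReward a y| ≤ G * l2dist x y) :
    |linearReward a (menuDist (M.score v) K) - linearReward a (menuDist (learnedModel A P h v) K)|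
      ≤ G * modelError P := by
  have hn' : 1 ≤ n := by exact_mod_cast hO.one_le_n
  have hk := hO.two_le
  have := hO.acc_pos
  obtain ⟨h1, -, h3⟩ := hO.menuDist_close hlam hM hG hv hK
  have h4 := (menusAtLeast_of_bounds (by omega) hn' (score_ge_of_dispersed hn' hlam hM v)
    (fun i => (M.score_mem v i).2) K hK).1
  refine (abs_linearReward_le hn' ha (h4.trans h1.symm)).trans ?_
  exact mul_le_mul_of_nonneg_left (l2dist_le_of_abs_sub_le (by positivity) h3) hG0

/-- In a round with a good model the conditional reward is affine in the exploration step, with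
almost the correct value and gradient. -/
lemma exists_affine_reward (hlam : (k : ℝ) ^ 2 / n ≤ lam) (hM : Dispersed lam M)
    {h : List (Obs n)} (hG : GoodModel A P M h) {s : ℕ} (hl : h.length = P.tLearn S + s)
    (u : ℕ → Reduced n) {a : Fin n → ℝ} (hG0 : 0 ≤ G)
    (ha : ∀ x ∈ stdSimplex ℝ (Fin n), ∀ y ∈ stdSimplex ℝ (Fin n),
      |linearReward a x - linearReward a y| ≤ G * l2dist x y) :
    ∃ (a₀ : ℝ) (B : Fin (n - 1) → ℝ),
      (∀ w : Reduced n, ‖w‖ ≤ P.delta →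
        ∑ K, P.lp.sol (learnedModel A P h (memory h)) (iterate A P c u h s) w K *
          linearReward a (menuDist (M.score (memory h)) K) = a₀ + ∑ j, w j * B j) ∧
      (∀ w : Reduced n, ‖w‖ ≤ P.delta →
        linearReward a (lift (iterate A P c u h s + w)) - G * modelError P ≤ a₀ + ∑ j, w j * B j) ∧
      ∀ d : Reduced n, |∑ j, B j * d j - linearReward a (liftLin n d)|
        ≤ n * ‖d‖ * (G * modelError P / R) := by
  have hRp := hO.R_pos
  have hn' : 1 ≤ n := by exact_mod_cast hO.one_le_n
  have hv : memory h ∈ stdSimplex ℝ (Fin n) :=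
    memory_mem_stdSimplex (by have := hO.tLearn_pos; omega)
  have he := hO.modelError_nonneg
  set x := iterate A P c u h s
  set ŝ := learnedModel A P h (memory h)
  obtain ⟨z, ζ, hζ, hζ0, hsol⟩ := hO.lp ŝ
    (hO.crossInHull (hO.menusAtLeast_learned hlam hM hG hv)) x
    (hO.iterate_scaled_mem hlam hM hG hl u).2
  have hδ : P.delta ≤ θ * P.r := by rw [← hO.theta_eq]; linarith [hO.eps_pos]
  set cK := fun K => linearReward a (menuDist (M.score (memory h)) K) with hcK
  set cH := fun K => linearReward a (menuDist ŝ K) with hcH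
  have hcc : ∀ K : Finset (Fin n), K.card = k → |cK K - cH K| ≤ G * modelError P :=
    fun K hK => hO.abs_reward_sub_le hlam hM hG hv hK hG0 ha
  have hH : ∀ w : Reduced n, ‖w‖ ≤ θ * P.r → ∑ K, P.lp.sol ŝ x w K * cH K
      = linearReward a (lift (x + w)) := fun w hw => by
    rw [← (hsol w hw).2, linearReward_sum_smul]
  have hexp : ∀ (q : Finset (Fin n) → ℝ) (w : Reduced n), ‖w‖ ≤ θ * P.r →
      ∑ K, P.lp.sol ŝ x w K * q K = (∑ K, z K * q K) + ∑ j, w j * ∑ K, ζ j K * q K :=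
    fun q w hw => by
      simp only [(hsol w hw).1, add_mul, Finset.sum_add_distrib, Finset.sum_mul, Finset.mul_sum]
      congr 1
      rw [Finset.sum_comm]
      exact Finset.sum_congr rfl fun j _ => Finset.sum_congr rfl fun K _ => by ring
  -- The solver's affine weights are paired with the true menu rewards `cK` in place of the learned
  -- ones `cH`. The result is still affine in `w`, so the model error perturbs value and slopes
  -- separately, without a division by `δ`.
  refine ⟨∑ K, z K * cK K, fun j => ∑ K, ζ j K * cK K, fun w hw => hexp cK w (hw.trans hδ),
    fun w hw => ?_, fun d => ?_⟩
  · rw [← hexp cK w (hw.trans hδ), ← hH w (hw.trans hδ)]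
    have hz := P.lp.isMenuDistribution ŝ x w
    calc ∑ K, P.lp.sol ŝ x w K * cH K - G * modelError P
        = ∑ K, P.lp.sol ŝ x w K * (cH K - G * modelError P) := by
          simp only [mul_sub, Finset.sum_sub_distrib, ← Finset.sum_mul, hz.2.2, one_mul]
      _ ≤ _ := by
          refine Finset.sum_le_sum fun K _ => ?_
          by_cases hK : K.card = k
          · refine mul_le_mul_of_nonneg_left ?_ (hz.1 K)
            linarith [(abs_le.1 (hcc K hK)).1]
          · rw [hz.2.1 K hK, zero_mul, zero_mul]
  · have hlin : ∑ j, d j * ∑ K, ζ j K * cH K = linearReward a (liftLin n d) := by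
      have hr := hO.r_pos
      have hθ := hO.theta_pos
      -- Small enough for `τ • d` to be in the range where the solver is affine. Comparing its
      -- values at `τ • d` and `0` identifies the slopes for the learned rewards.
      set τ := θ * P.r / (‖d‖ + 1) with hτ
      have hτ0 : 0 < τ := by positivity
      have hτd : ‖τ • d‖ ≤ θ * P.r := by
        rw [norm_smul, Real.norm_eq_abs, abs_of_pos hτ0, hτ, div_mul_eq_mul_div, div_le_iff₀
          (by positivity)]
        exact mul_le_mul_of_nonneg_left (by linarith) (by positivity)
      have h1 := hexp cH _ hτd
      have h2 := hexp cH 0 (by rw [norm_zero]; positivity)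
      rw [hH _ hτd] at h1
      rw [hH 0 (by rw [norm_zero]; positivity)] at h2
      have h3 : linearReward a (lift (x + τ • d)) - linearReward a (lift (x + 0))
          = τ * linearReward a (liftLin n d) := by
        rw [linearReward_sub, lift_add, lift_add, map_zero, add_zero, add_sub_cancel_left, map_smul,
          linearReward_smul]
      have h4 : ∑ j, (τ • d) j * ∑ K, ζ j K * cH K = τ * ∑ j, d j * ∑ K, ζ j K * cH K := by
        rw [Finset.mul_sum]
        exact Finset.sum_congr rfl fun j _ => by rw [PiLp.smul_apply, smul_eq_mul, mul_assoc]
      have h5 : ∑ j, (0 : Reduced n) j * ∑ K, ζ j K * cH K = 0 := by simp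
      rw [h4] at h1
      rw [h5] at h2
      exact mul_left_cancel₀ hτ0.ne' (by linarith)
    -- Here the `ℓ¹`-bound on the slopes is used, as well as that they vanish on sets which are not
    -- menus.
    have hB : ∀ j, |∑ K, ζ j K * cK K - ∑ K, ζ j K * cH K| ≤ G * modelError P / R := fun j => by
      rw [← Finset.sum_sub_distrib]
      refine (Finset.abs_sum_le_sum_abs _ _).trans ?_
      calc _ ≤ ∑ K, |ζ j K| * (G * modelError P) := by
            refine Finset.sum_le_sum fun K _ => ?_
            rw [← mul_sub, abs_mul]
            by_cases hK : K.card = k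
            · exact mul_le_mul_of_nonneg_left (hcc K hK) (abs_nonneg _)
            · rw [hζ0 j K hK, abs_zero, zero_mul, zero_mul]
        _ ≤ 1 / R * (G * modelError P) := by
            rw [← Finset.sum_mul]
            exact mul_le_mul_of_nonneg_right (hζ j) (by positivity)
        _ = _ := by ring
    rw [← hlin, ← Finset.sum_sub_distrib]
    refine (Finset.abs_sum_le_sum_abs _ _).trans ?_
    calc _ ≤ ∑ j, |d j| * (G * modelError P / R) := by
          refine Finset.sum_le_sum fun j _ => ?_
          rw [show (∑ K, ζ j K * cK K) * d j - d j * ∑ K, ζ j K * cH K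
            = d j * (∑ K, ζ j K * cK K - ∑ K, ζ j K * cH K) by ring, abs_mul]
          exact mul_le_mul_of_nonneg_left (hB j) (abs_nonneg _)
      _ ≤ _ := by
          rw [← Finset.sum_mul]
          refine mul_le_mul_of_nonneg_right ((abs_sum_le_norm d).trans ?_) (by positivity)
          refine mul_le_mul_of_nonneg_right ?_ (norm_nonneg d)
          exact_mod_cast Nat.sub_le n 1

lemma norm_iterate_le (hlam : (k : ℝ) ^ 2 / n ≤ lam) (hM : Dispersed lam M)
    {h : List (Obs n)} (hG : GoodModel A P M h) {s : ℕ} (hl : h.length = P.tLearn S + s)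
    (u : ℕ → Reduced n) : ‖iterate A P c u h s‖ ≤ n := by
  have hθ0 := hO.theta_pos
  have hθ1 := hO.theta_lt
  have hn' : 1 ≤ n := by exact_mod_cast hO.one_le_n
  have h1 := norm_le_of_lift_mem hn' (hO.iterate_scaled_mem hlam hM hG hl u).1.1
  rw [norm_smul, norm_inv, Real.norm_eq_abs, abs_of_pos (by linarith)] at h1
  rw [inv_mul_le_iff₀ (by linarith)] at h1
  exact h1.trans (mul_le_of_le_one_left (by positivity) (by linarith))

/-- The target `x + δ u` is induced up to the model error, and the exploration step moves the lifted
point by at most `n * δ`. -/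
lemma condReward_ge (hlam : (k : ℝ) ^ 2 / n ≤ lam) (hM : Dispersed lam M)
    {h : List (Obs n)} (hG : GoodModel A P M h) {s : ℕ} (hl : h.length = P.tLearn S + s)
    {u : ℕ → Reduced n} (hu : ‖u h.length‖ ≤ 1) {ρ : ℕ → Fin n → ℝ} (hG0 : 0 ≤ G)
    (ha : ∀ x ∈ stdSimplex ℝ (Fin n), ∀ y ∈ stdSimplex ℝ (Fin n),
      |linearReward (ρ h.length) x - linearReward (ρ h.length) y| ≤ G * l2dist x y) :
    linearReward (ρ h.length) (lift (iterate A P c u h s)) - G * (modelError P + n * P.delta)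
      ≤ condReward (algorithm A P c) M ρ u h := by
  have hδ := hO.delta_pos
  have hn' : 1 ≤ n := by exact_mod_cast hO.one_le_n
  obtain ⟨a₀, B, h1, h2, -⟩ := hO.exists_affine_reward hlam hM hG hl u hG0 ha
  have hw : ‖P.delta • u h.length‖ ≤ P.delta := by
    rw [norm_smul, Real.norm_eq_abs, abs_of_pos hδ]
    exact mul_le_of_le_one_right hδ.le hu
  rw [condReward, algorithm_eq_sol hl, h1 _ hw]
  refine le_trans ?_ (h2 _ hw)
  have h3 := abs_linearReward_le hn' ha ((sum_lift hn' (iterate A P c u h s)).trans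
    (sum_lift hn' (iterate A P c u h s + P.delta • u h.length)).symm)
  have h4 := l2dist_lift_le hn' (iterate A P c u h s) (iterate A P c u h s + P.delta • u h.length)
  rw [sub_add_cancel_left, norm_neg] at h4
  have h5 : l2dist (lift (iterate A P c u h s)) (lift (iterate A P c u h s + P.delta • u h.length))
      ≤ n * P.delta := h4.trans (mul_le_mul_of_nonneg_left hw (by positivity))
  have h6 := (abs_le.1 h3).2
  have h7 := mul_le_mul_of_nonneg_left h5 hG0
  linarith

/-- For a fixed history the iterate does not depend on the current direction and the reward is
affine in it, so the sphere moments return the pairing of the gradient with `y - x`. The factors `(n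
- 1) / δ` and `δ / (n - 1)` cancel; only the slope error over a distance of at most `2 n` remains.
-/
lemma le_integral_gainEstimate (hlam : (k : ℝ) ^ 2 / n ≤ lam) (hM : Dispersed lam M)
    {h : List (Obs n)} (hG : GoodModel A P M h) {s : ℕ} (hl : h.length = P.tLearn S + s)
    {T : ℕ} (hT : h.length < T) (ω : Fin T → Metric.sphere (0 : Reduced n) 1)
    {ρ : ℕ → Fin n → ℝ} (hG0 : 0 ≤ G)
    (ha : ∀ x ∈ stdSimplex ℝ (Fin n), ∀ y ∈ stdSimplex ℝ (Fin n),
      |linearReward (ρ h.length) x - linearReward (ρ h.length) y| ≤ G * l2dist x y)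
    {y : Reduced n} (hy : ‖y‖ ≤ n) :
    linearReward (ρ h.length) (lift y)
        - linearReward (ρ h.length) (lift (iterate A P c (directions ω) h s))
        - 2 * n ^ 2 * (G * modelError P / R)
      ≤ ∫ v, gainEstimate A P c M ρ y (directions (Function.update ω ⟨h.length, hT⟩ v)) h
          ∂(sphereUniform n) := by
  have hδ := hO.delta_pos
  have hRp := hO.R_pos
  have he := hO.modelError_nonneg
  have hn2 : 2 ≤ n := hO.two_le.trans hO.le_n
  have hn1 : (0 : ℝ) < ((n - 1 : ℕ) : ℝ) := by exact_mod_cast (by omega : 0 < n - 1)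
  have hit : ∀ v, iterate A P c (directions (Function.update ω ⟨h.length, hT⟩ v)) h s
      = iterate A P c (directions ω) h s := fun v =>
    iterate_congr_directions fun t ht => directions_update_of_ne hT (by omega) ω v
  obtain ⟨a₀, B, h1, -, h3⟩ := hO.exists_affine_reward hlam hM hG hl (directions ω) hG0 ha
  set x := iterate A P c (directions ω) h s
  have hx : ‖x‖ ≤ n := hO.norm_iterate_le hlam hM hG hl _
  have hv : ∀ v : Metric.sphere (0 : Reduced n) 1,
      gainEstimate A P c M ρ y (directions (Function.update ω ⟨h.length, hT⟩ v)) h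
      = ((n - 1 : ℕ) : ℝ) / P.delta * (((1 - a₀) + ∑ j, (v : Reduced n) j * (-P.delta * B j)) *
        ∑ l, (v : Reduced n) l * (x - y) l) := fun v => by
    have hnorm : ‖P.delta • (v : Reduced n)‖ ≤ P.delta := by
      rw [norm_smul, Real.norm_eq_abs, abs_of_pos hδ]; simp
    rw [gainEstimate, condReward, algorithm_eq_sol hl, show h.length - P.tLearn S = s by omega,
      hit v, directions_update_self hT, h1 _ hnorm, PiLp.inner_apply]
    congr 2
    · rw [← sub_sub, sub_eq_add_neg (1 - a₀), ← Finset.sum_neg_distrib]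
      congr 1
      exact Finset.sum_congr rfl fun j _ => by rw [PiLp.smul_apply, smul_eq_mul]; ring
    · exact Finset.sum_congr rfl fun j _ => by simp [mul_comm]
  simp only [hv]
  rw [integral_const_mul, integral_sphere_affine_mul_linear hn2]
  have e : ((n - 1 : ℕ) : ℝ) / P.delta * ((∑ j, -P.delta * B j * (x - y) j) / ((n - 1 : ℕ) : ℝ))
      = ∑ j, B j * (y - x) j := by
    rw [div_mul_div_comm, mul_comm P.delta, mul_div_mul_left _ _ hn1.ne', Finset.sum_div]
    refine Finset.sum_congr rfl fun j _ => ?_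
    rw [PiLp.sub_apply, PiLp.sub_apply]
    field_simp
    ring
  rw [e]
  have h4 := (abs_le.1 (h3 (y - x))).1
  have h5 : linearReward (ρ h.length) (liftLin n (y - x))
      = linearReward (ρ h.length) (lift y) - linearReward (ρ h.length) (lift x) := by
    rw [linearReward_sub, lift_eq y, lift_eq x, map_sub, add_sub_add_left_eq_sub]
  have h6 : ‖y - x‖ ≤ 2 * n := (norm_sub_le _ _).trans (by linarith)
  have h7 : (n : ℝ) * ‖y - x‖ * (G * modelError P / R) ≤ 2 * n ^ 2 * (G * modelError P / R) := by
    refine mul_le_mul_of_nonneg_right ?_ (by positivity)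
    nlinarith [Nat.cast_nonneg (α := ℝ) n]
  linarith

end OptConditions

end Round

/-! ### Regret of the optimization phase -/

lemma integral_le_of_forall_update {α : Type*} [MeasurableSpace α] {T : ℕ} (σ : Measure α)
    [IsProbabilityMeasure σ] (t : Fin T) {F H : (Fin T → α) → ℝ} (hF : Measurable F) {B : ℝ}
    (hB : ∀ ω, |F ω| ≤ B) (hH : Integrable H (Measure.pi fun _ => σ))
    (hle : ∀ ω, H ω ≤ ∫ v, F (Function.update ω t v) ∂σ) :
    ∫ ω, H ω ∂(Measure.pi fun _ => σ) ≤ ∫ ω, F ω ∂(Measure.pi fun _ => σ) := by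
  rw [integral_pi_update σ t hF hB]
  have hi : Integrable (fun p : (Fin T → α) × α => F (Function.update p.1 t p.2))
      ((Measure.pi fun _ => σ).prod σ) :=
    Integrable.of_bound (hF.comp (measurePreserving_update σ t).measurable).aestronglyMeasurable
      B (ae_of_all _ fun p => hB _)
  exact integral_mono hH hi.integral_prod_left hle

lemma l2dist_le_two {n : ℕ} {x y : Fin n → ℝ} (hx : x ∈ stdSimplex ℝ (Fin n))
    (hy : y ∈ stdSimplex ℝ (Fin n)) : l2dist x y ≤ 2 := by
  have h1 : ∀ z ∈ stdSimplex ℝ (Fin n), ∀ i, z i ≤ 1 := fun z hz i => by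
    rw [← hz.2]; exact Finset.single_le_sum (fun j _ => hz.1 j) (Finset.mem_univ i)
  refine (Real.sqrt_le_sqrt (y := 2 ^ 2) ?_).trans (Real.sqrt_sq (by norm_num)).le
  calc ∑ i, (x i - y i) ^ 2 ≤ ∑ i, (x i + y i) := by
        refine Finset.sum_le_sum fun i _ => ?_
        have a1 := hx.1 i; have a2 := hy.1 i; have a3 := h1 x hx i; have a4 := h1 y hy i
        nlinarith [mul_nonneg a1 a2]
    _ ≤ 2 ^ 2 := by rw [Finset.sum_add_distrib, hx.2, hy.2]; norm_num

section Regret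

variable {n k S : ℕ} {𝓜 : Set (PreferenceModel n)} {A : LocalLearner 𝓜 (uniformVec n) S}
  {P : Params n k} {c θ R : ℝ} {M : PreferenceModel n} {lam G : ℝ} {ρ : ℕ → Fin n → ℝ}

open Classical in
/-- Indicator of a good model. -/
noncomputable def goodInd (A : LocalLearner 𝓜 (uniformVec n) S) (P : Params n k)
    (M : PreferenceModel n) (h : List (Obs n)) : ℝ := if GoodModel A P M h then 1 else 0

lemma goodInd_of_prefix (hk : 2 ≤ k) (hkn : k ≤ n) {h h' : List (Obs n)} (hp : h <+: h')
    (hl : P.tLearn S ≤ h.length) : goodInd A P M h' = goodInd A P M h := by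
  have := goodModel_iff_of_prefix (A := A) (M := M) hk hkn hp hl
  by_cases hG : GoodModel A P M h
  · rw [goodInd, goodInd, if_pos hG, if_pos (this.2 hG)]
  · rw [goodInd, goodInd, if_neg hG, if_neg (mt this.1 hG)]

lemma isTransition_algorithm (hk : 2 ≤ k) (hkn : k ≤ n) (hlam : (k : ℝ) ^ 2 / n ≤ lam)
    (hM : Dispersed lam M) (u : ℕ → Reduced n) :
    IsTransition (transition (algorithm A P c) M u) :=
  isTransition_transition (by omega) (isMenuDistribution_algorithm hk hkn u) fun v i =>
    lt_of_lt_of_le (div_pos (pow_pos (by exact_mod_cast (by omega : 0 < k)) 2)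
      (by exact_mod_cast (by omega : 0 < n))) (score_ge_of_dispersed (by omega) hlam hM v i)

lemma measurable_transition_algorithm {T : ℕ} (h : List (Obs n)) (K : Finset (Fin n)) (i : Fin n) :
    Measurable fun ω : Fin T → Metric.sphere (0 : Reduced n) 1 =>
      transition (algorithm A P c) M (directions ω) h K i :=
  (measurable_algorithm h K).mul_const _

/-- The gain estimate computed from the rewards observed along a complete history. -/
noncomputable def observedGain (A : LocalLearner 𝓜 (uniformVec n) S) (P : Params n k) (c : ℝ)
    (y : Reduced n) (u : ℕ → Reduced n) (s : ℕ) (h : List (Obs n)) : ℝ :=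
  inner ℝ ((((n - 1 : ℕ) : ℝ) / P.delta *
      (1 - (h.map Obs.reward).getD (P.tLearn S + s) 0)) • u (P.tLearn S + s))
    (iterate A P c u h s - y)

/-- Gradient descent runs on observed rewards along complete histories, while the gradient analysis
uses conditional rewards at round `s`. The two agree in mean: the observed gain is affine in the
reward of its round, and everything else is fixed by the past. -/
lemma iterate_goodInd_observedGain (hk : 2 ≤ k) (hkn : k ≤ n) {u : ℕ → Reduced n}
    (hW : IsTransition (transition (algorithm A P c) M u)) {T s : ℕ} (hs : P.tLearn S + s < T)
    (y : Reduced n) :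
    (stepE (transition (algorithm A P c) M u) ρ)^[T]
        (fun h => goodInd A P M h * observedGain A P c y u s h) []
      = (stepE (transition (algorithm A P c) M u) ρ)^[P.tLearn S + s]
        (fun h => goodInd A P M h * gainEstimate A P c M ρ y u h) [] := by
  set f : List (Obs n) → ℝ := fun h => goodInd A P M h * observedGain A P c y u s h with hf
  have h1 : (stepE (transition (algorithm A P c) M u) ρ)^[T] f []
      = (stepE (transition (algorithm A P c) M u) ρ)^[T]
        (fun h => f (h.take (P.tLearn S + s + 1))) [] := by
    refine iterate_congr hW fun h hl => ?_
    rw [List.length_nil, zero_add] at hl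
    have hp := List.take_prefix (P.tLearn S + s + 1) h
    have hlt : (h.take (P.tLearn S + s + 1)).length = P.tLearn S + s + 1 := by
      rw [List.length_take]; omega
    simp only [hf, observedGain]
    rw [goodInd_of_prefix hk hkn hp (by omega), iterate_of_prefix hk hkn hp (by omega)]
    congr 5
    rw [List.map_take, List.getD_eq_getElem?_getD, List.getD_eq_getElem?_getD,
      List.getElem?_take_of_lt (by omega)]
  rw [h1, iterate_take hW f (by omega)]
  refine iterate_succ_eq hW fun h hl => ?_
  set b := goodInd A P M h * (((n - 1 : ℕ) : ℝ) / P.delta *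
    inner ℝ (u (P.tLearn S + s)) (iterate A P c u h s - y)) with hb
  rw [stepE_of_affine hW (a := b) (b := -b)]
  · rw [hb, gainEstimate, hl, Nat.add_sub_cancel_left]; ring
  · intro K i
    have hp : h <+: addRound ρ h K i := List.prefix_append _ _
    have hget := getD_addRound (R := ρ) h K i
    rw [hl] at hget
    simp only [hf, observedGain]
    rw [goodInd_of_prefix hk hkn hp (by omega), iterate_of_prefix hk hkn hp (by omega), hget,
      inner_smul_left, hl, hb]
    simp only [conj_trivial]
    ring

/-- The gain of a comparator over the current iterate. -/
noncomputable def iterateGap (A : LocalLearner 𝓜 (uniformVec n) S) (P : Params n k)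
    (c : ℝ) (ρ : ℕ → Fin n → ℝ) (y : Reduced n) (u : ℕ → Reduced n) (h : List (Obs n)) : ℝ :=
  linearReward (ρ h.length) (lift y)
    - linearReward (ρ h.length) (lift (iterate A P c u h (h.length - P.tLearn S)))

namespace OptConditions

variable (hO : OptConditions A P c θ R)
include hO

/-- The descent bound holds along every history with a good model, since the comparator then belongs
to all decision sets; the other histories contribute zero. Estimates have norm at most `n / δ`, and
the start `0` is within `n` of the comparator. -/
lemma sum_gainEstimate_le (hlam : (k : ℝ) ^ 2 / n ≤ lam) (hM : Dispersed lam M)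
    (hρ : ∀ t i, ρ t i ∈ Set.Icc (0 : ℝ) 1) (heta : 0 < P.eta)
    {N : ℕ} (ω : Fin (P.tLearn S + N) → Metric.sphere (0 : Reduced n) 1)
    {x : Fin n → ℝ} (hx : x ∈ entropySet n c ∩ EIRD k M.score) {y : Reduced n}
    (hy : y = ((1 - θ) * (1 - θ / 2)) • reduce x) (hyn : ‖y‖ ≤ n) :
    ∑ s ∈ Finset.range N,
      (stepE (transition (algorithm A P c) M (directions ω)) ρ)^[P.tLearn S + s]
        (fun h => goodInd A P M h * gainEstimate A P c M ρ y (directions ω) h) []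
      ≤ n ^ 2 / (2 * P.eta) + N * (P.eta / 2 * (n / P.delta) ^ 2) := by
  have hk := hO.two_le
  have hkn := hO.le_n
  have hδ := hO.delta_pos
  have hW := isTransition_algorithm (A := A) (P := P) (c := c) hk hkn hlam hM (directions ω)
  have h1 : ∀ s ∈ Finset.range N,
      (stepE (transition (algorithm A P c) M (directions ω)) ρ)^[P.tLearn S + s]
        (fun h => goodInd A P M h * gainEstimate A P c M ρ y (directions ω) h) []
      = (stepE (transition (algorithm A P c) M (directions ω)) ρ)^[P.tLearn S + N]
        (fun h => goodInd A P M h * observedGain A P c y (directions ω) s h) [] := fun s hs =>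
    (iterate_goodInd_observedGain hk hkn hW (by rw [Finset.mem_range] at hs; omega) y).symm
  rw [Finset.sum_congr rfl h1]
  have h2 := congrFun (iterate_sum (W := transition (algorithm A P c) M (directions ω)) (R := ρ)
    (Finset.range N) (fun s h => goodInd A P M h * observedGain A P c y (directions ω) s h)
    (P.tLearn S + N)) []
  rw [← h2, ← iterate_const (R := ρ) hW
    (n ^ 2 / (2 * P.eta) + N * (P.eta / 2 * (n / P.delta) ^ 2)) (P.tLearn S + N) []]
  refine iterate_mono_of_inv (tb := P.tLearn S + N)
    (Inv := fun h => ∀ o ∈ h, o.reward ∈ Set.Icc (0 : ℝ) 1) hW (fun h hI _ K i _ o ho => ?_) _ _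
    (by simp) (by simp) fun h hI hl => ?_
  · rcases List.mem_append.1 ho with ho | ho
    · exact hI o ho
    · rw [List.mem_singleton.1 ho]; exact hρ _ _
  rw [List.length_nil, zero_add] at hl
  rw [← Finset.mul_sum]
  by_cases hG : GoodModel A P M h
  · rw [goodInd, if_pos hG, one_mul]
    refine (sum_inner_le N (η := P.eta) (Γ := n / P.delta) (xs := iterate A P c (directions ω) h)
      heta (fun s hs => ?_) fun s hs => ?_).trans ?_
    · have hr : (h.map Obs.reward).getD (P.tLearn S + s) 0 ∈ Set.Icc (0 : ℝ) 1 := by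
        rw [List.getD_eq_getElem _ _ (by simp; omega), List.getElem_map]
        exact hI _ (List.getElem_mem _)
      have hn1 : ((n - 1 : ℕ) : ℝ) ≤ n := by exact_mod_cast Nat.sub_le n 1
      rw [norm_smul, norm_directions (by omega), mul_one, norm_mul, Real.norm_eq_abs,
        Real.norm_eq_abs, abs_of_nonneg (by positivity), abs_of_nonneg (by linarith [hr.2])]
      refine (mul_le_of_le_one_right (by positivity) (by linarith [hr.1])).trans ?_
      gcongr
    · rw [iterate]
      refine norm_proj_sub_le (isClosed_contracted (isClosed_decisionSet h _))
        (convex_contracted (convex_decisionSet h _)) _ ?_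
      rw [hy]
      exact hO.comparator_mem hlam hM hG (by omega) hx _
    · rw [iterate, zero_sub, norm_neg]
      gcongr
  · rw [goodInd, if_neg hG, zero_mul]
    positivity

lemma norm_comparator_le {x : Fin n → ℝ} (hx : x ∈ stdSimplex ℝ (Fin n)) :
    ‖((1 - θ) * (1 - θ / 2)) • reduce x‖ ≤ n := by
  have hθ0 := hO.theta_pos
  have hθ1 := hO.theta_lt
  have hn' : 1 ≤ n := by exact_mod_cast hO.one_le_n
  have h1 := norm_le_of_lift_mem (w := reduce x) hn' (by rwa [lift_reduce hn' hx.2])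
  rw [norm_smul, Real.norm_eq_abs, abs_of_nonneg (by nlinarith)]
  exact (mul_le_of_le_one_left (norm_nonneg _) (by nlinarith)).trans h1

lemma linearReward_le_comparator {x a : Fin n → ℝ} (hx : x ∈ stdSimplex ℝ (Fin n)) (hG0 : 0 ≤ G)
    (ha : ∀ x ∈ stdSimplex ℝ (Fin n), ∀ y ∈ stdSimplex ℝ (Fin n),
      |linearReward a x - linearReward a y| ≤ G * l2dist x y) :
    linearReward a x ≤ linearReward a (lift (((1 - θ) * (1 - θ / 2)) • reduce x))
      + 3 * θ * G := by
  have hθ0 := hO.theta_pos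
  have hθ1 := hO.theta_lt
  have hn' : 1 ≤ n := by exact_mod_cast hO.one_le_n
  set κ := (1 - θ) * (1 - θ / 2) with hκ
  have e : κ • reduce x = κ • reduce x + (1 - κ) • (0 : Reduced n) := by simp
  have hu := uniformVec_mem hn'
  have e2 : linearReward a (lift (κ • reduce x))
      = κ * linearReward a x + (1 - κ) * linearReward a (uniformVec n) := by
    rw [e, lift_combo _ _ (by ring), lift_reduce hn' hx.2, lift_zero]
    simp only [linearReward, Pi.add_apply, Pi.smul_apply, smul_eq_mul, mul_add,
      Finset.sum_add_distrib, Finset.mul_sum]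
    congr 1 <;> exact Finset.sum_congr rfl fun i _ => by ring
  have h1 := (abs_le.1 (ha x hx _ hu)).2
  have h2 := mul_le_mul_of_nonneg_left (l2dist_le_two hx hu) hG0
  have h3 : 0 ≤ 1 - κ := by rw [hκ]; nlinarith
  have h4 : 1 - κ ≤ 3 / 2 * θ := by rw [hκ]; nlinarith [sq_nonneg θ]
  rw [e2]
  have h5 : (1 - κ) * (linearReward a x - linearReward a (uniformVec n)) ≤ 3 / 2 * θ * (G * 2) :=
    (mul_le_mul_of_nonneg_left (h1.trans h2) h3).trans
      (mul_le_mul_of_nonneg_right h4 (by positivity))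
  linarith

/-- The direction of the round is resampled. The law of the earlier history ignores it, so the
integral over it passes inside the iterates, where `le_integral_gainEstimate` applies history by
history. -/
lemma integral_iterateGap_le (hlam : (k : ℝ) ^ 2 / n ≤ lam) (hM : Dispersed lam M)
    (hρ : ∀ t i, ρ t i ∈ Set.Icc (0 : ℝ) 1) {T s : ℕ} (hs : P.tLearn S + s < T) (hG0 : 0 ≤ G)
    (ha : ∀ t < T, ∀ x ∈ stdSimplex ℝ (Fin n), ∀ y ∈ stdSimplex ℝ (Fin n),
      |linearReward (ρ t) x - linearReward (ρ t) y| ≤ G * l2dist x y)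
    {y : Reduced n} (hy : ‖y‖ ≤ n) :
    Integrable (fun ω : Fin T → Metric.sphere (0 : Reduced n) 1 =>
        (stepE (transition (algorithm A P c) M (directions ω)) ρ)^[P.tLearn S + s]
        (fun h => goodInd A P M h * (iterateGap A P c ρ y (directions ω) h
          - 2 * n ^ 2 * (G * modelError P / R))) []) (Measure.pi fun _ => sphereUniform n) ∧
    Integrable (fun ω : Fin T → Metric.sphere (0 : Reduced n) 1 =>
        (stepE (transition (algorithm A P c) M (directions ω)) ρ)^[P.tLearn S + s]
        (fun h => goodInd A P M h * gainEstimate A P c M ρ y (directions ω) h) [])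
        (Measure.pi fun _ => sphereUniform n) ∧
    ∫ ω : Fin T → Metric.sphere (0 : Reduced n) 1,
        (stepE (transition (algorithm A P c) M (directions ω)) ρ)^[P.tLearn S + s]
        (fun h => goodInd A P M h * (iterateGap A P c ρ y (directions ω) h
          - 2 * n ^ 2 * (G * modelError P / R))) [] ∂(Measure.pi fun _ => sphereUniform n)
    ≤ ∫ ω : Fin T → Metric.sphere (0 : Reduced n) 1,
        (stepE (transition (algorithm A P c) M (directions ω)) ρ)^[P.tLearn S + s]
        (fun h => goodInd A P M h * gainEstimate A P c M ρ y (directions ω) h) []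
        ∂(Measure.pi fun _ => sphereUniform n) := by
  have hk := hO.two_le
  have hkn := hO.le_n
  have hδ := hO.delta_pos
  have hRp := hO.R_pos
  have he := hO.modelError_nonneg
  have hn2 : 2 ≤ n := hk.trans hkn
  have hprob := isProbabilityMeasure_sphereUniform hn2
  have hW := fun u => isTransition_algorithm (A := A) (P := P) (c := c) hk hkn hlam hM u
  have hmW := fun h K i => measurable_transition_algorithm (A := A) (P := P) (c := c) (M := M)
    (T := T) h K i
  set b := 2 * (n : ℝ) ^ 2 * (G * modelError P / R) with hb
  have hb0 : 0 ≤ b := by positivity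
  have hmI : ∀ h : List (Obs n), Measurable fun ω : Fin T → Metric.sphere (0 : Reduced n) 1 =>
      iterate A P c (directions ω) h (h.length - P.tLearn S) := fun h => measurable_iterate h _
  have hmF : ∀ h : List (Obs n), Measurable fun ω : Fin T → Metric.sphere (0 : Reduced n) 1 =>
      goodInd A P M h * gainEstimate A P c M ρ y (directions ω) h := fun h => by
    refine Measurable.const_mul (Measurable.const_mul (Measurable.mul ?_ ?_) _) _
    · refine measurable_const.sub (Finset.measurable_sum _ fun K _ => ?_)
      exact (measurable_algorithm h K).mul_const _
    · exact (measurable_directions _).inner ((hmI h).sub_const y)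
  have hmH : ∀ h : List (Obs n), Measurable fun ω : Fin T → Metric.sphere (0 : Reduced n) 1 =>
      goodInd A P M h * (iterateGap A P c ρ y (directions ω) h - b) := fun h => by
    refine Measurable.const_mul (Measurable.sub_const (measurable_const.sub ?_) _) _
    refine Finset.measurable_sum _ fun i _ => Measurable.const_mul ?_ _
    exact (measurable_pi_apply i).comp (continuous_lift.measurable.comp (hmI h))
  have hFb : ∀ (ω : Fin T → Metric.sphere (0 : Reduced n) 1) (h : List (Obs n)),
      h.length = P.tLearn S + s →
      |goodInd A P M h * gainEstimate A P c M ρ y (directions ω) h|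
        ≤ ((n - 1 : ℕ) : ℝ) / P.delta * (2 * n) := fun ω h hl => by
    by_cases hG : GoodModel A P M h
    · have h1 := condReward_mem_Icc (hW (directions ω)) (h := h) (hρ h.length)
      have h2 := hO.norm_iterate_le hlam hM hG hl (directions ω)
      rw [goodInd, if_pos hG, one_mul, gainEstimate, abs_mul, abs_of_nonneg (by positivity), abs_mul,
        abs_of_nonneg (by linarith [h1.2])]
      refine mul_le_mul_of_nonneg_left ?_ (by positivity)
      refine (mul_le_of_le_one_left (abs_nonneg _) (by linarith [h1.1])).trans ?_
      refine (abs_real_inner_le_norm _ _).trans ?_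
      rw [norm_directions (by omega), one_mul, hl, Nat.add_sub_cancel_left]
      exact (norm_sub_le _ _).trans (by linarith)
    · rw [goodInd, if_neg hG, zero_mul, abs_zero]; positivity
  have hHb : ∀ (ω : Fin T → Metric.sphere (0 : Reduced n) 1) (h : List (Obs n)),
      h.length = P.tLearn S + s →
      |goodInd A P M h * (iterateGap A P c ρ y (directions ω) h - b)|
        ≤ G * (n * (2 * n)) + b := fun ω h hl => by
    by_cases hG : GoodModel A P M h
    · rw [goodInd, if_pos hG, one_mul]
      have h2 := hO.norm_iterate_le hlam hM hG hl (directions ω)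
      refine (abs_sub _ _).trans ?_
      rw [abs_of_nonneg hb0]
      gcongr
      have hn' : 1 ≤ n := by omega
      refine (abs_linearReward_le hn' (ha _ (by omega))
        ((sum_lift hn' _).trans (sum_lift hn' _).symm)).trans ?_
      gcongr
      refine (l2dist_lift_le hn' _ _).trans ?_
      gcongr
      rw [hl, Nat.add_sub_cancel_left]
      exact (norm_sub_le _ _).trans (by linarith)
    · rw [goodInd, if_neg hG, zero_mul, abs_zero]; positivity
  have hFm := measurable_iterate_stepE (R := ρ) hmW hmF (P.tLearn S + s) []
  have hHm := measurable_iterate_stepE (R := ρ) hmW hmH (P.tLearn S + s) []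
  have hFB := fun ω => abs_iterate_le (R := ρ) (hW (directions ω)) (m := P.tLearn S + s) (h := [])
    fun h hl => hFb ω h (by simpa using hl)
  have hHB := fun ω => abs_iterate_le (R := ρ) (hW (directions ω)) (m := P.tLearn S + s) (h := [])
    fun h hl => hHb ω h (by simpa using hl)
  have hHi := Integrable.of_bound (μ := Measure.pi fun _ : Fin T => sphereUniform n)
    hHm.aestronglyMeasurable _ (ae_of_all _ hHB)
  refine ⟨hHi, Integrable.of_bound hFm.aestronglyMeasurable _ (ae_of_all _ hFB),
    integral_le_of_forall_update (sphereUniform n) ⟨P.tLearn S + s, hs⟩ hFm hFB hHi fun ω => ?_⟩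
  -- Transitions before this round use only earlier directions, so the update affects the estimate
  -- alone.
  have hcongr : ∀ v, (stepE (transition (algorithm A P c) M
        (directions (Function.update ω ⟨P.tLearn S + s, hs⟩ v))) ρ)^[P.tLearn S + s]
        (fun h => goodInd A P M h * gainEstimate A P c M ρ y
          (directions (Function.update ω ⟨P.tLearn S + s, hs⟩ v)) h) []
      = (stepE (transition (algorithm A P c) M (directions ω)) ρ)^[P.tLearn S + s]
        (fun h => goodInd A P M h * gainEstimate A P c M ρ y
          (directions (Function.update ω ⟨P.tLearn S + s, hs⟩ v)) h) [] := fun v => by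
    refine iterate_congr_transition (tb := P.tLearn S + s) (fun h hl => ?_) _ _ _ (by simp)
    ext K i
    rw [transition, transition, algorithm_congr_directions fun t ht =>
      directions_update_of_ne hs (by omega) ω v]
  simp only [hcongr]
  have hint := (integral_iterate_stepE (R := ρ) (σ := sphereUniform n)
    (W := transition (algorithm A P c) M (directions ω)) (t := P.tLearn S + s)
    (F := fun v h => goodInd A P M h * gainEstimate A P c M ρ y
      (directions (Function.update ω ⟨P.tLearn S + s, hs⟩ v)) h)
    (fun h hl => Integrable.of_bound
      ((hmF h).comp (measurable_update ω)).aestronglyMeasurable _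
      (ae_of_all _ fun v => hFb _ h hl)) (P.tLearn S + s) [] (by simp)).2
  rw [hint]
  refine iterate_mono (hW _) fun h hl => ?_
  rw [List.length_nil, zero_add] at hl
  rw [integral_const_mul]
  by_cases hG : GoodModel A P M h
  · rw [goodInd, if_pos hG, one_mul, one_mul, iterateGap]
    have := hO.le_integral_gainEstimate hlam hM hG hl (by omega) ω hG0 (ha _ (by omega)) hy
    simp only [hl, Nat.add_sub_cancel_left] at this ⊢
    exact this
  · rw [goodInd, if_neg hG, zero_mul, zero_mul]

end OptConditions

end Regret

/-! ### The regret bound -/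

section RegretBound

variable {n k S : ℕ} {𝓜 : Set (PreferenceModel n)} {A : LocalLearner 𝓜 (uniformVec n) S}
  {P : Params n k} {c θ R : ℝ} {M : PreferenceModel n} {lam G : ℝ}

lemma rewardSeq_mem_Icc {T : ℕ} {ρ : Fin T → Fin n → ℝ}
    (hρ : ∀ t i, ρ t i ∈ Set.Icc (0 : ℝ) 1) (t : ℕ) (i : Fin n) :
    rewardSeq ρ t i ∈ Set.Icc (0 : ℝ) 1 := by
  unfold rewardSeq
  split_ifs with h
  · exact hρ _ _
  · simp

lemma sum_trajectoryProb_reward {T : ℕ} {π : Policy n} {u : ℕ → Reduced n}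
    (hW : IsTransition (transition π M u)) (ρ : Fin T → Fin n → ℝ) :
    ∑ τ : Trajectory n T, trajectoryProb π M ρ u τ * ∑ t, ρ t (τ t).2
      = ∑ t ∈ Finset.range T, (stepE (transition π M u) (rewardSeq ρ))^[t]
          (condReward π M (rewardSeq ρ) u) [] := by
  have h1 : ∀ τ : Trajectory n T, ∑ t, ρ t (τ t).2
      = ∑ t ∈ Finset.range T, ((observed ρ τ).map Obs.reward).getD t 0 := fun τ => by
    rw [Finset.sum_range]
    refine Finset.sum_congr rfl fun t _ => ?_
    simp [observed]
  simp only [h1]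
  rw [sum_trajectoryProb_mul' π M ρ u fun h => ∑ t ∈ Finset.range T, (h.map Obs.reward).getD t 0]
  rw [congrFun (iterate_sum (W := transition π M u) (R := rewardSeq ρ) (Finset.range T)
    (fun t h => (h.map Obs.reward).getD t 0) T) []]
  refine Finset.sum_congr rfl fun t ht => ?_
  rw [Finset.mem_range] at ht
  rw [show (stepE (transition π M u) (rewardSeq ρ))^[T] (fun h => (h.map Obs.reward).getD t 0) []
      = (stepE (transition π M u) (rewardSeq ρ))^[T]
        (fun h => ((h.take (t + 1)).map Obs.reward).getD t 0) [] from
    congrArg (fun f => (stepE (transition π M u) (rewardSeq ρ))^[T] f []) (by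
      ext h
      rw [List.map_take, List.getD_eq_getElem?_getD, List.getD_eq_getElem?_getD,
        List.getElem?_take_of_lt (by omega)])]
  rw [iterate_take hW (fun h => (h.map Obs.reward).getD t 0) (by omega)]
  refine iterate_succ_eq hW fun h hl => ?_
  have h2 : ∀ K i, ((addRound (rewardSeq ρ) h K i).map Obs.reward).getD t 0
      = 1 * rewardSeq ρ h.length i + 0 := fun K i => by
    rw [one_mul, add_zero, ← getD_addRound (R := rewardSeq ρ) h K i, hl]
  rw [stepE_of_affine hW h2, one_mul, add_zero]

namespace OptConditions

variable (hO : OptConditions A P c θ R)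
include hO

/-- With a good model the loss of a round splits into contraction of the comparator, model error,
exploration, and the gap to the iterate. With a bad model it is at most `1`, and whether the model
is good is already decided after the learning phase. -/
lemma linearReward_sub_condReward_le (hlam : (k : ℝ) ^ 2 / n ≤ lam) (hM : Dispersed lam M)
    {ρ : ℕ → Fin n → ℝ} (hρ : ∀ t i, ρ t i ∈ Set.Icc (0 : ℝ) 1) {s : ℕ} (hG0 : 0 ≤ G)
    (ha : ∀ x ∈ stdSimplex ℝ (Fin n), ∀ y ∈ stdSimplex ℝ (Fin n),
      |linearReward (ρ (P.tLearn S + s)) x - linearReward (ρ (P.tLearn S + s)) y| ≤ G * l2dist x y)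
    {u : ℕ → Reduced n} (hu : ‖u (P.tLearn S + s)‖ ≤ 1) {η b : ℝ}
    (hfail : (stepE (transition (algorithm A P c) M u) ρ)^[P.tLearn S]
      (fun h => 1 - goodInd A P M h) [] ≤ η) (hb : 0 ≤ b)
    {x : Fin n → ℝ} (hx : x ∈ stdSimplex ℝ (Fin n)) :
    linearReward (ρ (P.tLearn S + s)) x
      - (stepE (transition (algorithm A P c) M u) ρ)^[P.tLearn S + s]
        (condReward (algorithm A P c) M ρ u) []
      ≤ η + (G * (3 * θ + modelError P + n * P.delta) + b)
        + (stepE (transition (algorithm A P c) M u) ρ)^[P.tLearn S + s]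
        (fun h => goodInd A P M h *
          (iterateGap A P c ρ (((1 - θ) * (1 - θ / 2)) • reduce x) u h - b)) [] := by
  have hk := hO.two_le
  have hkn := hO.le_n
  have hδ := hO.delta_pos
  have hθ0 := hO.theta_pos
  have he := hO.modelError_nonneg
  set t := P.tLearn S + s with ht
  set y := ((1 - θ) * (1 - θ / 2)) • reduce x
  have hW := isTransition_algorithm (A := A) (P := P) (c := c) hk hkn hlam hM u
  set W := transition (algorithm A P c) M u
  set b' := G * (3 * θ + modelError P + n * P.delta) + b with hb'
  have hb0 : 0 ≤ b' := by positivity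
  have h1 : (stepE W ρ)^[t] (fun h => 1 - goodInd A P M h) [] ≤ η := by
    refine le_trans (le_of_eq ?_) hfail
    rw [← iterate_take hW (fun h => 1 - goodInd A P M h) (Nat.le_add_right (P.tLearn S) s)]
    refine iterate_congr hW fun h hl => ?_
    rw [List.length_nil, zero_add] at hl
    rw [goodInd_of_prefix hk hkn (List.take_prefix (P.tLearn S) h) (by simp; omega)]
  have h2 := congrFun (iterate_const_mul_add (R := ρ) hW (condReward (algorithm A P c) M ρ u)
    (-1) (linearReward (ρ t) x) t) []
  have h3 := iterate_add (W := W) (R := ρ) (fun h => 1 - goodInd A P M h)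
    (fun h => goodInd A P M h * (iterateGap A P c ρ y u h - b)) t []
  have h4 := congrFun (iterate_const_mul_add (R := ρ) hW
    (fun h => 1 - goodInd A P M h + goodInd A P M h * (iterateGap A P c ρ y u h - b))
    1 b' t) []
  have h5 : (stepE W ρ)^[t] (fun h => -1 * condReward (algorithm A P c) M ρ u h
        + linearReward (ρ t) x) []
      ≤ (stepE W ρ)^[t] (fun h => 1 * (1 - goodInd A P M h
        + goodInd A P M h * (iterateGap A P c ρ y u h - b)) + b') [] := by
    refine iterate_mono hW fun h hl => ?_
    rw [List.length_nil, zero_add] at hl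
    by_cases hG : GoodModel A P M h
    · have h6 := hO.condReward_ge hlam hM hG (hl.trans ht) (u := u) (ρ := ρ) (by rw [hl]; exact hu)
        hG0 (by rw [hl]; exact ha)
      have h7 := hO.linearReward_le_comparator hx hG0 ha
      rw [goodInd, if_pos hG, iterateGap, show h.length - P.tLearn S = s by omega]
      rw [hl] at h6 ⊢
      rw [hb']
      linarith
    · have h6 := condReward_mem_Icc hW (h := h) (hρ h.length)
      have h7 : linearReward (ρ t) x ≤ 1 := by
        rw [← hx.2]
        exact Finset.sum_le_sum fun i _ => mul_le_of_le_one_left (hx.1 i) (hρ t i).2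
      rw [goodInd, if_neg hG]
      linarith [h6.1]
  linarith

/-- Learning rounds cost at most one each. In the later rounds the gap to the iterate is replaced in
mean by the gain estimate, whose sum is bounded for every sequence of directions. -/
theorem regret_le (hlam : (k : ℝ) ^ 2 / n ≤ lam) (hM : Dispersed lam M) {T : ℕ}
    (hT : P.tLearn S ≤ T) {ρ : Fin T → Fin n → ℝ} (hρ : ∀ t i, ρ t i ∈ Set.Icc (0 : ℝ) 1)
    (hG0 : 0 ≤ G)
    (ha : ∀ t, ∀ x ∈ stdSimplex ℝ (Fin n), ∀ y ∈ stdSimplex ℝ (Fin n),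
      |linearReward (ρ t) x - linearReward (ρ t) y| ≤ G * l2dist x y) {η : ℝ} (hη : 0 ≤ η)
    (hfail : ∀ u, (stepE (transition (algorithm A P c) M u) (rewardSeq ρ))^[P.tLearn S]
      (fun h => 1 - goodInd A P M h) [] ≤ η) (heta : 0 < P.eta)
    {x : Fin n → ℝ} (hx : x ∈ entropySet n c ∩ EIRD k M.score) :
    regretAgainst (algorithm A P c) M ρ x ≤ P.tLearn S
      + T * (η + (G * (3 * θ + modelError P + n * P.delta) + 2 * n ^ 2 * (G * modelError P / R)))
      + (n ^ 2 / (2 * P.eta) + T * (P.eta / 2 * (n / P.delta) ^ 2)) := by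
  obtain ⟨N, rfl⟩ := Nat.exists_eq_add_of_le hT
  have hk := hO.two_le
  have hkn := hO.le_n
  have hδ := hO.delta_pos
  have hθ0 := hO.theta_pos
  have hRp := hO.R_pos
  have he := hO.modelError_nonneg
  have hprob := isProbabilityMeasure_sphereUniform (hk.trans hkn)
  have hW := fun u => isTransition_algorithm (A := A) (P := P) (c := c) hk hkn hlam hM u
  have hρ' := rewardSeq_mem_Icc hρ
  have ha' : ∀ t < P.tLearn S + N, ∀ x ∈ stdSimplex ℝ (Fin n), ∀ y ∈ stdSimplex ℝ (Fin n),
      |linearReward (rewardSeq ρ t) x - linearReward (rewardSeq ρ t) y| ≤ G * l2dist x y :=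
    fun t ht => by rw [rewardSeq, dif_pos ht]; exact ha _
  set ρ' := rewardSeq ρ with hρdef
  set y := ((1 - θ) * (1 - θ / 2)) • reduce x with hy
  have hyn : ‖y‖ ≤ n := hO.norm_comparator_le hx.1.1
  set b := 2 * (n : ℝ) ^ 2 * (G * modelError P / R) with hb
  have hb0 : 0 ≤ b := by positivity
  set b' := G * (3 * θ + modelError P + n * P.delta) + b with hb'
  have hb'0 : 0 ≤ b' := by positivity
  set μ := Measure.pi fun _ : Fin (P.tLearn S + N) => sphereUniform n with hμ
  let W := fun ω : Fin (P.tLearn S + N) → Metric.sphere (0 : Reduced n) 1 =>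
    transition (algorithm A P c) M (directions ω)
  let V := fun (t : ℕ) (ω : Fin (P.tLearn S + N) → Metric.sphere (0 : Reduced n) 1) =>
    (stepE (W ω) ρ')^[t] (condReward (algorithm A P c) M ρ' (directions ω)) []
  let Y := fun (s : ℕ) (ω : Fin (P.tLearn S + N) → Metric.sphere (0 : Reduced n) 1) =>
    (stepE (W ω) ρ')^[P.tLearn S + s] (fun h => goodInd A P M h *
      (iterateGap A P c ρ' y (directions ω) h - b)) []
  let Z := fun (s : ℕ) (ω : Fin (P.tLearn S + N) → Metric.sphere (0 : Reduced n) 1) =>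
    (stepE (W ω) ρ')^[P.tLearn S + s] (fun h => goodInd A P M h *
      gainEstimate A P c M ρ' y (directions ω) h) []
  have hYZ : ∀ s < N, Integrable (Y s) μ ∧ Integrable (Z s) μ ∧
      ∫ ω, Y s ω ∂μ ≤ ∫ ω, Z s ω ∂μ := fun s hs =>
    hO.integral_iterateGap_le hlam hM hρ' (by omega) hG0 ha' hyn
  have hZ : ∀ ω, ∑ s ∈ Finset.range N, Z s ω
      ≤ n ^ 2 / (2 * P.eta) + N * (P.eta / 2 * (n / P.delta) ^ 2) := fun ω =>
    hO.sum_gainEstimate_le hlam hM hρ' heta ω hx hy hyn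
  have hVm : ∀ t, Integrable (V t) μ := fun t => by
    refine Integrable.of_bound (measurable_iterate_stepE
      (fun h K i => measurable_transition_algorithm h K i) (fun h => ?_) t []).aestronglyMeasurable 1
      (ae_of_all _ fun ω => abs_iterate_le (hW _) fun h _ => ?_)
    · exact Finset.measurable_sum _ fun K _ => (measurable_algorithm h K).mul_const _
    · have := condReward_mem_Icc (hW (directions ω)) (h := h) (hρ' h.length)
      exact abs_le.2 ⟨by linarith [this.1], this.2⟩
  have hlr : ∀ t, linearReward (ρ' t) x ≤ 1 := fun t => by
    rw [← hx.1.1.2]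
    exact Finset.sum_le_sum fun i _ => mul_le_of_le_one_left (hx.1.1.1 i) (hρ' t i).2
  have hV0 : ∀ t ω, 0 ≤ V t ω := fun t ω => by
    rw [← iterate_const (R := ρ') (hW (directions ω)) 0 t []]
    exact iterate_mono (hW _) fun h _ => (condReward_mem_Icc (hW _) (hρ' h.length)).1
  have hVY : ∀ s < N, ∀ ω, linearReward (ρ' (P.tLearn S + s)) x - V (P.tLearn S + s) ω
      ≤ η + b' + Y s ω := fun s hs ω =>
    hO.linearReward_sub_condReward_le hlam hM hρ' hG0 (ha' _ (by omega))
      (norm_directions (by omega) ω).le (hfail _) hb0 hx.1.1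
  have hreg : regretAgainst (algorithm A P c) M ρ x
      = ∑ t ∈ Finset.range (P.tLearn S + N), (linearReward (ρ' t) x - ∫ ω, V t ω ∂μ) := by
    rw [regretAgainst, expectation, Finset.sum_sub_distrib, ← integral_finsetSum _ fun t _ => hVm t,
      Finset.sum_range]
    congr 1
    · exact Finset.sum_congr rfl fun t _ => by simp [hρdef, rewardSeq]
    · exact integral_congr_ae (ae_of_all _ fun ω => sum_trajectoryProb_reward (hW _) ρ)
  rw [hreg, Finset.sum_range_add]
  have hfirst : ∑ t ∈ Finset.range (P.tLearn S), (linearReward (ρ' t) x - ∫ ω, V t ω ∂μ)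
      ≤ P.tLearn S := by
    have h1 : ∀ t ∈ Finset.range (P.tLearn S), linearReward (ρ' t) x - ∫ ω, V t ω ∂μ ≤ 1 :=
      fun t _ => by linarith [hlr t, integral_nonneg (μ := μ) (f := V t) (hV0 t)]
    simpa using Finset.sum_le_sum h1
  have hsecond : ∑ s ∈ Finset.range N,
      (linearReward (ρ' (P.tLearn S + s)) x - ∫ ω, V (P.tLearn S + s) ω ∂μ)
      ≤ N * (η + b') + (n ^ 2 / (2 * P.eta) + N * (P.eta / 2 * (n / P.delta) ^ 2)) := by
    calc _ ≤ ∑ s ∈ Finset.range N, (η + b' + ∫ ω, Z s ω ∂μ) := by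
          refine Finset.sum_le_sum fun s hs => ?_
          rw [Finset.mem_range] at hs
          obtain ⟨h1, -, h3⟩ := hYZ s hs
          have h4 : ∫ ω, (linearReward (ρ' (P.tLearn S + s)) x - V (P.tLearn S + s) ω) ∂μ
              ≤ ∫ ω, (η + b' + Y s ω) ∂μ :=
            integral_mono ((integrable_const _).sub (hVm _)) ((integrable_const _).add h1)
              (hVY s hs)
          rw [integral_sub (integrable_const _) (hVm _), integral_add (integrable_const _) h1] at h4
          simp only [integral_const, probReal_univ, one_smul] at h4
          linarith
      _ = N * (η + b') + ∫ ω, ∑ s ∈ Finset.range N, Z s ω ∂μ := by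
          rw [integral_finsetSum _ fun s hs => (hYZ s (Finset.mem_range.1 hs)).2.1,
            Finset.sum_add_distrib, Finset.sum_const, Finset.card_range, nsmul_eq_mul]
      _ ≤ _ := by
          have h1 : ∫ ω, ∑ s ∈ Finset.range N, Z s ω ∂μ
              ≤ ∫ _ω, (n ^ 2 / (2 * P.eta) + N * (P.eta / 2 * (n / P.delta) ^ 2)) ∂μ :=
            integral_mono (integrable_finsetSum _ fun s hs =>
              (hYZ s (Finset.mem_range.1 hs)).2.1) (integrable_const _) hZ
          simp only [integral_const, probReal_univ, one_smul] at h1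
          linarith
  have hN : (N : ℝ) ≤ ((P.tLearn S + N : ℕ) : ℝ) := by exact_mod_cast Nat.le_add_left _ _
  have h1 : (N : ℝ) * (η + b') ≤ ((P.tLearn S + N : ℕ) : ℝ) * (η + b') := by gcongr
  have h2 : (N : ℝ) * (P.eta / 2 * (n / P.delta) ^ 2)
      ≤ ((P.tLearn S + N : ℕ) : ℝ) * (P.eta / 2 * (n / P.delta) ^ 2) := by gcongr
  linarith

end OptConditions

end RegretBound

/-! ### The empirical item distribution -/

section Empirical

variable {n k S : ℕ} {𝓜 : Set (PreferenceModel n)} {A : LocalLearner 𝓜 (uniformVec n) S}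
  {P : Params n k} {c θ R : ℝ} {M : PreferenceModel n} {lam G : ℝ} {ρ : ℕ → Fin n → ℝ}

/-- Deviation of the number of selections of `i` after the first `t₀` rounds from its
compensator. -/
noncomputable def countDeviation (W : Transition n) (t₀ : ℕ) (i : Fin n) (h : List (Obs n)) : ℝ :=
  (itemCount h i.val : ℝ) - itemCount (h.take t₀) i.val
    - ∑ t ∈ Finset.Ico t₀ h.length, ∑ K, W (h.take t) K i

lemma countDeviation_addRound (W : Transition n) {t₀ : ℕ} (i : Fin n) {h : List (Obs n)}
    (hl : t₀ ≤ h.length) (K : Finset (Fin n)) (j : Fin n) :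
    countDeviation W t₀ i (addRound ρ h K j)
      = countDeviation W t₀ i h + ((if j = i then 1 else 0) - ∑ K, W h K i) := by
  have h1 : ∀ t ≤ h.length, (addRound ρ h K j).take t = h.take t := fun t ht => by
    rw [addRound, List.take_append_of_le_length ht]
  simp only [countDeviation]
  rw [itemCount_addRound, length_addRound, Finset.sum_Ico_succ_top hl, h1 _ hl, h1 _ le_rfl,
    List.take_length]
  rw [Finset.sum_congr rfl fun t ht => by rw [h1 t (Finset.mem_Ico.1 ht).2.le]]
  simp only [Fin.ext_iff]
  push_cast
  ring

/-- Increments are centred Bernoulli variables, so the mean square grows by `p - p ^ 2 ≤ 1` per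
round. -/
lemma iterate_sq_countDeviation_le {W : Transition n} (hW : IsTransition W) {t₀ : ℕ} (i : Fin n)
    {h : List (Obs n)} (hl : h.length = t₀) (N : ℕ) :
    (stepE W ρ)^[N] (fun h' => countDeviation W t₀ i h' ^ 2) h ≤ N := by
  have h0 : countDeviation W t₀ i h = 0 := by
    simp [countDeviation, ← hl]
  have := iterate_le_of_drift (R := ρ) (tb := t₀ + N) (a := 1) (b := 1) hW
    (Inv := fun h => t₀ ≤ h.length)
    (Ψ := fun h' => countDeviation W t₀ i h' ^ 2) le_rfl zero_le_one
    (fun h hI _ K j _ => by rw [length_addRound]; omega) (fun h hI _ => ?_) N h hl.ge (by omega)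
  · simpa [h0] using this
  set X := countDeviation W t₀ i h
  set p := ∑ K, W h K i
  have hp0 : 0 ≤ p := Finset.sum_nonneg fun K _ => hW.nonneg h K i
  have e : ∀ K j, W h K j * countDeviation W t₀ i (addRound ρ h K j) ^ 2
      = W h K j * (X - p) ^ 2 + (if j = i then W h K j * (2 * X + 1 - 2 * p) else 0) := fun K j => by
    rw [countDeviation_addRound W i hI]
    split_ifs <;> ring
  have e2 : stepE W ρ (fun h' => countDeviation W t₀ i h' ^ 2) h
      = (X - p) ^ 2 + p * (2 * X + 1 - 2 * p) := by
    simp only [stepE, e, Finset.sum_add_distrib, ← Finset.sum_mul, hW.sum_eq_one, one_mul,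
      Finset.sum_ite_eq', Finset.mem_univ, if_true]
    rfl
  have hp1 : p ≤ 1 := by
    rw [← hW.sum_eq_one h]
    exact Finset.sum_le_sum fun K _ =>
      Finset.single_le_sum (f := fun j => W h K j) (fun j _ => hW.nonneg h K j) (Finset.mem_univ i)
  rw [e2]
  nlinarith

lemma reaches_countDeviation {W : Transition n} (hW : IsTransition W) {t₀ : ℕ} (N : ℕ) {y : ℝ}
    (hy : 0 < y) : Reaches W ρ (fun h => h.length = t₀)
      (fun h => ∀ i, |countDeviation W t₀ i h| ≤ y) N (n * N / y ^ 2) := by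
  classical
  intro h hl
  calc _ ≤ (stepE W ρ)^[N]
        (fun h' => (1 / y ^ 2) * (∑ i, countDeviation W t₀ i h' ^ 2) + 0) h := by
        refine iterate_mono hW fun h' _ => ?_
        split_ifs with hb
        · positivity
        · push Not at hb
          obtain ⟨i, hi⟩ := hb
          rw [add_zero, one_div_mul_eq_div, le_div_iff₀ (by positivity), one_mul]
          have h1 : y ^ 2 ≤ countDeviation W t₀ i h' ^ 2 := by
            rw [← sq_abs (countDeviation W t₀ i h')]; gcongr
          exact h1.trans (Finset.single_le_sum (f := fun i => countDeviation W t₀ i h' ^ 2)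
            (fun i _ => sq_nonneg _) (Finset.mem_univ i))
    _ = (1 / y ^ 2) * ∑ i, (stepE W ρ)^[N] (fun h' => countDeviation W t₀ i h' ^ 2) h := by
        rw [iterate_const_mul_add hW, iterate_sum]; exact add_zero _
    _ ≤ (1 / y ^ 2) * ∑ _i : Fin n, (N : ℝ) := by
        gcongr with i
        exact iterate_sq_countDeviation_le hW i hl N
    _ = _ := by
        rw [Finset.sum_const, Finset.card_univ, Fintype.card_fin, nsmul_eq_mul]; ring

namespace OptConditions

variable (hO : OptConditions A P c θ R)
include hO

/-- The played point is a convex combination, with weights `1 - θ` and `θ`, of the rescaled iterate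
and a point of the ball contained in `H_c`. -/
lemma played_mem_entropySet (hlam : (k : ℝ) ^ 2 / n ≤ lam) (hM : Dispersed lam M)
    {h : List (Obs n)} (hG : GoodModel A P M h) {s : ℕ} (hl : h.length = P.tLearn S + s)
    (u : ℕ → Reduced n) {v : Reduced n} (hv : ‖v‖ ≤ 1) :
    lift (iterate A P c u h s + P.delta • v) ∈ entropySet n c := by
  have hθ0 := hO.theta_pos
  have hθ1 := hO.theta_lt
  have hδ := hO.delta_pos
  have hr := hO.r_pos
  have e : iterate A P c u h s + P.delta • v
      = (1 - θ) • ((1 - θ)⁻¹ • iterate A P c u h s) + θ • ((P.delta / θ) • v) := by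
    rw [smul_smul, smul_smul, mul_inv_cancel₀ (by linarith), one_smul, mul_div_cancel₀ _ hθ0.ne']
  rw [e, lift_combo _ _ (by ring)]
  refine convex_entropySet n c (hO.iterate_scaled_mem hlam hM hG hl u).1 (hO.ball _ ?_)
    (by linarith) hθ0.le (by ring)
  rw [norm_smul, Real.norm_eq_abs, abs_of_pos (by positivity)]
  refine (mul_le_of_le_one_right (by positivity) hv).trans ?_
  rw [div_le_iff₀ hθ0]
  have h1 := hO.theta_eq
  have h2 := hO.eps_pos
  have h3 : P.r ≤ R := (le_mul_of_one_le_left hr.le hO.one_le_n).trans hO.r_le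
  nlinarith

lemma abs_itemProb_sub_le (hlam : (k : ℝ) ^ 2 / n ≤ lam) (hM : Dispersed lam M)
    {h : List (Obs n)} (hG : GoodModel A P M h) {s : ℕ} (hl : h.length = P.tLearn S + s)
    {u : ℕ → Reduced n} (hu : ‖u h.length‖ ≤ 1) (i : Fin n) :
    |lift (iterate A P c u h s + P.delta • u h.length) i
      - ∑ K, transition (algorithm A P c) M u h K i| ≤ 2 * n ^ 2 * P.accuracy := by
  have hδ := hO.delta_pos
  have hv : memory h ∈ stdSimplex ℝ (Fin n) :=
    memory_mem_stdSimplex (by have := hO.tLearn_pos; omega)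
  obtain ⟨z, ζ, -, -, hsol⟩ := hO.lp _
    (hO.crossInHull (hO.menusAtLeast_learned hlam hM hG hv)) _
    (hO.iterate_scaled_mem hlam hM hG hl u).2
  have hw : ‖P.delta • u h.length‖ ≤ θ * P.r := by
    rw [norm_smul, Real.norm_eq_abs, abs_of_pos hδ, ← hO.theta_eq]
    exact (mul_le_of_le_one_right hδ.le hu).trans (by linarith [hO.eps_pos])
  rw [← (hsol _ hw).2]
  have hz := P.lp.isMenuDistribution (learnedModel A P h (memory h)) (iterate A P c u h s)
    (P.delta • u h.length)
  simp only [transition, algorithm_eq_sol hl, Finset.sum_apply, Pi.smul_apply, smul_eq_mul,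
    ← Finset.sum_sub_distrib, ← mul_sub]
  refine (Finset.abs_sum_le_sum_abs _ _).trans ?_
  calc _ ≤ ∑ K, P.lp.sol (learnedModel A P h (memory h)) (iterate A P c u h s)
        (P.delta • u h.length) K * (2 * n ^ 2 * P.accuracy) := by
        refine Finset.sum_le_sum fun K _ => ?_
        rw [abs_mul, abs_of_nonneg (hz.1 K)]
        by_cases hK : K.card = k
        · rw [abs_sub_comm]
          exact mul_le_mul_of_nonneg_left ((hO.menuDist_close hlam hM hG hv hK).2.2 i) (hz.1 K)
        · rw [hz.2.1 K hK, zero_mul, zero_mul]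
    _ = _ := by rw [← Finset.sum_mul, hz.2.2, one_mul]

/-- The witness is the time average of points of `H_c`, which is convex. The empirical distribution
differs from it by the deviation left after learning, the martingale part of the counts, and the
error between intended and true item probabilities. -/
lemma entropySatisfied_of_countDeviation (hlam : (k : ℝ) ^ 2 / n ≤ lam) (hM : Dispersed lam M)
    {N : ℕ} {u : ℕ → Reduced n} (hu : ∀ t < P.tLearn S + N, ‖u t‖ ≤ 1) {h : List (Obs n)}
    (hl : h.length = P.tLearn S + N) (hG : GoodModel A P M h) {B y : ℝ}
    (hB : ∀ i, |deficit (uniformVec n) (P.tLearn S) (h.take (P.tLearn S)) i| ≤ B)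
    (hy : ∀ i, |countDeviation (transition (algorithm A P c) M u) (P.tLearn S) i h| ≤ y) :
    EntropySatisfied c (n * ((B + y) / (P.tLearn S + N : ℕ) + 2 * n ^ 2 * P.accuracy))
      (memory h) := by
  have hacc := hO.acc_pos
  have hk := hO.two_le
  have hkn := hO.le_n
  set W := transition (algorithm A P c) M u
  set t₀ := P.tLearn S with ht₀
  set T := t₀ + N with hT
  have hTpos : (0 : ℝ) < (T : ℕ) := by
    exact_mod_cast (by have := hO.tLearn_pos; omega : 0 < T)
  -- Each learning round is credited with the uniform vector; only the histogram at the end of the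
  -- learning phase has to be close to it, not the individual rounds.
  let z : ℕ → Fin n → ℝ := fun t => if t < t₀ then uniformVec n else
    lift (iterate A P c u (h.take t) (t - t₀) + P.delta • u t)
  have hlen : ∀ t ≤ T, (h.take t).length = t := fun t ht => by rw [List.length_take]; omega
  have hGt : ∀ t, t₀ ≤ t → t ≤ T → GoodModel A P M (h.take t) := fun t h1 h2 =>
    (goodModel_iff_of_prefix hk hkn (List.take_prefix t h) (by rw [hlen t h2]; exact h1)).1 hG
  have hz : ∀ t ∈ Finset.range T, z t ∈ entropySet n c := fun t ht => by
    rw [Finset.mem_range] at ht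
    simp only [z]
    split_ifs with h1
    · rw [← lift_zero]; exact hO.ball 0 (by rw [norm_zero]; exact hO.R_pos.le)
    · exact hO.played_mem_entropySet hlam hM (hGt t (by omega) ht.le)
        (by rw [hlen t ht.le]; omega) u (hu t ht)
  refine ⟨∑ t ∈ Finset.range T, (1 / (T : ℝ)) • z t,
    (convex_entropySet n c).sum_mem (fun t _ => by positivity)
      (by rw [Finset.sum_const, Finset.card_range, nsmul_eq_mul]; field_simp) hz, ?_⟩
  have hi : ∀ i, |(∑ t ∈ Finset.range T, (1 / (T : ℝ)) • z t) i - memory h i|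
      ≤ (B + y) / T + 2 * n ^ 2 * P.accuracy := fun i => by
    have e1 : (∑ t ∈ Finset.range T, (1 / (T : ℝ)) • z t) i - memory h i
        = (deficit (uniformVec n) t₀ (h.take t₀) i - countDeviation W t₀ i h
          + ∑ s ∈ Finset.range N, (z (t₀ + s) i - ∑ K, W (h.take (t₀ + s)) K i)) / T := by
      have e2 : ∑ t ∈ Finset.range T, z t i
          = t₀ * uniformVec n i + ∑ s ∈ Finset.range N, z (t₀ + s) i := by
        rw [hT, Finset.sum_range_add]
        congr 1
        rw [Finset.sum_congr rfl fun t ht => by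
          rw [show z t = uniformVec n from if_pos (Finset.mem_range.1 ht)]]
        simp
      have e3 : ∑ t ∈ Finset.Ico t₀ h.length, ∑ K, W (h.take t) K i
          = ∑ s ∈ Finset.range N, ∑ K, W (h.take (t₀ + s)) K i := by
        rw [hl, Finset.sum_Ico_eq_sum_range, hT, Nat.add_sub_cancel_left]
      simp only [Finset.sum_apply, Pi.smul_apply, smul_eq_mul, ← Finset.mul_sum, memory, hl]
      rw [e2, deficit, countDeviation, e3, Finset.sum_sub_distrib]
      ring
    have h2 : |∑ s ∈ Finset.range N, (z (t₀ + s) i - ∑ K, W (h.take (t₀ + s)) K i)|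
        ≤ N * (2 * n ^ 2 * P.accuracy) := by
      refine (Finset.abs_sum_le_sum_abs _ _).trans ?_
      rw [← nsmul_eq_mul, ← Finset.card_range N, ← Finset.sum_const, Finset.card_range]
      refine Finset.sum_le_sum fun s hs => ?_
      rw [Finset.mem_range] at hs
      have hlt := hlen (t₀ + s) (by omega)
      have := hO.abs_itemProb_sub_le hlam hM (hGt (t₀ + s) (by omega) (by omega)) hlt (u := u)
        (by rw [hlt]; exact hu _ (by omega)) i
      rw [hlt] at this
      rw [show z (t₀ + s) = lift (iterate A P c u (h.take (t₀ + s)) s + P.delta • u (t₀ + s)) by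
        simp [z]]
      exact this
    rw [e1, abs_div, abs_of_pos hTpos, div_add' _ _ _ hTpos.ne']
    refine div_le_div_of_nonneg_right ?_ hTpos.le
    have h3 := abs_add_le (deficit (uniformVec n) t₀ (h.take t₀) i - countDeviation W t₀ i h)
      (∑ s ∈ Finset.range N, (z (t₀ + s) i - ∑ K, W (h.take (t₀ + s)) K i))
    have h4 := abs_sub (deficit (uniformVec n) t₀ (h.take t₀) i) (countDeviation W t₀ i h)
    have h5 : (N : ℝ) * (2 * n ^ 2 * P.accuracy) ≤ 2 * n ^ 2 * P.accuracy * T := by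
      rw [mul_comm]
      refine mul_le_mul_of_nonneg_left ?_ (by positivity)
      exact_mod_cast Nat.le_add_left N t₀
    linarith [hB i, hy i]
  have hnn : 0 ≤ (B + y) / T + 2 * n ^ 2 * P.accuracy :=
    (abs_nonneg _).trans (hi ⟨0, by omega⟩)
  rw [tvDist]
  calc 1 / 2 * ∑ i, |(∑ t ∈ Finset.range T, (1 / (T : ℝ)) • z t) i - memory h i|
      ≤ 1 / 2 * ∑ _i : Fin n, ((B + y) / T + 2 * n ^ 2 * P.accuracy) := by
        gcongr with i; exact hi i
    _ = 1 / 2 * (n * ((B + y) / T + 2 * n ^ 2 * P.accuracy)) := by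
        rw [Finset.sum_const, Finset.card_univ, Fintype.card_fin, nsmul_eq_mul]
    _ ≤ _ := by
        have : 0 ≤ n * ((B + y) / T + 2 * n ^ 2 * P.accuracy) := by positivity
        linarith

theorem le_probability_entropySatisfied (hlam : (k : ℝ) ^ 2 / n ≤ lam) (hM : Dispersed lam M)
    (hM𝓜 : M ∈ 𝓜) (hα : 0 < P.alpha) (hacc1 : P.accuracy ≤ 1) {T : ℕ}
    (hT : P.tLearn S ≤ T) (ρ : Fin T → Fin n → ℝ) {B y η e : ℝ} (hy : 0 < y)
    (he : n * ((B + y) / T + 2 * n ^ 2 * P.accuracy) ≤ e)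
    (hfail : ∀ u, Reaches (transition (algorithm A P c) M u) (rewardSeq ρ) (fun h => h = [])
      (CycleGood A P M (P.accuracy / A.errorFactor P.alpha) B S) (P.tLearn S) η) :
    1 - (η + n * T / y ^ 2) ≤ probability (algorithm A P c) M ρ
      (fun τ => EntropySatisfied c e (memory (observed ρ τ))) := by
  classical
  obtain ⟨N, rfl⟩ := Nat.exists_eq_add_of_le hT
  have hk := hO.two_le
  have hkn := hO.le_n
  have hprob := isProbabilityMeasure_sphereUniform (hk.trans hkn)
  have hW := fun u => isTransition_algorithm (A := A) (P := P) (c := c) hk hkn hlam hM u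
  set f : List (Obs n) → ℝ := fun h => if EntropySatisfied c e (memory h) then 1 else 0 with hf
  have hprefix : ∀ u, Reaches (transition (algorithm A P c) M u) (rewardSeq ρ)
      (CycleGood A P M (P.accuracy / A.errorFactor P.alpha) B S)
      (fun h => (∀ i, |countDeviation (transition (algorithm A P c) M u) (P.tLearn S) i h| ≤ y) ∧
        GoodModel A P M h ∧
          ∀ i, |deficit (uniformVec n) (P.tLearn S) (h.take (P.tLearn S)) i| ≤ B) N
      (n * N / y ^ 2) := fun u => by
    refine Reaches.and_of_prefix (hW u) ((reaches_countDeviation (hW u) N hy).mono (hW u)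
      (fun h hG => hG.1.1) (fun h hG => hG) le_rfl) fun h h' hG hp => ?_
    have hlen : h.length = P.tLearn S := hG.1.1
    refine ⟨(goodModel_iff_of_prefix hk hkn hp hlen.ge).2
      (goodModel_of_cycleGood hM𝓜 hα hO.acc_pos hacc1 hG), fun i => ?_⟩
    rw [← hlen, ← List.prefix_iff_eq_take.1 hp, hlen]
    exact hG.1.2 i
  have hω : ∀ ω : Fin (P.tLearn S + N) → Metric.sphere (0 : Reduced n) 1,
      1 - (η + n * (P.tLearn S + N : ℕ) / y ^ 2) ≤
        (stepE (transition (algorithm A P c) M (directions ω)) (rewardSeq ρ))^[P.tLearn S + N]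
          f [] := fun ω => by
    have h1 := (hfail (directions ω)).trans (hW _) (hprefix (directions ω)) (by positivity) [] rfl
    have h2 := congrFun (iterate_const_mul_add (R := rewardSeq ρ) (hW (directions ω)) f (-1) 1
      (P.tLearn S + N)) []
    have h3 : (stepE (transition (algorithm A P c) M (directions ω)) (rewardSeq ρ))^[P.tLearn S + N]
          (fun h => -1 * f h + 1) [] ≤ η + n * N / y ^ 2 := by
      refine le_trans (iterate_mono (hW _) fun h hl => ?_) h1
      rw [List.length_nil, zero_add] at hl
      split_ifs with hgood
      · rw [hf]
        dsimp only
        rw [if_pos]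
        · norm_num
        · obtain ⟨x, hx, hd⟩ := hO.entropySatisfied_of_countDeviation hlam hM
            (fun t ht => (norm_directions ht ω).le) hl hgood.2.1 hgood.2.2 hgood.1
          exact ⟨x, hx, hd.trans he⟩
      · rw [hf]
        dsimp only
        split_ifs <;> norm_num
    have h4 : (n : ℝ) * N / y ^ 2 ≤ n * (P.tLearn S + N : ℕ) / y ^ 2 := by
      gcongr
      exact Nat.le_add_left _ _
    linarith
  rw [probability, expectation]
  have h1 : ∀ ω : Fin (P.tLearn S + N) → Metric.sphere (0 : Reduced n) 1,
      ∑ τ : Trajectory n (P.tLearn S + N), trajectoryProb (algorithm A P c) M ρ (directions ω) τ *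
        (if EntropySatisfied c e (memory (observed ρ τ)) then 1 else 0)
      = (stepE (transition (algorithm A P c) M (directions ω)) (rewardSeq ρ))^[P.tLearn S + N]
          f [] := fun ω => sum_trajectoryProb_mul' _ M ρ _ f
  have h2 : ∀ ω : Fin (P.tLearn S + N) → Metric.sphere (0 : Reduced n) 1,
      1 - (η + n * (P.tLearn S + N : ℕ) / y ^ 2) ≤
      ∑ τ : Trajectory n (P.tLearn S + N), trajectoryProb (algorithm A P c) M ρ (directions ω) τ *
        (if EntropySatisfied c e (memory (observed ρ τ)) then 1 else 0) := fun ω => by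
    rw [h1]; exact hω ω
  have h3 := integral_mono (μ := Measure.pi fun _ : Fin (P.tLearn S + N) => sphereUniform n)
    (integrable_const _) (g := fun ω =>
      ∑ τ : Trajectory n (P.tLearn S + N), trajectoryProb (algorithm A P c) M ρ (directions ω) τ *
        (if EntropySatisfied c e (memory (observed ρ τ)) then 1 else 0)) ?_ h2
  · simp only [integral_const, probReal_univ, one_smul] at h3
    convert h3
  · simp only [h1]
    have hm := measurable_iterate_stepE (R := rewardSeq ρ)
      (fun h K i => measurable_transition_algorithm (A := A) (P := P) (c := c) (M := M)
        (T := P.tLearn S + N) h K i)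
      (F := fun _ => f) (fun h => measurable_const) (P.tLearn S + N) []
    refine Integrable.of_bound hm.aestronglyMeasurable 1 (ae_of_all _ fun ω => abs_iterate_le (hW _) fun h _ => ?_)
    rw [hf]
    dsimp only
    split_ifs <;> norm_num

end OptConditions

end Empirical

/-! ### Choice of the parameters -/

section Tuning

/-- Constants for the lengths of the stages. -/
structure TuningConstants (n : ℕ) (L F R κ₁ κ₃ C₁ C₂ C₃ : ℝ) : Prop where
  R_pos : 0 < R
  R_le : R ≤ 1 / (4 * n ^ 2)
  C₃_eq : C₃ = 2 * n ^ 3 * (1 + 2 * n ^ 2 / R)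
  κ₁_pos : 0 < κ₁
  κ₁_le : κ₁ ≤ 1 / (2 * n)
  κ₁_mul : 4 * n ^ 3 * κ₁ * (C₃ * F) ≤ 1
  κ₃_pos : 0 < κ₃
  κ₃_le : κ₃ ≤ 1 / (2 * n)
  κ₃_mul : 8 * n ^ 3 * |L| * κ₃ ≤ κ₁
  one_le_C₁ : 1 ≤ C₁
  C₁_mul : 72 * n ≤ C₁ * κ₁ ^ 2
  one_le_C₂ : 1 ≤ C₂
  C₂_mul : 8 * n * C₁ ≤ κ₃ * C₂
  C₂_mul' : 6 * n ≤ κ₃ * C₂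

/-- The constants are chosen in the order `C₃`, `κ₁`, `κ₃`, `C₁`, `C₂`, each depending on earlier
ones only and none on the horizon. -/
lemma exists_tuningConstants {n : ℕ} (hn : 2 ≤ n) (L : ℝ) {F R : ℝ} (hF : 0 < F) (hR : 0 < R)
    (hRn : R ≤ 1 / (4 * n ^ 2)) : ∃ κ₁ κ₃ C₁ C₂ C₃, TuningConstants n L F R κ₁ κ₃ C₁ C₂ C₃ := by
  have hn0 : (0 : ℝ) < n := by exact_mod_cast (by omega : 0 < n)
  obtain ⟨C₃, hC₃⟩ : ∃ C₃, C₃ = 2 * (n : ℝ) ^ 3 * (1 + 2 * n ^ 2 / R) := ⟨_, rfl⟩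
  have hC₃0 : 0 < C₃ := by rw [hC₃]; positivity
  obtain ⟨κ₁, hκ₁, h1, h2⟩ : ∃ κ₁ : ℝ, 0 < κ₁ ∧ κ₁ ≤ 1 / (2 * n) ∧ κ₁ ≤ 1 / (4 * n ^ 3 * (C₃ * F)) :=
    ⟨min (1 / (2 * n)) (1 / (4 * n ^ 3 * (C₃ * F))), by positivity, min_le_left _ _,
      min_le_right _ _⟩
  obtain ⟨κ₃, hκ₃, h3, h4⟩ : ∃ κ₃ : ℝ, 0 < κ₃ ∧ κ₃ ≤ 1 / (2 * n) ∧
      κ₃ ≤ κ₁ / (8 * n ^ 3 * (|L| + 1)) :=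
    ⟨min (1 / (2 * n)) (κ₁ / (8 * n ^ 3 * (|L| + 1))), by positivity, min_le_left _ _,
      min_le_right _ _⟩
  obtain ⟨C₁, h5, h6⟩ : ∃ C₁ : ℝ, 1 ≤ C₁ ∧ 72 * n / κ₁ ^ 2 ≤ C₁ :=
    ⟨max 1 (72 * n / κ₁ ^ 2), le_max_left _ _, le_max_right _ _⟩
  obtain ⟨C₂, h7, h8, h9⟩ : ∃ C₂ : ℝ, 1 ≤ C₂ ∧ 8 * n * C₁ / κ₃ ≤ C₂ ∧ 6 * n / κ₃ ≤ C₂ :=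
    ⟨max 1 (max (8 * n * C₁ / κ₃) (6 * n / κ₃)), le_max_left _ _,
      (le_max_left _ _).trans (le_max_right _ _), (le_max_right _ _).trans (le_max_right _ _)⟩
  rw [le_div_iff₀ (by positivity)] at h2 h4
  rw [div_le_iff₀ (by positivity)] at h6 h8 h9
  refine ⟨κ₁, κ₃, C₁, C₂, C₃, hR, hRn, hC₃, hκ₁, h1, by linarith, hκ₃, h3, ?_, h5, h6, h7,
    by linarith, by linarith⟩
  have : 0 ≤ κ₃ * (8 * n ^ 3) := by positivity
  linarith

lemma le_ceil_and_ceil_le {x : ℝ} (hx : 1 ≤ x) : x ≤ ⌈x⌉₊ ∧ (⌈x⌉₊ : ℝ) ≤ 2 * x :=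
  ⟨Nat.le_ceil x, by linarith [Nat.ceil_lt_add_one (zero_le_one.trans hx)]⟩

/-- Relations between the lengths of the stages and the accuracy `ε`, with `ℓ` of the order of the
logarithm of the number of rounds. -/
structure TunedLengths {n k : ℕ} (P : Params n k) (C₁ C₂ C₃ ε ℓ : ℝ) : Prop where
  eps_pos : 0 < ε
  eps_le : ε ≤ 1
  one_le_log : 1 ≤ ℓ
  pad_eq : P.tPad = P.tMove
  le_move : C₂ * ℓ / ε ^ 3 ≤ P.tMove
  move_le : P.tMove ≤ 2 * (C₂ * ℓ / ε ^ 3)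
  le_block : C₁ * ℓ / ε ^ 2 ≤ P.tBlock
  block_le : P.tBlock ≤ 2 * (C₁ * ℓ / ε ^ 2)
  acc_eq : P.accuracy = ε / C₃

variable {n k S : ℕ} {𝓜 : Set (PreferenceModel n)} {A : LocalLearner 𝓜 (uniformVec n) S}
  {P : Params n k} {L F R κ₁ κ₃ C₁ C₂ C₃ ε ℓ : ℝ}

lemma TuningConstants.one_le_C₃ (hC : TuningConstants n L F R κ₁ κ₃ C₁ C₂ C₃) (hn : 2 ≤ n) :
    1 ≤ C₃ := by
  have hn1 : (1 : ℝ) ≤ n := by exact_mod_cast (by omega : 1 ≤ n)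
  have hR := hC.R_pos
  have h1 : 1 ≤ (n : ℝ) ^ 3 := one_le_pow₀ hn1
  have h2 : 0 ≤ 2 * (n : ℝ) ^ 2 / R := by positivity
  rw [hC.C₃_eq]
  nlinarith

namespace TunedLengths

variable (hP : TunedLengths P C₁ C₂ C₃ ε ℓ) (hC : TuningConstants n L F R κ₁ κ₃ C₁ C₂ C₃)
include hP

lemma query_le (hk : 2 ≤ k) : (P.tQuery : ℝ) ≤ n * (2 * (C₁ * ℓ / ε ^ 2)) := by
  have h1 : (numQueryMenus n k : ℝ) ≤ n := by exact_mod_cast numQueryMenus_le hk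
  have h2 := hP.block_le
  rw [Params.tQuery, Nat.cast_mul]
  exact mul_le_mul h1 h2 (Nat.cast_nonneg _) (Nat.cast_nonneg _)

include hC

lemma move_pos : (0 : ℝ) < P.tMove := by
  have := hP.eps_pos; have := hP.one_le_log; have := hC.one_le_C₂
  exact lt_of_lt_of_le (by positivity) hP.le_move

lemma query_le_move (hk : 2 ≤ k) : 2 * (P.tQuery : ℝ) ≤ κ₃ * ε * P.tMove / 2 := by
  have hε := hP.eps_pos; have hℓ := hP.one_le_log; have hκ := hC.κ₃_pos
  have h1 := hP.query_le hk
  have h2 := hP.le_move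
  have h3 : κ₃ * ε * (C₂ * ℓ / ε ^ 3) ≤ κ₃ * ε * P.tMove := by gcongr
  have h4 : κ₃ * ε * (C₂ * ℓ / ε ^ 3) = κ₃ * C₂ * (ℓ / ε ^ 2) := by field_simp
  have h5 : 8 * n * C₁ * (ℓ / ε ^ 2) ≤ κ₃ * C₂ * (ℓ / ε ^ 2) := by
    have := hC.C₂_mul
    gcongr
  have h6 : (n : ℝ) * (2 * (C₁ * ℓ / ε ^ 2)) * 4 = 8 * n * C₁ * (ℓ / ε ^ 2) := by ring
  linarith

lemma learn_le (hn : 2 ≤ n) (hk : 2 ≤ k) (hS : 1 ≤ S) : (P.tLearn S : ℝ) ≤ 4 * S * P.tMove := by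
  have hε := hP.eps_pos; have hκ := hC.κ₃_pos
  have hn1 : (1 : ℝ) ≤ n := by exact_mod_cast (by omega : 1 ≤ n)
  have hS1 : (1 : ℝ) ≤ S := by exact_mod_cast hS
  have h1 := hP.query_le_move hC hk
  have hm := hP.move_pos hC
  have hκ1 : κ₃ ≤ 1 := hC.κ₃_le.trans (by rw [div_le_one (by positivity)]; linarith)
  have h2 : κ₃ * ε * P.tMove ≤ 1 * 1 * P.tMove := by gcongr; exact hP.eps_le
  rw [tLearn_eq, tCycle_eq, hP.pad_eq]
  push_cast
  have h3 : (S : ℝ) * (2 * P.tMove + P.tQuery) ≤ S * (3 * P.tMove) := by gcongr; linarith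
  have h4 : (1 : ℝ) * P.tMove ≤ S * P.tMove := by gcongr
  linarith

/-- The learning phase has at most `4 S` times the length of a move, so `α = k / (8 n ^ 2 S)` keeps
every shift of the target below `tMove / (2 n)`. The position error and the query together are at
most `κ₃ ε tMove`, and `κ₃` is small enough that the induced change of the scores is below the
sampling error `κ₁ ε`. -/
lemma learnConditions (hn : 2 ≤ n) (hk : 2 ≤ k) (hkn : k ≤ n) (hS : 1 ≤ S) (hα : P.alpha = k / (8 * n ^ 2 * S))
    (hF : F = A.errorFactor P.alpha) :
    LearnConditions A P L (ε ^ 2) (κ₃ / (2 * n) * ε * P.tMove)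
      (P.accuracy / A.errorFactor P.alpha) (κ₁ * ε) := by
  have hε := hP.eps_pos; have hε1 := hP.eps_le; have hℓ := hP.one_le_log
  have hκ := hC.κ₃_pos; have hκ₁ := hC.κ₁_pos
  have hn1 : (1 : ℝ) ≤ n := by exact_mod_cast (by omega : 1 ≤ n)
  have hS1 : (1 : ℝ) ≤ S := by exact_mod_cast hS
  have hk0 : (2 : ℝ) ≤ k := by exact_mod_cast hk
  have hkn' : (k : ℝ) ≤ n := by exact_mod_cast hkn
  have hC₃ := hC.one_le_C₃ hn
  have hm := hP.move_pos hC
  have hα0 : 0 < P.alpha := by rw [hα]; positivity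
  have hF0 : 0 < F := by rw [hF]; exact A.errorFactor_pos _ hα0
  have hq := hP.query_le_move hC hk
  have hD : n * (κ₃ / (2 * n) * ε * P.tMove) = κ₃ * ε * P.tMove / 2 := by field_simp
  have hsum : n * (κ₃ / (2 * n) * ε * P.tMove) + 2 * P.tQuery ≤ κ₃ * ε * P.tMove := by
    rw [hD]; linarith
  refine ⟨hP.pad_eq, by exact_mod_cast hm, ?_, by positivity, pow_le_one₀ hε.le hε1, by positivity,
    ?_, ?_, by positivity, ?_, ?_, ?_, hα0, ?_, ?_⟩
  · have : (0 : ℝ) < P.tBlock := by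
      have := hC.one_le_C₁
      exact lt_of_lt_of_le (by positivity) hP.le_block
    exact_mod_cast this
  · have h1 := hP.learn_le hC hn hk hS
    calc P.alpha * P.tLearn S ≤ k / (8 * n ^ 2 * S) * (4 * S * P.tMove) := by
          rw [hα]; gcongr
      _ = k * P.tMove / (2 * n ^ 2) := by field_simp; norm_num
      _ ≤ n * P.tMove / (2 * n ^ 2) := by gcongr
      _ = P.tMove / (2 * n) := by field_simp
  · refine hsum.trans ?_
    calc κ₃ * ε * P.tMove ≤ 1 / (2 * n) * 1 * P.tMove := by gcongr; exact hC.κ₃_le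
      _ = P.tMove / (2 * n) := by ring
  · exact (mul_le_of_le_one_right hκ₁.le hε1).trans hC.κ₁_le
  · rw [hP.acc_eq, ← hF, div_div, le_div_iff₀ (by positivity)]
    have := mul_le_mul_of_nonneg_right hC.κ₁_mul hε.le
    linarith
  · calc 4 * (n : ℝ) * (2 * n ^ 2 * |L| * (n * (κ₃ / (2 * n) * ε * P.tMove) + 2 * P.tQuery)
          / P.tMove)
        ≤ 4 * (n : ℝ) * (2 * n ^ 2 * |L| * (κ₃ * ε * P.tMove) / P.tMove) := by gcongr
      _ = 8 * n ^ 3 * |L| * κ₃ * ε := by field_simp; ring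
      _ ≤ κ₁ * ε := by gcongr; exact hC.κ₃_mul
  · rw [hP.acc_eq]; positivity
  · rw [hP.acc_eq, div_le_one (by positivity)]; linarith

/-- With `γ = ε ^ 2` the growth exponent `3 γ ^ 2 tMove` is of order `ε log T`, hence bounded,
whereas `γ D` is of order `ε ^ 3 tMove` and exceeds `3 log T`. This is why moves need about `log T /
ε ^ 3` rounds. -/
lemma moveFailure_le (hn : 2 ≤ n) {T : ℝ} (hT : 0 < T) (hlog : ℓ = Real.log T) (h1 : 6 * C₂ * (ε * ℓ) ≤ 1)
    (h2 : n + 18 * n * (C₂ * ℓ / ε) ≤ T) :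
    moveFailure n P.tMove (ε ^ 2) (κ₃ / (2 * n) * ε * P.tMove) ≤ 3 / T ^ 2 := by
  have hε := hP.eps_pos; have hℓ := hP.one_le_log; have hκ := hC.κ₃_pos
  have hn1 : (1 : ℝ) ≤ n := by exact_mod_cast (by omega : 1 ≤ n)
  have hle := hP.le_move
  have hge := hP.move_le
  have e1 : Real.exp (3 * (ε ^ 2) ^ 2 * P.tMove) ≤ 3 := by
    refine (Real.exp_le_exp.2 (?_ : _ ≤ (1 : ℝ))).trans (Real.exp_one_lt_d9.le.trans (by norm_num))
    calc 3 * (ε ^ 2) ^ 2 * P.tMove ≤ 3 * (ε ^ 2) ^ 2 * (2 * (C₂ * ℓ / ε ^ 3)) := by gcongr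
      _ = 6 * C₂ * (ε * ℓ) := by field_simp; ring
      _ ≤ 1 := h1
  have e2 : (n : ℝ) + P.tMove * (9 * n * ε ^ 2) ≤ T := by
    refine le_trans ?_ h2
    calc (n : ℝ) + P.tMove * (9 * n * ε ^ 2)
        ≤ n + 2 * (C₂ * ℓ / ε ^ 3) * (9 * n * ε ^ 2) := by gcongr
      _ = n + 18 * n * (C₂ * ℓ / ε) := by field_simp; ring
  have e3 : T ^ 3 ≤ Real.exp (ε ^ 2 * (κ₃ / (2 * n) * ε * P.tMove)) := by
    have : T ^ 3 = Real.exp (3 * ℓ) := by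
      rw [hlog, ← Real.log_rpow hT, Real.exp_log (by positivity)]
      exact_mod_cast rfl
    rw [this, Real.exp_le_exp]
    calc 3 * ℓ ≤ κ₃ * C₂ / (2 * n) * ℓ := by
          gcongr
          rw [le_div_iff₀ (by positivity)]
          linarith [hC.C₂_mul']
      _ = ε ^ 2 * (κ₃ / (2 * n) * ε * (C₂ * ℓ / ε ^ 3)) := by field_simp
      _ ≤ _ := by gcongr
  have e4 : (0 : ℝ) ≤ n + P.tMove * (9 * n * ε ^ 2) := by positivity
  rw [moveFailure]
  calc _ ≤ 3 * T / T ^ 3 := by gcongr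
    _ = 3 / T ^ 2 := by field_simp

/-- A block has about `log T / ε ^ 2` rounds, the number needed to see frequencies up to `κ₁ ε` with
failure `T ^ (-3)`. -/
lemma queryFailure_le (hn : 2 ≤ n) {T : ℝ} (hT : 0 < T) (hlog : ℓ = Real.log T) :
    queryFailure n P.tBlock (κ₁ * ε) ≤ 2 * n ^ 2 / T ^ 3 := by
  have hε := hP.eps_pos; have hℓ := hP.one_le_log; have hκ := hC.κ₁_pos
  have hn1 : (1 : ℝ) ≤ n := by exact_mod_cast (by omega : 1 ≤ n)
  have hle := hP.le_block
  have e3 : T ^ 3 ≤ Real.exp (P.tBlock * ((κ₁ * ε) ^ 2 / (24 * n))) := by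
    have : T ^ 3 = Real.exp (3 * ℓ) := by
      rw [hlog, ← Real.log_rpow hT, Real.exp_log (by positivity)]
      exact_mod_cast rfl
    rw [this, Real.exp_le_exp]
    calc 3 * ℓ ≤ C₁ * κ₁ ^ 2 / (24 * n) * ℓ := by
          gcongr
          rw [le_div_iff₀ (by positivity)]
          linarith [hC.C₁_mul]
      _ = C₁ * ℓ / ε ^ 2 * ((κ₁ * ε) ^ 2 / (24 * n)) := by field_simp
      _ ≤ _ := by gcongr
  rw [queryFailure, Real.exp_neg, ← div_eq_mul_inv]
  gcongr

lemma failure_le (hn : 2 ≤ n) {T : ℝ} (hlog : ℓ = Real.log T) (h1 : 6 * C₂ * (ε * ℓ) ≤ 1)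
    (h2 : n + 18 * n * (C₂ * ℓ / ε) ≤ T) (h3 : 3 * (1 + 2 * S) + 2 * S * n ^ 2 ≤ T) :
    moveFailure n P.tMove (ε ^ 2) (κ₃ / (2 * n) * ε * P.tMove) + S *
        (2 * moveFailure n P.tMove (ε ^ 2) (κ₃ / (2 * n) * ε * P.tMove)
          + queryFailure n P.tBlock (κ₁ * ε)) ≤ 1 / T := by
  have hT1 : 1 ≤ T := by
    have : (0 : ℝ) ≤ 2 * S * n ^ 2 := by positivity
    have : (0 : ℝ) ≤ S := by positivity
    linarith
  have hT : 0 < T := by linarith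
  have a1 := hP.moveFailure_le hC hn hT hlog h1 h2
  have a2 := hP.queryFailure_le hC hn hT hlog
  have a3 : 2 * (n : ℝ) ^ 2 / T ^ 3 ≤ 2 * n ^ 2 / T ^ 2 := by
    gcongr
    norm_num
  calc _ ≤ 3 / T ^ 2 + S * (2 * (3 / T ^ 2) + 2 * n ^ 2 / T ^ 2) := by gcongr; linarith
    _ = (3 * (1 + 2 * S) + 2 * S * n ^ 2) / T ^ 2 := by ring
    _ ≤ T / T ^ 2 := by gcongr
    _ = 1 / T := by field_simp

end TunedLengths

end Tuning

/-! ### Numerical consequences of the choice of parameters -/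

lemma exists_large (K : ℝ) : ∃ T₀ : ℕ, ∀ T : ℕ, T₀ ≤ T →
    1 ≤ Real.log T ∧ K ≤ (T : ℝ) ^ (1 / 4 : ℝ) ∧ K * Real.log T ≤ (T : ℝ) ^ (1 / 4 : ℝ) := by
  have h1 : ∀ᶠ T : ℕ in Filter.atTop, 1 ≤ Real.log T :=
    (Real.tendsto_log_atTop.comp tendsto_natCast_atTop_atTop).eventually_ge_atTop 1
  have h2 : ∀ᶠ T : ℕ in Filter.atTop, K ≤ (T : ℝ) ^ (1 / 4 : ℝ) :=
    ((tendsto_rpow_atTop (by norm_num : (0 : ℝ) < 1 / 4)).comp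
      tendsto_natCast_atTop_atTop).eventually_ge_atTop K
  have h3 : ∀ᶠ T : ℕ in Filter.atTop,
      ‖Real.log T‖ ≤ 1 / (|K| + 1) * ‖(T : ℝ) ^ (1 / 4 : ℝ)‖ :=
    ((isLittleO_log_rpow_atTop (by norm_num : (0 : ℝ) < 1 / 4)).comp_tendsto
      tendsto_natCast_atTop_atTop).def (by positivity)
  obtain ⟨T₀, hT₀⟩ := Filter.eventually_atTop.1 (h1.and (h2.and h3))
  refine ⟨T₀, fun T hT => ?_⟩
  obtain ⟨a1, a2, a3⟩ := hT₀ T hT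
  refine ⟨a1, a2, ?_⟩
  rw [Real.norm_of_nonneg (by linarith), Real.norm_of_nonneg (by positivity),
    one_div_mul_eq_div, le_div_iff₀ (by positivity)] at a3
  have : K * Real.log T ≤ |K| * Real.log T := by gcongr; exact le_abs_self K
  linarith

lemma rpow_quarter {T : ℝ} (hT : 0 ≤ T) :
    (T ^ (1 / 4 : ℝ)) ^ 4 = T ∧ T ^ (3 / 4 : ℝ) = (T ^ (1 / 4 : ℝ)) ^ 3 := by
  constructor
  · rw [← Real.rpow_natCast, ← Real.rpow_mul hT]; norm_num
  · rw [← Real.rpow_natCast, ← Real.rpow_mul hT]; norm_num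

/-- Both descent terms are of order `q ^ 3`: the first equals `n ^ 3 q ^ 3 / 4`, the second `n r (q
^ 3 / r ^ 3)`. They are absorbed by the length of the learning phase, which keeps the constant
absolute. -/
lemma regret_terms_le {t₀ T q n r R G e θ η ε eta : ℝ} (hT : T = q ^ 4) (hε : ε = r / q)
    (heta : eta = 2 / (n * q ^ 3)) (hθ : θ = (ε + ε) / r) (hη : η ≤ 1 / T)
    (he : e * (1 + 2 * n ^ 2 / R) ≤ ε) (hn : 1 ≤ n) (hr : 0 < r) (hnr : n * r ≤ 1) (hq : 0 < q)
    (hG : 0 ≤ G) (h1 : 1 ≤ t₀) (h2 : q ^ 3 / r ^ 3 ≤ t₀) (h3 : n ^ 3 * q ^ 3 / 4 ≤ t₀) :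
    t₀ + T * (η + (G * (3 * θ + e + n * ε) + 2 * n ^ 2 * (G * e / R)))
      + (n ^ 2 / (2 * eta) + T * (eta / 2 * (n / ε) ^ 2))
      ≤ 8 * (t₀ + n * G * q ^ 3 + (ε + ε) * G * T / r + ε * G * T) := by
  have hn0 : 0 < n := by linarith
  have hT0 : 0 < T := by rw [hT]; positivity
  have a1 : T * η ≤ 1 := by
    calc T * η ≤ T * (1 / T) := by gcongr
      _ = 1 := by field_simp
  have a2 : T * G * (e * (1 + 2 * n ^ 2 / R)) ≤ T * G * ε := by gcongr
  have a3 : T * (G * (n * ε)) ≤ n * G * q ^ 3 := by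
    calc T * (G * (n * ε)) = r * (n * G * q ^ 3) := by rw [hT, hε]; field_simp
      _ ≤ 1 * (n * G * q ^ 3) := by gcongr; nlinarith
      _ = _ := one_mul _
  have a4 : n ^ 2 / (2 * eta) ≤ t₀ := by
    refine le_trans (le_of_eq ?_) h3
    rw [heta]; field_simp; norm_num
  have a5 : T * (eta / 2 * (n / ε) ^ 2) ≤ t₀ := by
    refine le_trans ?_ h2
    calc T * (eta / 2 * (n / ε) ^ 2) = n * r * (q ^ 3 / r ^ 3) := by
          rw [hT, hε, heta]; field_simp
      _ ≤ 1 * (q ^ 3 / r ^ 3) := by gcongr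
      _ = _ := one_mul _
  have a6 : T * (G * (3 * θ)) = 3 * ((ε + ε) * G * T / r) := by rw [hθ]; ring
  have hε0 : 0 < ε := by rw [hε]; positivity
  have b1 : 0 ≤ n * G * q ^ 3 := by positivity
  have b2 : 0 ≤ (ε + ε) * G * T / r := by positivity
  have b3 : 0 ≤ ε * G * T := by positivity
  have e1 : T * (η + (G * (3 * θ + e + n * ε) + 2 * n ^ 2 * (G * e / R)))
      = T * η + T * (G * (3 * θ)) + T * G * (e * (1 + 2 * n ^ 2 / R)) + T * (G * (n * ε)) := by
    ring
  rw [e1]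
  linarith

lemma coarse_regret_le {t₀ n r a Q ℓ C x y : ℝ} (hr : r ≤ 1) (hn : 1 ≤ n)
    (hQ : 0 ≤ Q) (hℓ : 1 ≤ ℓ) (ht : t₀ ≤ a * (Q * ℓ)) (hC : 8 * (a + 4 * n ^ 2) ≤ C)
    (hx : x = 2 * n * Q) (hy : y = r * (n * Q)) :
    8 * (t₀ + n * n * Q + x + y) ≤ C * Q * ℓ := by
  have h0 : 0 ≤ n * Q := by positivity
  have h1 : r * (n * Q) ≤ n * Q := mul_le_of_le_one_left h0 hr
  have h2 : n * Q ≤ n * (n * Q) := le_mul_of_one_le_left h0 hn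
  have h3 : n * (n * Q) ≤ n * (n * Q) * ℓ := le_mul_of_one_le_right (by positivity) hℓ
  have h4 := mul_le_mul_of_nonneg_right hC (by positivity : 0 ≤ Q * ℓ)
  subst hx hy
  linarith

/-- Rewards in `[0, 1]` are `n`-Lipschitz whatever `G` is; this gives the second regret bound, whose
constant does not involve `G`. -/
lemma abs_linearReward_sub_le_of_mem_Icc {n : ℕ} {a : Fin n → ℝ}
    (ha : ∀ i, a i ∈ Set.Icc (0 : ℝ) 1) (x y : Fin n → ℝ) :
    |linearReward a x - linearReward a y| ≤ n * l2dist x y := by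
  rw [linearReward_sub, linearReward]
  refine (Finset.abs_sum_le_sum_abs _ _).trans ?_
  calc _ ≤ ∑ _i : Fin n, l2dist x y := by
        refine Finset.sum_le_sum fun i _ => ?_
        rw [abs_mul, abs_of_nonneg (ha i).1]
        exact (mul_le_of_le_one_left (abs_nonneg _) (ha i).2).trans (abs_sub_le_l2dist x y i)
    _ = _ := by simp

section Assembly

variable {n k S : ℕ} {𝓜 : Set (PreferenceModel n)} {A : LocalLearner 𝓜 (uniformVec n) S}
  {P : Params n k} {c L F R κ₁ κ₃ C₁ C₂ C₃ ε ℓ θ : ℝ} {M : PreferenceModel n} {lam : ℝ}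

/-- The value of `C₃` is chosen for this identity: the model error and its amplification in the
gradient together cost exactly `ε`. -/
lemma modelError_mul_le (hC : TuningConstants n L F R κ₁ κ₃ C₁ C₂ C₃) (hn : 2 ≤ n)
    (hacc : P.accuracy = ε / C₃) : modelError P * (1 + 2 * n ^ 2 / R) = ε := by
  have hn0 : (0 : ℝ) < n := by exact_mod_cast (by omega : 0 < n)
  have hC₃ := hC.one_le_C₃ hn
  rw [modelError, hacc]
  have : n * (2 * n ^ 2 * (ε / C₃)) * (1 + 2 * n ^ 2 / R)
      = (2 * n ^ 3 * (1 + 2 * n ^ 2 / R)) * ε / C₃ := by ring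
  rw [this, ← hC.C₃_eq, mul_div_cancel_left₀ _ (by linarith)]

lemma optConditions_of_tuned (hP : TunedLengths P C₁ C₂ C₃ ε ℓ)
    (hC : TuningConstants n L F R κ₁ κ₃ C₁ C₂ C₃) (hk : 2 ≤ k) (hkn : k ≤ n)
    (hr : P.r = R / n) (hδ : P.delta = ε) (hε : P.eps = ε) (hθ : θ = (ε + ε) / P.r) (hθ1 : θ < 1)
    (hball : ∀ w : Reduced n, ‖w‖ ≤ R → lift w ∈ entropySet n c)
    (hlp : ∀ s, CrossInHull k R s → ∀ x : Reduced n,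
      lift ((1 - θ)⁻¹ • x) ∈ menuHull k s →
      ∃ (z : Finset (Fin n) → ℝ) (ζ : Fin (n - 1) → Finset (Fin n) → ℝ),
        (∀ j, ∑ K, |ζ j K| ≤ 1 / R) ∧ (∀ j K, K.card ≠ k → ζ j K = 0) ∧
        ∀ w : Reduced n, ‖w‖ ≤ θ * P.r → (∀ K, P.lp.sol s x w K = z K + ∑ j, w j * ζ j K) ∧
          ∑ K, P.lp.sol s x w K • menuDist s K = lift (x + w)) : OptConditions A P c θ R := by
  have hn : 2 ≤ n := hk.trans hkn
  have hn1 : (1 : ℝ) ≤ n := by exact_mod_cast (by omega : 1 ≤ n)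
  have hε0 := hP.eps_pos
  have hR := hC.R_pos
  have hr0 : 0 < P.r := by rw [hr]; positivity
  have hC₃ := hC.one_le_C₃ hn
  have hacc0 : 0 < P.accuracy := by rw [hP.acc_eq]; positivity
  have hme := modelError_mul_le hC hn hP.acc_eq
  have h2n : 0 ≤ 2 * (n : ℝ) ^ 2 / R := by positivity
  have hme' : 2 * (n : ℝ) ^ 3 * P.accuracy ≤ ε := by
    have e : modelError P = 2 * n ^ 3 * P.accuracy := by rw [modelError]; ring
    rw [← e, ← hme]
    exact le_mul_of_one_le_right (by rw [e]; positivity) (by linarith)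
  have hθr : θ * P.r = ε + ε := by rw [hθ, div_mul_cancel₀ _ hr0.ne']
  have hεr : ε ≤ P.r := by nlinarith
  have hRθ : R * θ = n * (ε + ε) := by
    rw [← hθr, hr]; field_simp
  have hrle : P.r ≤ 1 / (4 * n ^ 3) := by
    rw [hr]
    calc R / n ≤ 1 / (4 * n ^ 2) / n := by gcongr; exact hC.R_le
      _ = 1 / (4 * (n : ℝ) ^ 3) := by field_simp
  refine ⟨hk, hkn, by rw [hθ]; positivity, hθ1, hr0, by rw [hδ]; exact hε0, by rw [hε]; exact hε0,
    by rw [hδ, hε, hθr], hR, hC.R_le, by rw [hr]; exact (mul_div_cancel₀ _ (by positivity)).le,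
    hball, hacc0, ?_, ?_, ?_, hlp⟩
  · refine le_trans ?_ (hεr.trans hrle)
    rw [hP.acc_eq]
    exact div_le_self hε0.le hC₃
  · rw [hRθ]
    nlinarith
  · have := hP.move_pos hC
    have h : 0 < P.tPad := by rw [hP.pad_eq]; exact_mod_cast this
    rw [tLearn_eq]
    omega

end Assembly

section Guarantees

variable {n k S : ℕ} {𝓜 : Set (PreferenceModel n)} {A : LocalLearner 𝓜 (uniformVec n) S}
  {P : Params n k} {c L F R κ₁ κ₃ C₁ C₂ C₃ ε θ q : ℝ} {M : PreferenceModel n} {lam : ℝ} {T : ℕ}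

/-- A run of `T = q ^ 4` rounds with tuned parameters, for `q` large. -/
structure TunedRun (A : LocalLearner 𝓜 (uniformVec n) S) (P : Params n k)
    (c L F R κ₁ κ₃ C₁ C₂ C₃ ε θ q : ℝ) (T : ℕ) : Prop where
  constants : TuningConstants n L F R κ₁ κ₃ C₁ C₂ C₃
  lengths : TunedLengths P C₁ C₂ C₃ ε (Real.log T)
  opt : OptConditions A P c θ R
  alpha_eq : P.alpha = k / (8 * n ^ 2 * S)
  errorFactor_eq : F = A.errorFactor P.alpha
  one_le : 1 ≤ S
  pow_eq : (T : ℝ) = q ^ 4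
  r_eq : P.r = R / n
  q_pos : 0 < q
  eps_def : ε = P.r / q
  delta_eq : P.delta = ε
  theta_def : θ = (ε + ε) / P.r
  eta_eq : P.eta = 2 / (n * q ^ 3)
  log_small : 8 * S * C₂ / P.r ^ 3 * Real.log T ≤ q
  large₁ : n ^ 3 / P.r ^ 2 ≤ q
  large₂ : 10 * n / P.r ≤ q
  large₃ : 3 * (1 + 2 * S) + 2 * S * n ^ 2 ≤ q

namespace TunedRun

variable (h : TunedRun A P c L F R κ₁ κ₃ C₁ C₂ C₃ ε θ q T)
include h

lemma two_le_n : 2 ≤ n := h.opt.two_le.trans h.opt.le_n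

lemma one_le_n : (1 : ℝ) ≤ n := h.opt.one_le_n

lemma one_le_q : 1 ≤ q := by
  have h1 := h.large₃
  have : (0 : ℝ) ≤ 2 * S * n ^ 2 := by positivity
  have : (0 : ℝ) ≤ S := by positivity
  linarith

lemma r_le : P.r ≤ 1 / (4 * n ^ 3) := by
  have hn := h.one_le_n
  rw [h.r_eq]
  calc R / n ≤ 1 / (4 * n ^ 2) / n := by gcongr; exact h.constants.R_le
    _ = 1 / (4 * (n : ℝ) ^ 3) := by field_simp

lemma r_le_one : P.r ≤ 1 := by
  refine h.r_le.trans ?_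
  have : 1 ≤ (n : ℝ) ^ 3 := one_le_pow₀ h.one_le_n
  rw [div_le_one (by positivity)]
  linarith

lemma mul_r_le_one : n * P.r ≤ 1 := by
  have hn := h.one_le_n
  calc n * P.r ≤ n * (1 / (4 * n ^ 3)) := by gcongr; exact h.r_le
    _ = 1 / (4 * (n : ℝ) ^ 2) := by field_simp
    _ ≤ 1 := by
        rw [div_le_one (by positivity)]
        nlinarith

lemma log_mul_le : 2 * C₂ * Real.log T ≤ q * P.r ^ 3 := by
  have hr := h.opt.r_pos
  have hS : (1 : ℝ) ≤ S := by exact_mod_cast h.one_le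
  have hC₂ := h.constants.one_le_C₂
  have hℓ := h.lengths.one_le_log
  have h1 := h.log_small
  rw [div_mul_eq_mul_div, div_le_iff₀ (by positivity)] at h1
  refine le_trans ?_ h1
  have : 1 * (C₂ * Real.log T) ≤ S * (C₂ * Real.log T) := by gcongr
  have : 0 ≤ C₂ * Real.log T := by positivity
  linarith

lemma learn_le : (P.tLearn S : ℝ) ≤ 8 * S * C₂ / P.r ^ 3 * (q ^ 3 * Real.log T) := by
  have hr := h.opt.r_pos
  have hq := h.q_pos
  have h1 := h.lengths.learn_le h.constants h.two_le_n h.opt.two_le h.one_le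
  have h2 := h.lengths.move_le
  calc (P.tLearn S : ℝ) ≤ 4 * S * (2 * (C₂ * Real.log T / ε ^ 3)) := h1.trans (by gcongr)
    _ = _ := by rw [h.eps_def]; field_simp; ring

lemma learn_le_T : P.tLearn S ≤ T := by
  have hq := h.q_pos
  have h1 := h.learn_le
  have : (P.tLearn S : ℝ) ≤ T := by
    rw [h.pow_eq]
    refine h1.trans ?_
    calc 8 * S * C₂ / P.r ^ 3 * (q ^ 3 * Real.log T)
        = q ^ 3 * (8 * S * C₂ / P.r ^ 3 * Real.log T) := by ring
      _ ≤ q ^ 3 * q := by gcongr; exact h.log_small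
      _ = q ^ 4 := by ring
  exact_mod_cast this

lemma le_learn : q ^ 3 / P.r ^ 3 ≤ P.tLearn S := by
  have hr := h.opt.r_pos
  have hq := h.q_pos
  have hC₂ := h.constants.one_le_C₂
  have hℓ := h.lengths.one_le_log
  have h1 : (P.tMove : ℝ) ≤ P.tLearn S := by
    rw [tLearn_eq, h.lengths.pad_eq]
    exact_mod_cast Nat.le_add_right _ _
  refine le_trans ?_ (h.lengths.le_move.trans h1)
  rw [h.eps_def]
  calc q ^ 3 / P.r ^ 3 = 1 * 1 / (P.r / q) ^ 3 := by field_simp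
    _ ≤ C₂ * Real.log T / (P.r / q) ^ 3 := by gcongr

lemma failure_le :
    moveFailure n P.tMove (ε ^ 2) (κ₃ / (2 * n) * ε * P.tMove) + S *
        (2 * moveFailure n P.tMove (ε ^ 2) (κ₃ / (2 * n) * ε * P.tMove)
          + queryFailure n P.tBlock (κ₁ * ε)) ≤ 1 / T := by
  have hr := h.opt.r_pos
  have hr1 := h.r_le_one
  have hq := h.q_pos
  have hq1 := h.one_le_q
  have hn := h.one_le_n
  have hC₂ := h.constants.one_le_C₂
  have hℓ := h.lengths.one_le_log
  have hlog := h.log_mul_le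
  have hr3 : P.r ^ 3 ≤ 1 := pow_le_one₀ hr.le hr1
  have hrn : 4 * P.r ≤ 1 := by
    have h1 := h.r_le
    have : 1 ≤ (n : ℝ) ^ 3 := one_le_pow₀ hn
    rw [le_div_iff₀ (by positivity)] at h1
    nlinarith
  have hTq : q ≤ T := by
    rw [h.pow_eq]
    exact le_self_pow₀ hq1 (by norm_num)
  refine h.lengths.failure_le h.constants h.two_le_n rfl ?_ ?_ (h.large₃.trans hTq)
  · calc 6 * C₂ * (ε * Real.log T) = 3 * (2 * C₂ * Real.log T) * (P.r / q) := by
          rw [h.eps_def]; ring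
      _ ≤ 3 * (q * P.r ^ 3) * (P.r / q) := by gcongr
      _ = 3 * P.r * P.r ^ 3 := by field_simp
      _ ≤ 3 * P.r * 1 := by gcongr
      _ ≤ 1 := by linarith
  · have h2 := h.large₂
    rw [div_le_iff₀ hr] at h2
    have h3 : C₂ * Real.log T / ε ≤ q ^ 2 / 2 := by
      rw [div_le_iff₀ h.lengths.eps_pos, h.eps_def]
      calc C₂ * Real.log T ≤ q * P.r ^ 3 / 2 := by linarith
        _ ≤ q * P.r / 2 := by
            gcongr
            exact pow_le_of_le_one hr.le hr1 (by norm_num)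
        _ = q ^ 2 / 2 * (P.r / q) := by field_simp
    calc (n : ℝ) + 18 * n * (C₂ * Real.log T / ε) ≤ n * q ^ 2 + 18 * n * (q ^ 2 / 2) := by
          gcongr
          exact le_mul_of_one_le_right (by positivity) (one_le_pow₀ hq1)
      _ = 10 * n * q ^ 2 := by ring
      _ ≤ q * P.r * q ^ 2 := by gcongr
      _ ≤ q * 1 * q ^ 2 := by gcongr
      _ ≤ q * q * q ^ 2 := by gcongr
      _ = T := by rw [h.pow_eq]; ring

lemma accuracy_le_one : P.accuracy ≤ 1 := by
  refine h.opt.acc_le.trans ?_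
  have : 1 ≤ (n : ℝ) ^ 3 := one_le_pow₀ h.one_le_n
  rw [div_le_one (by positivity)]
  linarith

lemma alpha_pos : 0 < P.alpha := by
  have hn := h.one_le_n
  have hS : (1 : ℝ) ≤ S := by exact_mod_cast h.one_le
  have hk : (0 : ℝ) < k := by exact_mod_cast (by have := h.opt.two_le; omega : 0 < k)
  rw [h.alpha_eq]
  positivity

lemma reaches (hlam : (k : ℝ) ^ 2 / n ≤ lam) (hM : Dispersed lam M) (hLip : LipschitzScores L M)
    (ρ : ℕ → Fin n → ℝ) (u : ℕ → Reduced n) :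
    Reaches (transition (algorithm A P c) M u) ρ (fun h => h = [])
      (CycleGood A P M (P.accuracy / A.errorFactor P.alpha)
        (n * (κ₃ / (2 * n) * ε * P.tMove)) S) (P.tLearn S) (1 / T) := by
  have hW := isTransition_algorithm (A := A) (P := P) (c := c) h.opt.two_le h.opt.le_n hlam hM u
  exact (reaches_learned h.opt.two_le h.opt.le_n hlam hM hLip hW
    (h.lengths.learnConditions h.constants h.two_le_n h.opt.two_le h.opt.le_n h.one_le h.alpha_eq
      h.errorFactor_eq)).mono hW (fun _ h => h) (fun _ h => h) h.failure_le

lemma regret_le (hlam : (k : ℝ) ^ 2 / n ≤ lam) (hM𝓜 : M ∈ 𝓜) (hM : Dispersed lam M)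
    (hLip : LipschitzScores L M) {ρ : Fin T → Fin n → ℝ}
    (hρ : ∀ t i, ρ t i ∈ Set.Icc (0 : ℝ) 1) {G : ℝ} (hG0 : 0 ≤ G)
    (ha : ∀ t, ∀ x ∈ stdSimplex ℝ (Fin n), ∀ y ∈ stdSimplex ℝ (Fin n),
      |linearReward (ρ t) x - linearReward (ρ t) y| ≤ G * l2dist x y)
    {x : Fin n → ℝ} (hx : x ∈ entropySet n c ∩ EIRD k M.score) :
    regretAgainst (algorithm A P c) M ρ x
      ≤ 8 * (P.tLearn S + n * G * q ^ 3 + (ε + ε) * G * T / P.r + ε * G * T) := by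
  classical
  have hn := h.one_le_n
  have hr := h.opt.r_pos
  have hq := h.q_pos
  have hfail : ∀ u, (stepE (transition (algorithm A P c) M u) (rewardSeq ρ))^[P.tLearn S]
      (fun h => 1 - goodInd A P M h) [] ≤ 1 / T := fun u => by
    have hW := isTransition_algorithm (A := A) (P := P) (c := c) h.opt.two_le h.opt.le_n hlam hM u
    refine le_trans (iterate_mono hW fun l _ => ?_) (h.reaches hlam hM hLip _ u [] rfl)
    by_cases hG : GoodModel A P M l
    · rw [goodInd, if_pos hG, sub_self]; split_ifs <;> norm_num
    · rw [goodInd, if_neg hG, if_neg fun hc => hG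
        (goodModel_of_cycleGood hM𝓜 h.alpha_pos h.opt.acc_pos h.accuracy_le_one hc), sub_zero]
  have h1 := h.opt.regret_le hlam hM h.learn_le_T hρ hG0 ha (by positivity) hfail
    (by rw [h.eta_eq]; positivity) hx
  rw [h.delta_eq] at h1
  refine h1.trans ?_
  have hl := h.le_learn
  have hq3 : 1 ≤ q ^ 3 := one_le_pow₀ h.one_le_q
  have hn3 : n ^ 3 * q ^ 3 ≤ q ^ 3 / P.r ^ 3 := by
    rw [le_div_iff₀ (by positivity)]
    calc n ^ 3 * q ^ 3 * P.r ^ 3 = (n * P.r) ^ 3 * q ^ 3 := by ring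
      _ ≤ 1 * q ^ 3 := by
          gcongr
          exact pow_le_one₀ (by positivity) h.mul_r_le_one
      _ = q ^ 3 := one_mul _
  have hn3' : 1 ≤ (n : ℝ) ^ 3 := one_le_pow₀ hn
  have hq0 : 0 ≤ (n : ℝ) ^ 3 * q ^ 3 := by positivity
  exact regret_terms_le h.pow_eq h.eps_def h.eta_eq h.theta_def le_rfl
    (modelError_mul_le h.constants h.two_le_n h.lengths.acc_eq).le hn hr h.mul_r_le_one hq hG0
    (by nlinarith) hl (by linarith)

lemma le_probability (hlam : (k : ℝ) ^ 2 / n ≤ lam) (hM𝓜 : M ∈ 𝓜) (hM : Dispersed lam M)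
    (hLip : LipschitzScores L M) (ρ : Fin T → Fin n → ℝ) :
    1 - 8 / q ≤ probability (algorithm A P c) M ρ
      (fun τ => EntropySatisfied c (8 * ε) (memory (observed ρ τ))) := by
  have hn := h.one_le_n
  have hr := h.opt.r_pos
  have hq := h.q_pos
  have hq1 := h.one_le_q
  have hε := h.lengths.eps_pos
  have hκ := h.constants.κ₃_pos
  have hT : (0 : ℝ) < T := by rw [h.pow_eq]; positivity
  have hm : (P.tMove : ℝ) ≤ T := by
    have h1 : P.tMove ≤ P.tLearn S := by
      rw [tLearn_eq, h.lengths.pad_eq]; exact Nat.le_add_right _ _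
    exact_mod_cast h1.trans h.learn_le_T
  have hme : modelError P ≤ ε := by
    rw [← modelError_mul_le h.constants h.two_le_n h.lengths.acc_eq]
    have hR := h.constants.R_pos
    have : 0 ≤ 2 * (n : ℝ) ^ 2 / R := by positivity
    exact le_mul_of_one_le_right h.opt.modelError_nonneg (by linarith)
  -- The choice `y = T ε / n` lets the martingale part contribute `ε` to the distance, while its
  -- Chebyshev failure is `n ^ 3 / (r ^ 2 q ^ 2) ≤ 1 / q`. The learning deviation and the model
  -- error cost at most `ε` each.
  have key := h.opt.le_probability_entropySatisfied hlam hM hM𝓜 h.alpha_pos h.accuracy_le_one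
    h.learn_le_T ρ (B := n * (κ₃ / (2 * n) * ε * P.tMove)) (y := T * ε / n) (η := 1 / T)
    (e := 8 * ε) (by positivity) ?_ (h.reaches hlam hM hLip _)
  · refine le_trans ?_ key
    have h1 : 1 / (T : ℝ) ≤ 1 / q := by
      apply one_div_le_one_div_of_le hq
      rw [h.pow_eq]; exact le_self_pow₀ hq1 (by norm_num)
    have h2 : n * (T : ℝ) / (T * ε / n) ^ 2 ≤ 1 / q := by
      calc n * (T : ℝ) / (T * ε / n) ^ 2 = n ^ 3 / P.r ^ 2 / q ^ 2 := by
            rw [h.pow_eq, h.eps_def]; field_simp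
        _ ≤ q / q ^ 2 := by gcongr; exact h.large₁
        _ = 1 / q := by field_simp
    have h3 : 8 / q = 8 * (1 / q) := by ring
    have h4 : 0 < 1 / q := by positivity
    linarith
  · have e1 : n * ((n * (κ₃ / (2 * n) * ε * P.tMove) + T * ε / n) / T + 2 * n ^ 2 * P.accuracy)
        = n * κ₃ / 2 * ε * (P.tMove / T) + ε + modelError P := by
      rw [modelError]; field_simp
    rw [e1]
    have h1 : n * κ₃ ≤ 1 := by
      calc n * κ₃ ≤ n * (1 / (2 * n)) := by gcongr; exact h.constants.κ₃_le
        _ = 1 / 2 := by field_simp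
        _ ≤ 1 := by norm_num
    have h2 : n * κ₃ / 2 * ε * (P.tMove / T) ≤ 1 / 2 * ε * 1 := by
      gcongr
      exact (div_le_one hT).2 hm
    linarith

end TunedRun

end Guarantees

theorem mainTheorem1 :
    ∃ (C : ℝ) (p : ℕ), 0 < C ∧
    ∀ (n k S : ℕ) (lam L c : ℝ) (𝓜 : Set (PreferenceModel n))
      (A : LocalLearner 𝓜 (uniformVec n) S),
      2 ≤ k → k ≤ n → 1 ≤ S → (k : ℝ) ^ 2 / n ≤ lam → c < Real.log n →
    ∃ r α : ℝ, 0 < r ∧ r ≤ C * ((k : ℝ) ^ 2 / n) ∧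
      (k : ℝ) / ((n : ℝ) ^ 2 * S) / C ≤ α ∧ α ≤ C * ((k : ℝ) / ((n : ℝ) ^ 2 * S)) ∧
    ∃ (C' : ℝ) (T₀ : ℕ), 0 < C' ∧
    ∀ T : ℕ, T₀ ≤ T →
    ∃ P : Params n k,
      P.r = r ∧ P.alpha = α ∧
      P.eps = r / (T : ℝ) ^ (1 / 4 : ℝ) ∧ P.delta = r / (T : ℝ) ^ (1 / 4 : ℝ) ∧
      P.eta = 2 / (n * (T : ℝ) ^ (3 / 4 : ℝ)) ∧
      (P.eps / C' ≤ P.accuracy ∧ P.accuracy ≤ P.eps) ∧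
      (1 / P.eps ^ 3 / C' ≤ P.tPad ∧ P.tPad ≤ C' * Real.log T ^ p / P.eps ^ 3) ∧
      (1 / P.eps ^ 3 / C' ≤ P.tMove ∧ P.tMove ≤ C' * Real.log T ^ p / P.eps ^ 3) ∧
      (1 / P.eps ^ 2 / C' ≤ P.tQuery ∧ P.tQuery ≤ C' * Real.log T ^ p / P.eps ^ 2) ∧
      ((P.tLearn S : ℝ) ≤ C' * (T : ℝ) ^ (3 / 4 : ℝ) * Real.log T ^ p) ∧
      ∀ M ∈ 𝓜, Dispersed lam M → LipschitzScores L M →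
      ∀ (G : ℝ) (ρ : Fin T → Fin n → ℝ),
        (∀ t i, ρ t i ∈ Set.Icc (0 : ℝ) 1) →
        (∀ t, ∀ x ∈ stdSimplex ℝ (Fin n), ∀ y ∈ stdSimplex ℝ (Fin n),
          |linearReward (ρ t) x - linearReward (ρ t) y| ≤ G * l2dist x y) →
        (∀ x ∈ entropySet n c ∩ EIRD k M.score,
          regretAgainst (algorithm A P c) M ρ x ≤
              C * (P.tLearn S + n * G * (T : ℝ) ^ (3 / 4 : ℝ) +
                (P.delta + P.eps) * G * T / r + P.eps * G * T) ∧
          regretAgainst (algorithm A P c) M ρ x ≤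
              C' * (T : ℝ) ^ (3 / 4 : ℝ) * Real.log T ^ p) ∧
        1 - C / (T : ℝ) ^ (1 / 4 : ℝ) ≤
          probability (algorithm A P c) M ρ
            (fun τ => EntropySatisfied c (C * P.eps) (memory (observed ρ τ))) := by
  refine ⟨8, 1, by norm_num, fun n k S lam L c 𝓜 A hk hkn hS hlam hc => ?_⟩
  have hn2 : 2 ≤ n := hk.trans hkn
  have hn1 : (1 : ℝ) ≤ n := by exact_mod_cast (by omega : 1 ≤ n)
  have hk1 : (1 : ℝ) ≤ k := by exact_mod_cast (by omega : 1 ≤ k)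
  have hS1 : (1 : ℝ) ≤ S := by exact_mod_cast hS
  obtain ⟨R₀, hR₀, hball₀⟩ := exists_ball_subset_entropySet (by omega : 1 ≤ n) hc
  obtain ⟨R, hR, hRn, hball⟩ : ∃ R : ℝ, 0 < R ∧ R ≤ 1 / (4 * n ^ 2) ∧
      ∀ w : Reduced n, ‖w‖ ≤ R → lift w ∈ entropySet n c :=
    ⟨min R₀ (1 / (4 * n ^ 2)), by positivity, min_le_right _ _,
      fun w hw => hball₀ w (hw.trans (min_le_left _ _))⟩
  -- A ball of radius `R / n` is what the affine weights over the cross-polytope of radius `R` can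
  -- serve.
  obtain ⟨r, hrdef⟩ : ∃ r : ℝ, r = R / n := ⟨_, rfl⟩
  obtain ⟨α, hαdef⟩ : ∃ α : ℝ, α = k / (8 * n ^ 2 * S) := ⟨_, rfl⟩
  have hr : 0 < r := by rw [hrdef]; positivity
  have hα : 0 < α := by rw [hαdef]; positivity
  have hr1 : r ≤ 1 := by
    rw [hrdef, div_le_one (by positivity)]
    refine hRn.trans (le_trans ?_ hn1)
    rw [div_le_one (by positivity)]
    nlinarith
  obtain ⟨κ₁, κ₃, C₁, C₂, C₃, hC⟩ :=
    exists_tuningConstants hn2 L (A.errorFactor_pos α hα) hR hRn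
  have hC₁ := hC.one_le_C₁
  have hC₂ := hC.one_le_C₂
  have hC₃ := hC.one_le_C₃ hn2
  obtain ⟨C', hC'1, hC'2, hC'3, hC'4, hC'5⟩ : ∃ C' : ℝ, C₃ ≤ C' ∧ 2 * C₂ ≤ C' ∧ 2 * n * C₁ ≤ C' ∧
      8 * S * C₂ / r ^ 3 ≤ C' ∧ 8 * (8 * S * C₂ / r ^ 3 + 4 * n ^ 2) ≤ C' := by
    have b1 : 0 ≤ 2 * n * C₁ := by positivity
    have b2 : 0 ≤ 8 * S * C₂ / r ^ 3 := by positivity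
    have b3 : 0 ≤ 8 * (8 * S * C₂ / r ^ 3 + 4 * (n : ℝ) ^ 2) := by positivity
    refine ⟨C₃ + 2 * C₂ + 2 * n * C₁ + 8 * S * C₂ / r ^ 3
      + 8 * (8 * S * C₂ / r ^ 3 + 4 * n ^ 2), ?_, ?_, ?_, ?_, ?_⟩ <;> linarith
  have hC'0 : 1 ≤ C' := hC₃.trans hC'1
  -- Requirements on `q = T ^ (1 / 4)`: `θ = 2 / q < 1`, a learning phase no longer than `T`, the
  -- Chebyshev bound, and the two conditions for a failure probability of at most `1 / T`.
  obtain ⟨K, hK1, hK2, hK3, hK4, hK5⟩ : ∃ K : ℝ, 3 ≤ K ∧ 8 * S * C₂ / r ^ 3 ≤ K ∧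
      n ^ 3 / r ^ 2 ≤ K ∧ 10 * n / r ≤ K ∧ 3 * (1 + 2 * S) + 2 * S * n ^ 2 ≤ K := by
    have b2 : 0 ≤ 8 * S * C₂ / r ^ 3 := by positivity
    have b3 : 0 ≤ n ^ 3 / r ^ 2 := by positivity
    have b4 : 0 ≤ 10 * n / r := by positivity
    have b5 : 0 ≤ 3 * (1 + 2 * S) + 2 * S * (n : ℝ) ^ 2 := by positivity
    refine ⟨3 + 8 * S * C₂ / r ^ 3 + n ^ 3 / r ^ 2 + 10 * n / r
      + (3 * (1 + 2 * S) + 2 * S * n ^ 2), ?_, ?_, ?_, ?_, ?_⟩ <;> linarith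
  obtain ⟨T₀, hT₀⟩ := exists_large K
  have hkS : (k : ℝ) / ((n : ℝ) ^ 2 * S) / 8 = α := by rw [hαdef]; field_simp
  have hkS0 : 0 < (k : ℝ) / ((n : ℝ) ^ 2 * S) := by positivity
  refine ⟨r, α, hr, ?_, hkS.le, by linarith, C', T₀, by linarith, fun T hT => ?_⟩
  · have h1 : r ≤ 1 / n := by
      rw [hrdef]
      gcongr
      refine hRn.trans ?_
      rw [div_le_one (by positivity)]
      nlinarith
    have h2 : (1 : ℝ) / n ≤ k ^ 2 / n := by
      gcongr
      exact one_le_pow₀ hk1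
    linarith [h1.trans h2]
  obtain ⟨hℓ, hKq, hKℓ⟩ := hT₀ T hT
  obtain ⟨hq4, hq3⟩ := rpow_quarter (Nat.cast_nonneg T)
  rw [hq3]
  obtain ⟨q, hq⟩ : ∃ q : ℝ, q = (T : ℝ) ^ (1 / 4 : ℝ) := ⟨_, rfl⟩
  rw [← hq] at hKq hKℓ hq4 ⊢
  have hq0 : 0 < q := by linarith
  obtain ⟨ε, hεdef⟩ : ∃ ε : ℝ, ε = r / q := ⟨_, rfl⟩
  have hε : 0 < ε := by rw [hεdef]; positivity
  have hε1 : ε ≤ 1 := by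
    rw [hεdef, div_le_one hq0]; linarith
  obtain ⟨θ, hθdef⟩ : ∃ θ : ℝ, θ = (ε + ε) / r := ⟨_, rfl⟩
  have hθ0 : 0 < θ := by rw [hθdef]; positivity
  have hθ1 : θ < 1 := by
    rw [hθdef, div_lt_one hr, hεdef]
    have : r / q ≤ r / 3 := by gcongr; linarith
    linarith
  obtain ⟨lp, hlp⟩ := exists_affine_solver hkn hn2 hθ0 hθ1 hR
    (by rw [hrdef]; exact (mul_div_cancel₀ _ (by positivity)).le : n * r ≤ R)
  have hx3 : 1 ≤ 1 / ε ^ 3 := by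
    rw [le_div_iff₀ (by positivity), one_mul]; exact pow_le_one₀ hε.le hε1
  have hx2 : 1 ≤ 1 / ε ^ 2 := by
    rw [le_div_iff₀ (by positivity), one_mul]; exact pow_le_one₀ hε.le hε1
  have hCℓ2 : 1 ≤ C₂ * Real.log T := one_le_mul_of_one_le_of_one_le hC₂ hℓ
  have hCℓ1 : 1 ≤ C₁ * Real.log T := one_le_mul_of_one_le_of_one_le hC₁ hℓ
  have hmove : 1 / ε ^ 3 ≤ C₂ * Real.log T / ε ^ 3 := by gcongr
  have hblock : 1 / ε ^ 2 ≤ C₁ * Real.log T / ε ^ 2 := by gcongr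
  obtain ⟨hm1, hm2⟩ := le_ceil_and_ceil_le (hx3.trans hmove)
  obtain ⟨hb1, hb2⟩ := le_ceil_and_ceil_le (hx2.trans hblock)
  let P : Params n k :=
    { tPad := ⌈C₂ * Real.log T / ε ^ 3⌉₊
      tMove := ⌈C₂ * Real.log T / ε ^ 3⌉₊
      tBlock := ⌈C₁ * Real.log T / ε ^ 2⌉₊
      alpha := α
      accuracy := ε / C₃
      r := r
      delta := ε
      eps := ε
      eta := 2 / (n * q ^ 3)
      lp := lp }
  have hP : TunedLengths P C₁ C₂ C₃ ε (Real.log T) :=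
    ⟨hε, hε1, hℓ, rfl, hm1, hm2, hb1, hb2, rfl⟩
  have hrun : TunedRun A P c L (A.errorFactor α) R κ₁ κ₃ C₁ C₂ C₃ ε θ q T :=
    { constants := hC
      lengths := hP
      opt := optConditions_of_tuned hP hC hk hkn hrdef rfl rfl hθdef hθ1 hball hlp
      alpha_eq := hαdef
      errorFactor_eq := rfl
      one_le := hS
      pow_eq := hq4.symm
      r_eq := hrdef
      q_pos := hq0
      eps_def := hεdef
      delta_eq := rfl
      theta_def := hθdef
      eta_eq := rfl
      log_small := (mul_le_mul_of_nonneg_right hK2 (by linarith)).trans hKℓ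
      large₁ := hK3.trans hKq
      large₂ := hK4.trans hKq
      large₃ := hK5.trans hKq }
  have hq30 : 0 ≤ q ^ 3 := by positivity
  have hlearn := hrun.learn_le
  simp only [pow_one]
  have hm3 : (⌈C₂ * Real.log T / ε ^ 3⌉₊ : ℝ) ≤ C' * Real.log T / ε ^ 3 := by
    refine hm2.trans ?_
    rw [← mul_div_assoc, ← mul_assoc]
    gcongr
  have hlow3 : 1 / ε ^ 3 / C' ≤ ⌈C₂ * Real.log T / ε ^ 3⌉₊ :=
    (div_le_self (by positivity) hC'0).trans (hmove.trans hm1)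
  refine ⟨P, rfl, rfl, hεdef, hεdef, rfl, ⟨?_, ?_⟩, ⟨hlow3, hm3⟩, ⟨hlow3, hm3⟩, ⟨?_, ?_⟩, ?_,
    fun M hM𝓜 hM hLip G ρ hρ hG => ⟨fun x hx => ⟨?_, ?_⟩, ?_⟩⟩
  · change ε / C' ≤ ε / C₃
    gcongr
  · exact div_le_self hε.le hC₃
  · refine (div_le_self (by positivity) hC'0).trans ((hblock.trans hb1).trans ?_)
    rw [Params.tQuery]
    exact_mod_cast Nat.le_mul_of_pos_left _ (numQueryMenus_pos hk hkn)
  · refine (hP.query_le hk).trans ?_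
    change (n : ℝ) * (2 * (C₁ * Real.log T / ε ^ 2)) ≤ C' * Real.log T / ε ^ 2
    rw [show (n : ℝ) * (2 * (C₁ * Real.log T / ε ^ 2)) = 2 * n * C₁ * Real.log T / ε ^ 2 by ring]
    gcongr
  · rw [mul_assoc]
    exact hlearn.trans (mul_le_mul_of_nonneg_right hC'4 (by positivity))
  · have hT1 : 0 < T := by
      have : (0 : ℝ) < T := by rw [← hq4]; positivity
      exact_mod_cast this
    exact hrun.regret_le hlam hM𝓜 hM hLip hρ (lipschitzConst_nonneg hn2 (hG ⟨0, hT1⟩)) hG hx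
  -- The bound free of `G` comes from the first one with the Lipschitz constant `n`.
  · have h1 := hrun.regret_le hlam hM𝓜 hM hLip hρ (G := n) (by positivity)
      (fun t x _ y _ => abs_linearReward_sub_le_of_mem_Icc (hρ t) x y) hx
    refine h1.trans ?_
    exact coarse_regret_le hr1 hn1 hq30 hℓ hlearn hC'5
      (by change (ε + ε) * n * T / r = 2 * n * q ^ 3
          rw [← hq4, hεdef]; field_simp; norm_num)
      (by rw [← hq4, hεdef]; field_simp)
  · exact hrun.le_probability hlam hM𝓜 hM hLip ρ
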